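/- Let $1<p<\infty$ and let $d$ be a dimension. Call the intervals $[2^{k-1},2^k)$ and $(-2^k,-2^{k-1}]$, $k\in\mathbb Z$, the dyadic intervals of $\mathbb R\setminus\{0\}$, and let $\Delta$ be the family of all $d$-fold products of such intervals. For $R\in\Delta$ let $S_R$ be the partial sum operator on $L_p(\mathbb R^d)$, $\widehat{S_R f}=\mathbf 1_R\widehat f$ (that is, convolution with the inverse Fourier transform of $\mathbf 1_R$), and put $$S^{\Delta}(f)=\Big(\sum_{R\in\Delta}|S_R f|^2\Big)^{1/2},\qquad f\in L_p(\mathbb R^d).$$ Call the sets $I\cap\mathbb Z$, with $I$ a dyadic interval of $\mathbb R\setminus\{0\}$, together with $\{0\}$, the dyadic intervals of $\mathbb Z$, and let $\widetilde\Delta$ be the family of all $d$-fold products of dyadic intervals of $\mathbb Z$ (its nonempty members partition $\mathbb Z^d$). Let $\mathbb T^d=(\mathbb R/\mathbb Z)^d$ carry its normalized Haar measure, and for $f\in L_p(\mathbb T^d)$ and $R\in\widetilde\Delta$ put $S_R f(x)=\sum_{m\in R}\widehat f(m)e^{2\pi i\, m\cdot x}$ and $$S^{\widetilde\Delta}(f)=\Big(\sum_{R\in\widetilde\Delta}|S_R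 f|^2\Big)^{1/2}.$$ Let $\mathsf L^{\Delta}_{c,p,d}$ and $\mathsf L^{\Delta}_{t,p,d}$ be the best (that is, least) constants in $[0,\infty]$ (a constant being $\infty$ if the corresponding inequality fails with every finite constant) such that $$\big(\mathsf L^{\Delta}_{t,p,d}\big)^{-1}\|f\|_p\le\|S^{\Delta}(f)\|_p\le \mathsf L^{\Delta}_{c,p,d}\|f\|_p,\qquad f\in L_p(\mathbb R^d),$$ and let $\mathsf L^{\widetilde\Delta}_{c,p,d}$ and $\mathsf L^{\widetilde\Delta}_{t,p,d}$ be the best constants, in the same sense, such that $$\big(\mathsf L^{\widetilde\Delta}_{t,p,d}\big)^{-1}\|f\|_p\le\|S^{\widetilde\Delta}(f)\|_p\le \mathsf L^{\widetilde\Delta}_{c,p,d}\|f\|_p,\qquad f\in L_p(\mathbb T^d).$$ Then $$\mathsf L^{\Delta}_{c,p,d}=\mathsf L^{\widetilde\Delta}_{c,p,d}\quad\text{and}\quad \mathsf L^{\Delta}_{t,p,d}=\mathsf L^{\widetilde\Delta}_{t,p,d}.$$ -/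

import Mathlib

open MeasureTheory Set
open scoped ENNReal FourierTransform

noncomputable section

namespace DyadicLP

/-- The dyadic intervals of `ℝ \ {0}`: `[2^(k-1), 2^k)` and `(-2^k, -2^(k-1)]` for `k ∈ ℤ`. -/
def dyadicIntervals : Set (Set ℝ) :=
  {I | ∃ k : ℤ, I = Ico ((2 : ℝ) ^ (k - 1)) ((2 : ℝ) ^ k) ∨
    I = Ioc (-(2 : ℝ) ^ k) (-(2 : ℝ) ^ (k - 1))}

/-- The family `Δ` of dyadic rectangles of `ℝ^d`: all `d`-fold products of dyadic intervals. -/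
def dyadicRectangles (d : ℕ) : Set (Set (EuclideanSpace ℝ (Fin d))) :=
  {R | ∃ I : Fin d → Set ℝ, (∀ i, I i ∈ dyadicIntervals) ∧ R = {ξ | ∀ i, ξ i ∈ I i}}

/-- The dyadic intervals of `ℤ`: the traces on `ℤ` of the dyadic intervals of `ℝ \ {0}`, together
with the block `{0}`, so that they cover `ℤ`. -/
def intDyadicIntervals : Set (Set ℤ) :=
  {J | J = {0} ∨ ∃ I ∈ dyadicIntervals, J = {n : ℤ | (n : ℝ) ∈ I}}

/-- The dyadic partition of `ℤ^d`: all `d`-fold products of dyadic intervals of `ℤ`.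
(The empty trace may occur as a member; its partial sum operator is zero.) -/
def intDyadicRectangles (d : ℕ) : Set (Set (Fin d → ℤ)) :=
  {R | ∃ J : Fin d → Set ℤ, (∀ i, J i ∈ intDyadicIntervals) ∧ R = {m | ∀ i, m i ∈ J i}}

/-- The partial sum operator `S_R` on `ℝ^d`, i.e. the Fourier multiplier with symbol `1_R`, for a
bounded rectangle `R`: convolution with the kernel `𝓕⁻ 1_R`, that is `x ↦ ∫_R e^{2πi⟨ξ, x⟩} dξ`.
This kernel lies in `L_q` for every `q > 1`, so the integral converges absolutely at every `x`
for every `f ∈ L_p` with `1 < p < ∞`; for `f ∈ L_1 ∩ L_p` it equals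
`∫_R (𝓕 f)(ξ) e^{2πi⟨ξ, x⟩} dξ`. -/
def partialSum {d : ℕ} (R : Set (EuclideanSpace ℝ (Fin d)))
    (f : EuclideanSpace ℝ (Fin d) → ℂ) (x : EuclideanSpace ℝ (Fin d)) : ℂ :=
  ∫ y, f y * (𝓕⁻ (R.indicator fun _ => (1 : ℂ))) (x - y)

/-- The dyadic square function `S^Δ(f) = (∑_{R ∈ Δ} |S_R f|²)^{1/2}` on `ℝ^d`, with values
in `[0, ∞]`. -/
def squareFunction {d : ℕ} (f : EuclideanSpace ℝ (Fin d) → ℂ)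
    (x : EuclideanSpace ℝ (Fin d)) : ℝ≥0∞ :=
  (∑' R : dyadicRectangles d, ‖partialSum (R : Set (EuclideanSpace ℝ (Fin d))) f x‖ₑ ^ 2) ^
    (1 / 2 : ℝ)

/-- Normalized Haar measure on the torus `𝕋^d = (ℝ/ℤ)^d`. -/
def torusMeasure (d : ℕ) : Measure (UnitAddTorus (Fin d)) :=
  Measure.pi fun _ => (AddCircle.haarAddCircle : Measure UnitAddCircle)

/-- The Fourier coefficient `∫ f(z) e^{-2πi⟨m, z⟩} dz` of a function on `𝕋^d`. -/
def torusCoeff {d : ℕ} (f : UnitAddTorus (Fin d) → ℂ) (m : Fin d → ℤ) : ℂ :=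
  ∫ z, f z * UnitAddTorus.mFourier (-m) z ∂torusMeasure d

/-- The partial sum operator `S_R f = ∑_{m ∈ R} f̂(m) e^{2πi⟨m, ·⟩}` on `𝕋^d`, for a finite
set `R` of frequencies. -/
def torusPartialSum {d : ℕ} (R : Set (Fin d → ℤ)) (f : UnitAddTorus (Fin d) → ℂ)
    (z : UnitAddTorus (Fin d)) : ℂ :=
  ∑ᶠ m ∈ R, torusCoeff f m * UnitAddTorus.mFourier m z

/-- The dyadic square function on `𝕋^d`, with values in `[0, ∞]`. -/
def torusSquareFunction {d : ℕ} (f : UnitAddTorus (Fin d) → ℂ)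
    (z : UnitAddTorus (Fin d)) : ℝ≥0∞ :=
  (∑' R : intDyadicRectangles d, ‖torusPartialSum (R : Set (Fin d → ℤ)) f z‖ₑ ^ 2) ^ (1 / 2 : ℝ)

/-- The best constant in `‖S^Δ f‖_p ≤ C ‖f‖_p`, `f ∈ L_p(ℝ^d)` (`∞` if there is no finite one). -/
def cotypeConst (p : ℝ≥0∞) (d : ℕ) : ℝ≥0∞ :=
  sInf {C : ℝ≥0∞ | ∀ f : EuclideanSpace ℝ (Fin d) → ℂ, MemLp f p volume →
    eLpNorm (squareFunction f) p volume ≤ C * eLpNorm f p volume}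

/-- The best constant in `C⁻¹ ‖f‖_p ≤ ‖S^Δ f‖_p`, `f ∈ L_p(ℝ^d)` (`∞` if there is no finite one). -/
def typeConst (p : ℝ≥0∞) (d : ℕ) : ℝ≥0∞ :=
  sInf {C : ℝ≥0∞ | ∀ f : EuclideanSpace ℝ (Fin d) → ℂ, MemLp f p volume →
    C⁻¹ * eLpNorm f p volume ≤ eLpNorm (squareFunction f) p volume}

/-- The best constant in `‖S f‖_p ≤ C ‖f‖_p`, `f ∈ L_p(𝕋^d)` (`∞` if there is no finite one). -/
def torusCotypeConst (p : ℝ≥0∞) (d : ℕ) : ℝ≥0∞ :=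
  sInf {C : ℝ≥0∞ | ∀ f : UnitAddTorus (Fin d) → ℂ, MemLp f p (torusMeasure d) →
    eLpNorm (torusSquareFunction f) p (torusMeasure d) ≤ C * eLpNorm f p (torusMeasure d)}

/-- The best constant in `C⁻¹ ‖f‖_p ≤ ‖S f‖_p`, `f ∈ L_p(𝕋^d)` (`∞` if there is no finite one). -/
def torusTypeConst (p : ℝ≥0∞) (d : ℕ) : ℝ≥0∞ :=
  sInf {C : ℝ≥0∞ | ∀ f : UnitAddTorus (Fin d) → ℂ, MemLp f p (torusMeasure d) →
    C⁻¹ * eLpNorm f p (torusMeasure d) ≤ eLpNorm (torusSquareFunction f) p (torusMeasure d)}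

end DyadicLP

end

/-! Each inequality is transferred between `ℝ^d` and `𝕋^d` with the same constant. No boundedness of
the square functions is presupposed, so both sides may be infinite.

From the torus to `ℝ^d`. Take `g` rapidly decreasing, with spectrum at positive distance from the
boundaries of all dyadic rectangles and from the coordinate hyperplanes, and periodize it over `2^N
ℤ^d`. By Poisson summation the Fourier coefficients are `2^{-Nd} ĝ(2^{-N} m)`. Dyadic rectangles are
invariant under dilation by `2^N`, so the blocks of `ℤ^d` sort these coefficients exactly as `Δ`
sorts `ĝ`; the blocks containing a factor `{0}` see nothing. Hence the torus partial sums of the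
periodization are the periodizations of the `S_R g`. On the cube of side `2^N` periodization changes
a function of decay order `d + 1` by `O(2^{-N(d+1)})`, which is `O(2^{-N})` in `L_p` of the cube.
The normalizing powers of `2^N` on the two sides cancel, and Fatou's lemma gives the estimate for
`g` as `N → ∞` (`WellLocalized.eLpNorm_squareFunction_le`, `WellLocalized.mul_eLpNorm_le`).

From `ℝ^d` to the torus. For a trigonometric polynomial `f`, an affine map `m ↦ (1 + η) m + ζ` moves
its finitely many frequencies into the interiors of dyadic rectangles without changing which of them
share a block (`exists_frequencies`). Multiplying the characters by one function `Ψ` of small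
spectrum gives functions `g z` on `ℝ^d`, `z ∈ 𝕋^d`, with `|g z x| = |Ψ x| |f(z + s x)|`, and with
the same identity between the square functions. Integrating the `p`-th powers over `z` gives the
torus norms times `‖Ψ‖_p^p` exactly, with no limit involved (`exists_modulated_model`,
`lintegral_eLpNorm_translates`).

Density. For the upper estimate it suffices to approximate in `L_p`, because the norm of the square
function is lower semicontinuous. For the lower estimate the approximants must not have a much
larger square function. They are therefore obtained by convolution, for which `S(K * f) ≤ |K| * S f`
pointwise. On `ℝ^d` one has moreover to clear the spectrum near finitely many hyperplanes: this
subtracts a convolution with a kernel spread out in one direction, which is small in `L_p` because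
`p > 1` (`exists_wellLocalized_approx`, `exists_trigPoly_approx`). -/

noncomputable section

namespace DyadicLP

open Filter Topology

/-! ### The `ℓ²` norm on families in `[0, ∞]`: Minkowski and lower semicontinuity. -/

section L2

variable {ι : Type*}

/-- The `ℓ²` norm of a family of extended nonnegative reals. -/
def l2 (a : ι → ℝ≥0∞) : ℝ≥0∞ := (∑' i, a i ^ 2) ^ (1 / 2 : ℝ)

lemma l2_sq (a : ι → ℝ≥0∞) : l2 a ^ 2 = ∑' i, a i ^ 2 := by
  rw [l2, ← ENNReal.rpow_natCast, ← ENNReal.rpow_mul]; norm_num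

lemma l2_mono {a b : ι → ℝ≥0∞} (h : ∀ i, a i ≤ b i) : l2 a ≤ l2 b := by
  unfold l2; gcongr with i; exact h i

lemma le_l2 (a : ι → ℝ≥0∞) (i : ι) : a i ≤ l2 a := by
  have : a i ^ 2 ≤ l2 a ^ 2 := by rw [l2_sq]; exact ENNReal.le_tsum i
  exact le_of_sq_le_sq this
where
  le_of_sq_le_sq {x y : ℝ≥0∞} (h : x ^ 2 ≤ y ^ 2) : x ≤ y :=
    (ENNReal.pow_le_pow_left_iff two_ne_zero).1 h

lemma l2_mul_left (c : ℝ≥0∞) (a : ι → ℝ≥0∞) : l2 (fun i => c * a i) = c * l2 a := by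
  unfold l2
  simp_rw [mul_pow, ENNReal.tsum_mul_left]
  rw [ENNReal.mul_rpow_of_nonneg _ _ (by norm_num), ← ENNReal.rpow_natCast, ← ENNReal.rpow_mul]
  norm_num

/-- With counting measure and the discrete σ-algebra, the triangle inequality for `l2` becomes that
of `L_2`. -/
lemma l2_eq_eLpNorm (a : ι → ℝ≥0∞) :
    l2 a = @eLpNorm ι ℝ≥0∞ _ ⊤ a 2 (@Measure.count ι ⊤) := by
  let _ : MeasurableSpace ι := ⊤
  rw [eLpNorm_eq_lintegral_rpow_enorm_toReal (by norm_num) (by norm_num), lintegral_count]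
  simp [l2]

lemma l2_add_le (a b : ι → ℝ≥0∞) : l2 (fun i => a i + b i) ≤ l2 a + l2 b := by
  let _ : MeasurableSpace ι := ⊤
  simp_rw [l2_eq_eLpNorm]
  exact eLpNorm_add_le measurable_from_top.aestronglyMeasurable
    measurable_from_top.aestronglyMeasurable (by norm_num)

/-- Reduction to finite subfamilies, where Cauchy–Schwarz and passage to the limit are elementary.
-/
lemma l2_eq_iSup (a : ι → ℝ≥0∞) :
    l2 a = ⨆ s : Finset ι, (∑ i ∈ s, a i ^ 2) ^ (1 / 2 : ℝ) := by
  rw [l2, ENNReal.tsum_eq_iSup_sum]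
  exact (ENNReal.orderIsoRpow (1 / 2) (by norm_num)).map_iSup _

variable {X : Type*} [MeasurableSpace X] {μ : Measure X}

lemma measurable_l2 [Countable ι] {a : X → ι → ℝ≥0∞} (h : ∀ i, Measurable fun x => a x i) :
    Measurable fun x => l2 (a x) := by
  unfold l2
  exact (Measurable.tsum fun i => (h i).pow_const 2).pow_const _

/-- Minkowski's inequality: the `ℓ²` norm of an integral is at most the integral of the
`ℓ²` norms. -/
lemma l2_lintegral_le {a : X → ι → ℝ≥0∞} (h : ∀ i, AEMeasurable (fun x => a x i) μ) :
    l2 (fun i => ∫⁻ x, a x i ∂μ) ≤ ∫⁻ x, l2 (a x) ∂μ := by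
  rw [l2_eq_iSup]
  refine iSup_le fun s => ?_
  set A : ι → ℝ≥0∞ := fun i => ∫⁻ x, a x i ∂μ with hA
  set T : ℝ≥0∞ := ∑ i ∈ s, A i ^ 2 with hT
  rcases eq_or_ne T 0 with h0 | h0
  · simp [h0]
  by_cases htop : ∃ i ∈ s, A i = ∞
  · obtain ⟨i, -, hi⟩ := htop
    have : ∞ ≤ ∫⁻ x, l2 (a x) ∂μ := by
      rw [← hi]; exact lintegral_mono fun x => le_l2 _ i
    exact le_trans le_top this
  push Not at htop
  have hTtop : T ≠ ∞ := by
    rw [hT]; exact ENNReal.sum_ne_top.2 fun i hi => ENNReal.pow_ne_top (htop i hi)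
  -- Duality with the vector `A` of integrals as its own test vector, followed by Cauchy–Schwarz
  -- under the integral. The conclusion divides by `T ^ (1 / 2)`, which is why `T = 0` and infinite
  -- entries were split off.
  have key : T ≤ T ^ (1 / 2 : ℝ) * ∫⁻ x, l2 (a x) ∂μ := by
    calc T = ∑ i ∈ s, ∫⁻ x, A i * a x i ∂μ := by
          refine Finset.sum_congr rfl fun i hi => ?_
          rw [lintegral_const_mul' _ _ (htop i hi), sq]
      _ = ∫⁻ x, ∑ i ∈ s, A i * a x i ∂μ :=
          (lintegral_finsetSum' _ fun i _ => (h i).const_mul _).symm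
      _ ≤ ∫⁻ x, T ^ (1 / 2 : ℝ) * l2 (a x) ∂μ := by
          refine lintegral_mono fun x => ?_
          have := ENNReal.inner_le_Lp_mul_Lq s A (a x) (p := 2) (q := 2)
            (by constructor <;> norm_num)
          refine this.trans ?_
          simp only [ENNReal.rpow_ofNat]
          gcongr
          rw [l2_eq_iSup]
          exact le_iSup (fun s : Finset ι => (∑ i ∈ s, a x i ^ 2) ^ (1 / 2 : ℝ)) s
      _ = _ := lintegral_const_mul' _ _ (ENNReal.rpow_ne_top_of_nonneg (by norm_num) hTtop)
  have e : T = T ^ (1 / 2 : ℝ) * T ^ (1 / 2 : ℝ) := by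
    rw [← ENNReal.rpow_add _ _ h0 hTtop]; norm_num
  have h1 : T ^ (1 / 2 : ℝ) ≠ 0 := by simp [h0, hTtop]
  have h2 : T ^ (1 / 2 : ℝ) ≠ ∞ := ENNReal.rpow_ne_top_of_nonneg (by norm_num) hTtop
  nth_rewrite 1 [e] at key
  exact (ENNReal.mul_le_mul_iff_right h1 h2).1 key

lemma l2_tsum_le {κ : Type*} (a : κ → ι → ℝ≥0∞) :
    l2 (fun i => ∑' k, a k i) ≤ ∑' k, l2 (a k) := by
  let _ : MeasurableSpace κ := ⊤
  simp_rw [← lintegral_count]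
  exact l2_lintegral_le fun i => measurable_from_top.aemeasurable

/-- Fatou for sums. Finite partial sums converge, and each is dominated by the full norm. -/
lemma l2_le_liminf {a : ι → ℝ≥0∞} {b : ℕ → ι → ℝ≥0∞}
    (h : ∀ i, Tendsto (fun n => b n i) atTop (𝓝 (a i))) :
    l2 a ≤ liminf (fun n => l2 (b n)) atTop := by
  rw [l2_eq_iSup]
  refine iSup_le fun s => ?_
  have : Tendsto (fun n => (∑ i ∈ s, b n i ^ 2) ^ (1 / 2 : ℝ)) atTop
      (𝓝 ((∑ i ∈ s, a i ^ 2) ^ (1 / 2 : ℝ))) := by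
    refine (ENNReal.continuous_rpow_const.tendsto _).comp ?_
    exact tendsto_finsetSum _ fun i _ => (ENNReal.continuous_pow 2).continuousAt.tendsto.comp (h i)
  rw [← this.liminf_eq]
  refine liminf_le_liminf (Eventually.of_forall fun n => ?_)
  rw [l2_eq_iSup]
  exact le_iSup (fun s : Finset ι => (∑ i ∈ s, b n i ^ 2) ^ (1 / 2 : ℝ)) s

end L2

/-! ### Fatou and Jensen inequalities in `L_p`. -/

section Lp

variable {X : Type*} [MeasurableSpace X] {μ : Measure X} {p : ℝ≥0∞}

lemma eLpNorm_rpow_eq_lintegral (hp0 : p ≠ 0) (hp : p ≠ ∞) {ε : Type*} [ENorm ε] (f : X → ε) :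
    eLpNorm f p μ ^ p.toReal = ∫⁻ x, ‖f x‖ₑ ^ p.toReal ∂μ := by
  rw [eLpNorm_eq_lintegral_rpow_enorm_toReal hp0 hp, ← ENNReal.rpow_mul, one_div,
    inv_mul_cancel₀ (ENNReal.toReal_pos hp0 hp).ne', ENNReal.rpow_one]

/-- Fatou's lemma for `L_p` norms. -/
lemma eLpNorm_le_liminf (hp0 : p ≠ 0) (hp : p ≠ ∞) {u : X → ℝ≥0∞} {v : ℕ → X → ℝ≥0∞}
    (hv : ∀ n, AEMeasurable (v n) μ) (h : ∀ᵐ x ∂μ, u x ≤ liminf (fun n => v n x) atTop) :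
    eLpNorm u p μ ≤ liminf (fun n => eLpNorm (v n) p μ) atTop := by
  have hp' := ENNReal.toReal_pos hp0 hp
  have hiso : ∀ w : ℕ → ℝ≥0∞, (liminf w atTop) ^ p.toReal = liminf (fun n => w n ^ p.toReal) atTop :=
    fun w => (ENNReal.orderIsoRpow p.toReal hp').liminf_apply (u := w) (f := atTop)
  rw [← ENNReal.rpow_le_rpow_iff hp', hiso]
  simp_rw [eLpNorm_rpow_eq_lintegral hp0 hp]
  refine le_trans (lintegral_mono_ae ?_) (lintegral_liminf_le' fun n => (hv n).pow_const _)
  filter_upwards [h] with x hx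
  simp only [enorm_eq_self]
  rw [← hiso]
  gcongr

/-- Jensen's inequality for the power `r ≥ 1` and a finite density `k`. -/
lemma rpow_lintegral_mul_le {k u : X → ℝ≥0∞} (hk : AEMeasurable k μ) (hu : AEMeasurable u μ)
    {r : ℝ} (hr : 1 ≤ r) :
    (∫⁻ x, k x * u x ∂μ) ^ r ≤ (∫⁻ x, k x ∂μ) ^ (r - 1) * ∫⁻ x, k x * u x ^ r ∂μ := by
  rcases hr.eq_or_lt with rfl | hr
  · simp
  have hr0 : 0 < r := by linarith
  have hc := Real.HolderConjugate.conjExponent hr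
  set s := Real.conjExponent r
  have hs0 : 0 < s := hc.symm.pos
  -- Split `k = k^{1/s} k^{1/r}` with `s` conjugate to `r`, so that Hölder leaves the total mass of
  -- `k` to the power `r / s = r - 1`.
  have h1 : ∫⁻ x, k x * u x ∂μ = ∫⁻ x, (fun x => k x ^ (1 / s)) x * (fun x => k x ^ (1 / r) * u x) x ∂μ := by
    refine lintegral_congr fun x => ?_
    simp only
    rw [← mul_assoc, ← ENNReal.rpow_add_of_nonneg _ _ (by positivity) (by positivity)]
    have : 1 / s + 1 / r = 1 := by have := hc.inv_add_inv_eq_one; rw [one_div, one_div]; linarith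
    rw [this, ENNReal.rpow_one]
  have h2 := ENNReal.lintegral_mul_le_Lp_mul_Lq μ hc.symm (hk.pow_const (1 / s))
    ((hk.pow_const (1 / r)).mul hu)
  rw [h1]
  refine (ENNReal.rpow_le_rpow h2 hr0.le).trans (le_of_eq ?_)
  rw [ENNReal.mul_rpow_of_nonneg _ _ hr0.le]
  simp only [Pi.mul_apply, ← ENNReal.rpow_mul, ENNReal.mul_rpow_of_nonneg _ _ hr0.le]
  congr 1
  · congr 1
    · simp [hs0.ne']
    · have := hc.sub_one_mul_conj; rw [div_mul_eq_mul_div, one_mul, div_eq_iff hs0.ne', this]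
  · rw [one_div, inv_mul_cancel₀ hr0.ne', ENNReal.rpow_one]
    simp

end Lp

/-! ### Minkowski and Young inequalities for nonnegative kernels. -/

section Conv

variable {G : Type*} [AddCommGroup G] [MeasurableSpace G] [MeasurableAdd₂ G] [MeasurableNeg G]
  {μ : Measure G} [SFinite μ] [μ.IsAddLeftInvariant] {p q : ℝ≥0∞}

/-- Minkowski's inequality for averages of a family of functions. -/
lemma eLpNorm_lintegral_mul_le {X Y : Type*} [MeasurableSpace X] [MeasurableSpace Y]
    {μ : Measure X} {ν : Measure Y} [SFinite μ] [SFinite ν]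
    (hp1 : 1 ≤ p) (hp : p ≠ ∞) {k : Y → ℝ≥0∞} (hk : AEMeasurable k ν) (hk1 : ∫⁻ y, k y ∂ν ≠ ∞)
    {F : X → Y → ℝ≥0∞} (hF : AEMeasurable (Function.uncurry F) (μ.prod ν)) :
    eLpNorm (fun x => ∫⁻ y, k y * F x y ∂ν) p μ ^ p.toReal ≤
      (∫⁻ y, k y ∂ν) ^ (p.toReal - 1) * ∫⁻ y, k y * eLpNorm (fun x => F x y) p μ ^ p.toReal ∂ν := by
  have hp0 : p ≠ 0 := (zero_lt_one.trans_le hp1).ne'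
  have hr : 1 ≤ p.toReal := by
    rw [← ENNReal.toReal_one]; exact (ENNReal.toReal_le_toReal (by simp) hp).2 hp1
  simp_rw [eLpNorm_rpow_eq_lintegral hp0 hp, enorm_eq_self]
  have hF' : ∀ᵐ x ∂μ, AEMeasurable (F x) ν := by
    filter_upwards [hF.aestronglyMeasurable.prodMk_left] with x hx using hx.aemeasurable
  calc _ ≤ ∫⁻ x, (∫⁻ y, k y ∂ν) ^ (p.toReal - 1) * ∫⁻ y, k y * F x y ^ p.toReal ∂ν ∂μ := by
        refine lintegral_mono_ae ?_
        filter_upwards [hF'] with x hx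
        exact rpow_lintegral_mul_le hk hx hr
    _ = (∫⁻ y, k y ∂ν) ^ (p.toReal - 1) * ∫⁻ x, ∫⁻ y, k y * F x y ^ p.toReal ∂ν ∂μ :=
        lintegral_const_mul' _ _ (ENNReal.rpow_ne_top_of_nonneg (by linarith) hk1)
    _ = _ := by
        rw [lintegral_lintegral_swap]
        · congr 1
          refine lintegral_congr_ae ?_
          filter_upwards [hF.prod_swap.aestronglyMeasurable.prodMk_left] with y hy
          exact lintegral_const_mul'' _ (hy.aemeasurable.pow_const _)
        · exact (hk.comp_snd (μ := μ)).mul (hF.pow_const _)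

/-- Young's inequality `‖k * u‖_p ≤ ‖k‖_1 ‖u‖_p` for nonnegative functions. -/
lemma eLpNorm_lconv_le (hp1 : 1 ≤ p) (hp : p ≠ ∞) {k u : G → ℝ≥0∞} (hk : AEMeasurable k μ)
    (hk1 : ∫⁻ y, k y ∂μ ≠ ∞) (hu : AEMeasurable u μ) :
    eLpNorm (fun x => ∫⁻ z, k z * u (x - z) ∂μ) p μ ≤ (∫⁻ z, k z ∂μ) * eLpNorm u p μ := by
  have hp0 : p ≠ 0 := (zero_lt_one.trans_le hp1).ne'
  have hr : 1 ≤ p.toReal := by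
    rw [← ENNReal.toReal_one]; exact (ENNReal.toReal_le_toReal (by simp) hp).2 hp1
  have hr0 : 0 < p.toReal := by linarith
  rw [← ENNReal.rpow_le_rpow_iff hr0]
  refine (eLpNorm_lintegral_mul_le hp1 hp hk hk1 (F := fun x z => u (x - z)) ?_).trans ?_
  · exact hu.comp_quasiMeasurePreserving (quasiMeasurePreserving_sub_of_right_invariant μ μ)
  · have : ∀ z, eLpNorm (fun x => u (x - z)) p μ = eLpNorm u p μ := fun z => by
      have hm : MeasurePreserving (fun x => x - z) μ μ := measurePreserving_sub_right μ z
      exact eLpNorm_comp_measurePreserving hu.aestronglyMeasurable hm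
    simp_rw [this]
    rw [lintegral_mul_const'' _ hk, ENNReal.mul_rpow_of_nonneg _ _ hr0.le, ← mul_assoc]
    gcongr
    rcases eq_or_ne (∫⁻ z, k z ∂μ) 0 with h0 | h0
    · simp [h0]
    nth_rewrite 2 [← ENNReal.rpow_one (∫⁻ z, k z ∂μ)]
    rw [← ENNReal.rpow_add _ _ h0 hk1]; simp

end Conv

end DyadicLP

end

noncomputable section

namespace DyadicLP

open Filter Topology

/-! ### Convolution of complex functions on an abelian group. -/

section Convolution

variable {G : Type*} [AddCommGroup G] [MeasurableSpace G]

/-- The convolution of two complex functions on an abelian group. -/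
def conv (μ : Measure G) (K f : G → ℂ) (x : G) : ℂ := ∫ z, K z * f (x - z) ∂μ

variable [MeasurableAdd₂ G] [MeasurableNeg G]
  {μ : Measure G} [SFinite μ] [μ.IsAddLeftInvariant] [μ.IsNegInvariant] {p q : ℝ≥0∞}

lemma conv_comm (K f : G → ℂ) (x : G) : conv μ K f x = conv μ f K x := by
  unfold conv
  rw [← integral_sub_left_eq_self (fun z => K z * f (x - z)) μ x]
  simp [mul_comm]

lemma MemLp.comp_sub_left {f : G → ℂ} (hf : MemLp f p μ) (x : G) :
    MemLp (fun z => f (x - z)) p μ :=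
  hf.comp_measurePreserving (Measure.measurePreserving_sub_left μ x)

lemma eLpNorm_comp_sub_left {f : G → ℂ} (hf : AEStronglyMeasurable f μ) (x : G) :
    eLpNorm (fun z => f (x - z)) p μ = eLpNorm f p μ :=
  eLpNorm_comp_measurePreserving hf (Measure.measurePreserving_sub_left μ x)

lemma integrable_mul_comp_sub [p.HolderConjugate q] {K f : G → ℂ} (hK : MemLp K p μ)
    (hf : MemLp f q μ) (x : G) : Integrable (fun z => K z * f (x - z)) μ :=
  hK.integrable_mul (MemLp.comp_sub_left hf x)

lemma enorm_conv_le_lintegral (K f : G → ℂ) (x : G) :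
    ‖conv μ K f x‖ₑ ≤ ∫⁻ z, ‖K z‖ₑ * ‖f (x - z)‖ₑ ∂μ := by
  simp_rw [← enorm_mul]; exact enorm_integral_le_lintegral_enorm _

lemma lintegral_mul_comp_sub_le [hpq : p.HolderConjugate q] {K f : G → ℂ}
    (hK : AEStronglyMeasurable K μ) (hf : AEStronglyMeasurable f μ) (x : G) :
    ∫⁻ z, ‖K z‖ₑ * ‖f (x - z)‖ₑ ∂μ ≤ eLpNorm K p μ * eLpNorm f q μ := by
  have h := eLpNorm_smul_le_mul_eLpNorm (μ := μ) (r := 1) (p := p) (q := q)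
    (f := fun z => f (x - z)) (φ := K) (hf.comp_measurePreserving (Measure.measurePreserving_sub_left μ x)) hK
  rw [eLpNorm_comp_sub_left hf, eLpNorm_one_eq_lintegral_enorm] at h
  simpa [enorm_mul] using h

lemma enorm_conv_le [p.HolderConjugate q] {K f : G → ℂ} (hK : AEStronglyMeasurable K μ)
    (hf : AEStronglyMeasurable f μ) (x : G) :
    ‖conv μ K f x‖ₑ ≤ eLpNorm K p μ * eLpNorm f q μ :=
  (enorm_conv_le_lintegral K f x).trans (lintegral_mul_comp_sub_le hK hf x)

lemma conv_congr_right {K f g : G → ℂ} (h : f =ᵐ[μ] g) : conv μ K f = conv μ K g := by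
  ext x
  refine integral_congr_ae ?_
  have := (Measure.measurePreserving_sub_left μ x).quasiMeasurePreserving.ae_eq_comp h
  filter_upwards [this] with z hz
  simp only [Function.comp] at hz
  rw [hz]

lemma conv_congr_left {K L f : G → ℂ} (h : K =ᵐ[μ] L) : conv μ K f = conv μ L f := by
  ext x
  refine integral_congr_ae ?_
  filter_upwards [h] with z hz
  rw [hz]

lemma stronglyMeasurable_conv {K f : G → ℂ} (hK : AEStronglyMeasurable K μ)
    (hf : AEStronglyMeasurable f μ) : StronglyMeasurable (conv μ K f) := by
  rw [conv_congr_left hK.ae_eq_mk, conv_congr_right hf.ae_eq_mk]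
  refine StronglyMeasurable.integral_prod_right (f := fun x z => hK.mk K z * hf.mk f (x - z)) ?_
  exact (hK.stronglyMeasurable_mk.comp_measurable measurable_snd).mul
    (hf.stronglyMeasurable_mk.comp_measurable (measurable_fst.sub measurable_snd))

lemma eLpNorm_conv_le (hp1 : 1 ≤ p) (hp : p ≠ ∞) {K f : G → ℂ} (hK : Integrable K μ)
    (hf : AEStronglyMeasurable f μ) :
    eLpNorm (conv μ K f) p μ ≤ (∫⁻ z, ‖K z‖ₑ ∂μ) * eLpNorm f p μ := by
  refine (eLpNorm_mono_enorm (g := fun x => ∫⁻ z, ‖K z‖ₑ * ‖f (x - z)‖ₑ ∂μ)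
    fun x => enorm_conv_le_lintegral K f x).trans ?_
  refine (eLpNorm_lconv_le hp1 hp hK.1.enorm hK.2.ne hf.enorm).trans_eq ?_
  rw [eLpNorm_enorm]

lemma memLp_conv (hp1 : 1 ≤ p) (hp : p ≠ ∞) {K f : G → ℂ} (hK : Integrable K μ)
    (hf : MemLp f p μ) : MemLp (conv μ K f) p μ :=
  ⟨(stronglyMeasurable_conv hK.1 hf.1).aestronglyMeasurable,
    (eLpNorm_conv_le hp1 hp hK hf.1).trans_lt (ENNReal.mul_lt_top hK.2 hf.2)⟩

/-- Fubini: after a translation, the inner integral is at most `‖f‖_p ‖g‖_q` by Hölder, and `V` is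
integrable. The identity holds at every point, which is what makes convolution commute with partial
sums pointwise. -/
lemma conv_assoc [p.HolderConjugate q] {V f g : G → ℂ} (hV : Integrable V μ)
    (hf : MemLp f p μ) (hg : MemLp g q μ) (x : G) :
    conv μ V (conv μ f g) x = conv μ (conv μ V f) g x := by
  have hm1 : Measure.QuasiMeasurePreserving (fun y : G × G => y.1 - y.2) (μ.prod μ) μ :=
    quasiMeasurePreserving_sub_of_right_invariant μ μ
  have hmeas : AEStronglyMeasurable (fun y : G × G => V y.2 * f (y.1 - y.2) * g (x - y.1))
      (μ.prod μ) := by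
    refine ((hV.1.comp_snd).mul (hf.1.comp_quasiMeasurePreserving hm1)).mul ?_
    exact (AEStronglyMeasurable.comp_measurePreserving hg.1
      (Measure.measurePreserving_sub_left μ x)).comp_fst
  have hint : Integrable (fun y : G × G => V y.2 * f (y.1 - y.2) * g (x - y.1)) (μ.prod μ) := by
    refine ⟨hmeas, ?_⟩
    rw [HasFiniteIntegral, lintegral_prod_symm _ hmeas.enorm]
    have : ∀ z, ∫⁻ y, ‖V z * f (y - z) * g (x - y)‖ₑ ∂μ ≤
        ‖V z‖ₑ * (eLpNorm f p μ * eLpNorm g q μ) := fun z => by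
      simp_rw [mul_assoc, enorm_mul (V z)]
      rw [lintegral_const_mul' _ _ enorm_ne_top]
      gcongr
      rw [← lintegral_add_right_eq_self _ z]
      simp_rw [add_sub_cancel_right, enorm_mul, ← sub_sub, sub_right_comm x _ z]
      exact lintegral_mul_comp_sub_le hf.1 hg.1 (x - z)
    refine (lintegral_mono this).trans_lt ?_
    rw [lintegral_mul_const'' _ hV.1.enorm]
    exact ENNReal.mul_lt_top hV.2 (ENNReal.mul_lt_top hf.2 hg.2)
  calc conv μ V (conv μ f g) x = ∫ z, ∫ y, V z * f (y - z) * g (x - y) ∂μ ∂μ := by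
        unfold conv
        refine integral_congr_ae (Eventually.of_forall fun z => ?_)
        simp only
        rw [← integral_const_mul, ← integral_add_right_eq_self (fun y => V z * f (y - z) * g (x - y)) z]
        refine integral_congr_ae (Eventually.of_forall fun y => ?_)
        simp only [add_sub_cancel_right, ← sub_sub, sub_right_comm x _ z, mul_assoc]
    _ = ∫ y, ∫ z, V z * f (y - z) * g (x - y) ∂μ ∂μ :=
        (integral_integral_swap (f := fun y z => V z * f (y - z) * g (x - y)) hint).symm
    _ = _ := by
        unfold conv
        refine integral_congr_ae (Eventually.of_forall fun y => ?_)
        simp only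
        rw [← integral_mul_const]

/-- Minkowski's inequality for `l2`. Together with commutation it yields `S(K * f) ≤ |K| * S f` on
`ℝ^d` and on the torus. -/
lemma l2_conv_le {ι : Type*} {K : G → ℂ} {f : ι → G → ℂ} (hK : AEStronglyMeasurable K μ)
    (hf : ∀ i, AEStronglyMeasurable (f i) μ) (x : G) :
    l2 (fun i => ‖conv μ K (f i) x‖ₑ) ≤ ∫⁻ z, ‖K z‖ₑ * l2 (fun i => ‖f i (x - z)‖ₑ) ∂μ := by
  simp_rw [← l2_mul_left]
  refine (l2_mono fun i => enorm_conv_le_lintegral K (f i) x).trans (l2_lintegral_le fun i => ?_)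
  exact hK.enorm.mul ((hf i).comp_measurePreserving (Measure.measurePreserving_sub_left μ x)).enorm

end Convolution

/-! ### Approximate identities in `L_p`. -/

section ApproximateIdentity

variable {G : Type*} [AddCommGroup G] [MeasurableSpace G] [TopologicalSpace G]
  [IsTopologicalAddGroup G] [BorelSpace G] [SecondCountableTopology G] [R1Space G]
  {μ : Measure G} [μ.InnerRegularCompactLTTop] [IsLocallyFiniteMeasure μ]
  [SFinite μ] [μ.IsAddLeftInvariant] [μ.IsNegInvariant] {p q : ℝ≥0∞}

lemma tendsto_eLpNorm_translate_sub (hp1 : 1 ≤ p) (hp : p ≠ ∞) {f : G → ℂ} (hf : MemLp f p μ) :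
    Tendsto (fun z => eLpNorm (fun x => f (x - z) - f x) p μ) (𝓝 0) (𝓝 0) := by
  have : Fact (1 ≤ p) := ⟨hp1⟩
  let g : G → C(G, G) := fun z => ⟨fun x => x - z, by fun_prop⟩
  have hg : Tendsto g (𝓝 0) (𝓝 (g 0)) := by
    have : Continuous g := by
      let F : C(G × G, G) := ⟨fun y => y.2 - y.1, by fun_prop⟩
      exact F.curry.continuous
    exact this.tendsto 0
  have hm : ∀ z, MeasurePreserving (g z) μ μ := fun z => measurePreserving_sub_right μ z
  have h := Filter.Tendsto.compMeasurePreservingLp (tendsto_const_nhds (x := hf.toLp f) (f := 𝓝 (0:G)))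
    hg hm (hm 0) hp
  rw [tendsto_iff_edist_tendsto_0] at h
  refine h.congr fun z => ?_
  rw [Lp.edist_def]
  refine eLpNorm_congr_ae ?_
  have h1 : ∀ z, (Lp.compMeasurePreserving (g z) (hm z) (hf.toLp f) : G → ℂ) =ᵐ[μ] fun x => f (x - z) :=
    fun z => (Lp.coeFn_compMeasurePreserving _ _).trans
      ((hm z).quasiMeasurePreserving.ae_eq_comp hf.coeFn_toLp)
  filter_upwards [h1 z, h1 0] with x hx hx0
  simp only [sub_zero] at hx0
  rw [Pi.sub_apply, hx, hx0]

/-- Convolution with a normalized kernel that is concentrated near `0` is close to the identity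
in `L_p`. -/
lemma exists_nhds_eLpNorm_conv_sub_le [p.HolderConjugate q] (hp1 : 1 ≤ p) (hp : p ≠ ∞)
    {f : G → ℂ} (hf : MemLp f p μ) {ε : ℝ≥0∞} (hε : ε ≠ 0) :
    ∃ U ∈ 𝓝 (0 : G), ∃ δ : ℝ≥0∞, δ ≠ 0 ∧ ∀ K : G → ℂ, Integrable K μ → MemLp K q μ →
      ∫ z, K z ∂μ = 1 → ∫⁻ z, ‖K z‖ₑ ∂μ ≤ 1 → ∫⁻ z in Uᶜ, ‖K z‖ₑ ∂μ ≤ δ →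
      eLpNorm (fun x => conv μ K f x - f x) p μ ≤ ε := by
  rcases eq_or_ne ε ∞ with rfl | hε'
  · exact ⟨univ, univ_mem, 1, one_ne_zero, fun K _ _ _ _ _ => le_top⟩
  have hp0 : p ≠ 0 := (zero_lt_one.trans_le hp1).ne'
  have hr : 1 ≤ p.toReal := by
    rw [← ENNReal.toReal_one]; exact (ENNReal.toReal_le_toReal (by simp) hp).2 hp1
  have hr0 : 0 < p.toReal := by linarith
  set ω : G → ℝ≥0∞ := fun z => eLpNorm (fun x => f (x - z) - f x) p μ with hω
  have htrans : ∀ z, MemLp (fun x => f (x - z)) p μ := fun z =>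
    hf.comp_measurePreserving (measurePreserving_sub_right μ z)
  have hω2 : ∀ z, ω z ≤ 2 * eLpNorm f p μ := fun z => by
    refine (eLpNorm_sub_le (htrans z).1 hf.1 hp1).trans ?_
    rw [two_mul]
    exact add_le_add_left (eLpNorm_comp_measurePreserving hf.1 (measurePreserving_sub_right μ z)).le _
  set η : ℝ≥0∞ := (ε / 2) ^ p.toReal with hη
  have hη0 : η ≠ 0 := by
    have : ε / 2 ≠ 0 := by simp [hε]
    rw [hη]; exact (ENNReal.rpow_pos (pos_iff_ne_zero.2 this) (ENNReal.div_ne_top hε' (by simp))).ne'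
  set A : ℝ≥0∞ := (2 * eLpNorm f p μ) ^ p.toReal with hA
  have hAtop : A ≠ ∞ := ENNReal.rpow_ne_top_of_nonneg hr0.le (ENNReal.mul_ne_top (by simp) hf.2.ne)
  have hev : ∀ᶠ z in 𝓝 (0 : G), ω z ≤ ε / 2 :=
    (tendsto_eLpNorm_translate_sub hp1 hp hf).eventually_le_const (by
      exact pos_iff_ne_zero.2 (by simp [hε]))
  obtain ⟨U, hUs, hUo, hU0⟩ := eventually_nhds_iff.1 hev
  -- On `U` translation moves `f` by at most `ε / 2`; off `U` only the crude bound `2 ‖f‖_p` is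
  -- available, and the mass `δ = η / (A + 1)` of the kernel there brings its contribution down to
  -- `η`. The total `2η ≤ 2^p (ε / 2)^p` is `ε^p`.
  refine ⟨U, hUo.mem_nhds hU0, η / (A + 1), ?_, fun K hK hKq hK1 hKn hKU => ?_⟩
  · exact (ENNReal.div_pos hη0 (by simp [hAtop])).ne'
  rw [← ENNReal.rpow_le_rpow_iff hr0]
  have hconv : ∀ x, ‖conv μ K f x - f x‖ₑ ≤ ∫⁻ z, ‖K z‖ₑ * ‖f (x - z) - f x‖ₑ ∂μ := fun x => by
    have : conv μ K f x - f x = ∫ z, K z * (f (x - z) - f x) ∂μ := by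
      simp_rw [mul_sub]
      have : ENNReal.HolderConjugate q p := ENNReal.HolderConjugate.symm
      rw [integral_sub (integrable_mul_comp_sub hKq hf x) (hK.mul_const _), integral_mul_const,
        hK1, one_mul]
      rfl
    rw [this]
    simp_rw [← enorm_mul]
    exact enorm_integral_le_lintegral_enorm _
  have hF : AEMeasurable (Function.uncurry fun x z => ‖f (x - z) - f x‖ₑ) (μ.prod μ) := by
    refine AEStronglyMeasurable.enorm (f := fun y : G × G => f (y.1 - y.2) - f y.1) ?_
    exact (hf.1.comp_quasiMeasurePreserving
      (quasiMeasurePreserving_sub_of_right_invariant μ μ)).sub hf.1.comp_fst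
  calc eLpNorm (fun x => conv μ K f x - f x) p μ ^ p.toReal
      ≤ eLpNorm (fun x => ∫⁻ z, ‖K z‖ₑ * ‖f (x - z) - f x‖ₑ ∂μ) p μ ^ p.toReal := by
        gcongr
        exact eLpNorm_mono_enorm hconv
    _ ≤ (∫⁻ z, ‖K z‖ₑ ∂μ) ^ (p.toReal - 1) * ∫⁻ z, ‖K z‖ₑ * ω z ^ p.toReal ∂μ := by
        refine (eLpNorm_lintegral_mul_le hp1 hp hK.1.enorm hK.2.ne hF).trans_eq ?_
        simp_rw [hω]
        simp only [eLpNorm_enorm]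
    _ ≤ 1 * ∫⁻ z, ‖K z‖ₑ * ω z ^ p.toReal ∂μ := by
        gcongr
        exact ENNReal.rpow_le_one hKn (by linarith)
    _ = ∫⁻ z in U, ‖K z‖ₑ * ω z ^ p.toReal ∂μ + ∫⁻ z in Uᶜ, ‖K z‖ₑ * ω z ^ p.toReal ∂μ := by
        rw [one_mul, lintegral_add_compl _ hUo.measurableSet]
    _ ≤ ∫⁻ z in U, ‖K z‖ₑ * η ∂μ + ∫⁻ z in Uᶜ, ‖K z‖ₑ * A ∂μ := by
        gcongr ?_ + ?_
        · refine setLIntegral_mono' hUo.measurableSet fun z hz => ?_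
          gcongr
          exact ENNReal.rpow_le_rpow (hUs z hz) hr0.le
        · refine lintegral_mono fun z => ?_
          gcongr
          exact ENNReal.rpow_le_rpow (hω2 z) hr0.le
    _ ≤ 1 * η + η / (A + 1) * A := by
        rw [lintegral_mul_const'' _ hK.1.enorm.restrict, lintegral_mul_const'' _ hK.1.enorm.restrict]
        gcongr
        exact (setLIntegral_le_lintegral _ _).trans hKn
    _ ≤ η + η := by
        rw [one_mul]
        gcongr
        rw [← ENNReal.mul_div_right_comm]
        refine ENNReal.div_le_of_le_mul ?_
        gcongr
        exact le_self_add
    _ ≤ (2 : ℝ≥0∞) ^ p.toReal * η := by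
        rw [← two_mul]
        gcongr
        nth_rewrite 1 [← ENNReal.rpow_one 2]
        exact ENNReal.rpow_le_rpow_of_exponent_le (by norm_num) hr
    _ = ε ^ p.toReal := by
        rw [hη, ← ENNReal.mul_rpow_of_nonneg _ _ hr0.le, ENNReal.mul_div_cancel (by simp) (by simp)]

end ApproximateIdentity

end DyadicLP

end

noncomputable section

namespace DyadicLP

open Filter Topology

/-! ### Combinatorics and measurability of dyadic intervals and rectangles. -/

section DyadicIntervals

lemma zpow_two_pos (k : ℤ) : (0 : ℝ) < 2 ^ k := zpow_pos two_pos k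

lemma eq_of_mem_dyadicIntervals {I J : Set ℝ} (hI : I ∈ dyadicIntervals)
    (hJ : J ∈ dyadicIntervals) {x : ℝ} (hxI : x ∈ I) (hxJ : x ∈ J) : I = J := by
  have key : ∀ (k j : ℤ) (y : ℝ), (2 : ℝ) ^ (k - 1) ≤ y → y < 2 ^ k → (2 : ℝ) ^ (j - 1) ≤ y →
      y < 2 ^ j → k = j := by
    intro k j y h1 h2 h3 h4
    have a := (zpow_lt_zpow_iff_right₀ (one_lt_two : (1 : ℝ) < 2)).1 (h1.trans_lt h4)
    have b := (zpow_lt_zpow_iff_right₀ (one_lt_two : (1 : ℝ) < 2)).1 (h3.trans_lt h2)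
    omega
  obtain ⟨k, rfl | rfl⟩ := hI <;> obtain ⟨j, rfl | rfl⟩ := hJ
  · rw [key k j x hxI.1 hxI.2 hxJ.1 hxJ.2]
  · have h1 := hxI.1; have h2 := hxJ.2
    have := zpow_two_pos (k - 1); have := zpow_two_pos (j - 1)
    linarith
  · have h1 := hxJ.1; have h2 := hxI.2
    have := zpow_two_pos (k - 1); have := zpow_two_pos (j - 1)
    linarith
  · rw [key k j (-x) (by linarith [hxI.2]) (by linarith [hxI.1]) (by linarith [hxJ.2])
      (by linarith [hxJ.1])]

lemma exists_mem_dyadicIntervals {x : ℝ} (hx : x ≠ 0) : ∃ I ∈ dyadicIntervals, x ∈ I := by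
  rcases hx.lt_or_gt with h | h
  · obtain ⟨n, hn⟩ := exists_mem_Ico_zpow (neg_pos.2 h) (one_lt_two : (1 : ℝ) < 2)
    refine ⟨_, ⟨n + 1, Or.inr rfl⟩, ?_, ?_⟩
    · linarith [hn.2]
    · rw [add_sub_cancel_right]; linarith [hn.1]
  · obtain ⟨n, hn⟩ := exists_mem_Ico_zpow h (one_lt_two : (1 : ℝ) < 2)
    refine ⟨_, ⟨n + 1, Or.inl rfl⟩, ?_, hn.2⟩
    rw [add_sub_cancel_right]; exact hn.1

lemma ne_zero_of_mem_dyadicIntervals {I : Set ℝ} (hI : I ∈ dyadicIntervals) {x : ℝ} (hx : x ∈ I) :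
    x ≠ 0 := by
  obtain ⟨k, rfl | rfl⟩ := hI
  · exact ((zpow_two_pos _).trans_le hx.1).ne'
  · have := zpow_two_pos (k - 1); have := hx.2; intro h; linarith

lemma countable_dyadicIntervals : dyadicIntervals.Countable := by
  have : dyadicIntervals ⊆ range (fun k : ℤ => Ico ((2 : ℝ) ^ (k - 1)) ((2 : ℝ) ^ k)) ∪
      range (fun k : ℤ => Ioc (-(2 : ℝ) ^ k) (-(2 : ℝ) ^ (k - 1))) := by
    rintro I ⟨k, rfl | rfl⟩
    · exact Or.inl ⟨k, rfl⟩
    · exact Or.inr ⟨k, rfl⟩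
  exact ((countable_range _).union (countable_range _)).mono this

/-- The positive and negative intervals have opposite half-open conventions. Fourier integrals only
see them up to null sets, so one form serves both. -/
lemma ae_eq_Ioc_of_mem_dyadicIntervals {I : Set ℝ} (hI : I ∈ dyadicIntervals) :
    ∃ a b : ℝ, a ≤ b ∧ MeasurableSet I ∧ I =ᵐ[volume] Ioc a b ∧ I ⊆ Icc a b := by
  obtain ⟨k, rfl | rfl⟩ := hI
  · exact ⟨_, _, zpow_le_zpow_right₀ one_le_two (by omega), measurableSet_Ico, Ico_ae_eq_Ioc,
      Ico_subset_Icc_self⟩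
  · exact ⟨_, _, neg_le_neg (zpow_le_zpow_right₀ one_le_two (by omega)), measurableSet_Ioc,
      ae_eq_refl _, Ioc_subset_Icc_self⟩

variable {d : ℕ}

lemma eq_of_mem_dyadicRectangles {R S : Set (EuclideanSpace ℝ (Fin d))}
    (hR : R ∈ dyadicRectangles d) (hS : S ∈ dyadicRectangles d) {x : EuclideanSpace ℝ (Fin d)}
    (hxR : x ∈ R) (hxS : x ∈ S) : R = S := by
  obtain ⟨I, hI, rfl⟩ := hR
  obtain ⟨J, hJ, rfl⟩ := hS
  have : I = J := funext fun i => eq_of_mem_dyadicIntervals (hI i) (hJ i) (hxR i) (hxS i)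
  rw [this]

instance countable_dyadicRectangles : Countable (dyadicRectangles d) := by
  have h1 : (Set.pi univ fun _ : Fin d => dyadicIntervals).Countable :=
    Set.countable_univ_pi fun _ => countable_dyadicIntervals
  refine (Set.Countable.mono (s₂ := (fun I : Fin d → Set ℝ =>
    {ξ : EuclideanSpace ℝ (Fin d) | ∀ i, ξ i ∈ I i}) '' _) ?_ (h1.image _)).to_subtype
  rintro R ⟨I, hI, rfl⟩
  exact ⟨I, fun i _ => hI i, rfl⟩

lemma measurableSet_of_mem_dyadicRectangles {R : Set (EuclideanSpace ℝ (Fin d))}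
    (hR : R ∈ dyadicRectangles d) : MeasurableSet R := by
  obtain ⟨I, hI, rfl⟩ := hR
  simp only [ofPred_forall]
  refine MeasurableSet.iInter fun i => ?_
  obtain ⟨a, b, -, hm, -⟩ := ae_eq_Ioc_of_mem_dyadicIntervals (hI i)
  exact (by fun_prop : Measurable fun ξ : EuclideanSpace ℝ (Fin d) => ξ i) hm

lemma isBounded_of_mem_dyadicRectangles {R : Set (EuclideanSpace ℝ (Fin d))}
    (hR : R ∈ dyadicRectangles d) : Bornology.IsBounded R := by
  obtain ⟨I, hI, rfl⟩ := hR
  choose a b _ _ _ h using fun i => ae_eq_Ioc_of_mem_dyadicIntervals (hI i)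
  have hb : Bornology.IsBounded (Set.pi univ fun i => Icc (a i) (b i)) :=
    Bornology.IsBounded.pi fun i => Metric.isBounded_Icc _ _
  have := (PiLp.antilipschitzWith_ofLp 2 (fun _ : Fin d => ℝ)).isBounded_preimage hb
  exact this.subset fun ξ hξ i _ => h i (hξ i)

lemma volume_lt_top_of_mem_dyadicRectangles {R : Set (EuclideanSpace ℝ (Fin d))}
    (hR : R ∈ dyadicRectangles d) : volume R < ∞ :=
  (isBounded_of_mem_dyadicRectangles hR).measure_lt_top

lemma integrable_indicator_of_mem_dyadicRectangles {R : Set (EuclideanSpace ℝ (Fin d))}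
    (hR : R ∈ dyadicRectangles d) : Integrable (R.indicator fun _ => (1 : ℂ)) := by
  rw [integrable_indicator_iff (measurableSet_of_mem_dyadicRectangles hR)]
  exact integrableOn_const (volume_lt_top_of_mem_dyadicRectangles hR).ne

end DyadicIntervals

/-! ### The kernel of `S_R` lies in `L_q` for `1 < q < ∞`. -/

section Kernel

/-- Two bounds are added: the length `b - a`, and the bound `1 / |t|` coming from the explicit
primitive of the exponential. -/
lemma norm_fourierInv_indicator_Ioc_le (a b : ℝ) (hab : a ≤ b) (t : ℝ) :
    ‖𝓕⁻ ((Ioc a b).indicator fun _ => (1 : ℂ)) t‖ ≤ (b - a + 1) * (1 + ‖t‖)⁻¹ := by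
  have h0 : 𝓕⁻ ((Ioc a b).indicator fun _ => (1 : ℂ)) t =
      ∫ ξ in a..b, Complex.exp ((2 * Real.pi * t * Complex.I) * ξ) := by
    rw [Real.fourierInv_eq', intervalIntegral.integral_of_le hab, ← integral_indicator measurableSet_Ioc]
    refine integral_congr_ae (Eventually.of_forall fun ξ => ?_)
    by_cases h : ξ ∈ Ioc a b
    · simp only [h, indicator_of_mem, smul_eq_mul, mul_one]
      congr 1
      simp; ring
    · simp [h]
  have hn : ∀ ξ : ℝ, ‖Complex.exp ((2 * Real.pi * t * Complex.I) * ξ)‖ = 1 := fun ξ => by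
    have : (2 * Real.pi * t * Complex.I) * (ξ : ℂ) = ((2 * Real.pi * t * ξ : ℝ) : ℂ) * Complex.I := by
      push_cast; ring
    rw [this, Complex.norm_exp_ofReal_mul_I]
  have h1 : ‖𝓕⁻ ((Ioc a b).indicator fun _ => (1 : ℂ)) t‖ ≤ b - a := by
    rw [h0]
    have := intervalIntegral.norm_integral_le_of_norm_le_const (a := a) (b := b)
      (f := fun ξ : ℝ => Complex.exp ((2 * Real.pi * t * Complex.I) * ξ)) (C := 1) fun ξ _ => (hn ξ).le
    rwa [abs_of_nonneg (by linarith), one_mul] at this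
  have h2 : ‖𝓕⁻ ((Ioc a b).indicator fun _ => (1 : ℂ)) t‖ * ‖t‖ ≤ 1 := by
    rcases eq_or_ne t 0 with rfl | ht
    · simp
    have hc : (2 * Real.pi * t * Complex.I : ℂ) ≠ 0 := by
      simp [ht, Real.pi_ne_zero]
    rw [h0, integral_exp_mul_complex hc, norm_div]
    have h3 : ‖(2 * Real.pi * t * Complex.I : ℂ)‖ = 2 * Real.pi * ‖t‖ := by
      simp [abs_of_pos Real.pi_pos]
    have h4 := norm_sub_le (Complex.exp ((2 * Real.pi * t * Complex.I) * b))
      (Complex.exp ((2 * Real.pi * t * Complex.I) * a))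
    rw [hn, hn] at h4
    have ht' : 0 < ‖t‖ := norm_pos_iff.2 ht
    rw [h3, div_mul_eq_mul_div, div_le_one (by positivity)]
    nlinarith [Real.pi_gt_three]
  rw [← div_eq_mul_inv, le_div_iff₀ (by positivity)]
  nlinarith

lemma memLp_one_add_norm_inv {q : ℝ≥0∞} (hq : 1 < q) (hq' : q ≠ ∞) :
    MemLp (fun t : ℝ => (1 + ‖t‖)⁻¹) q volume := by
  have hq0 : q ≠ 0 := (zero_lt_one.trans hq).ne'
  have hr : 1 < q.toReal := by
    rw [← ENNReal.toReal_one]; exact (ENNReal.toReal_lt_toReal (by simp) hq').2 hq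
  have hc : Continuous fun t : ℝ => (1 + ‖t‖)⁻¹ :=
    (by fun_prop : Continuous fun t : ℝ => 1 + ‖t‖).inv₀ fun t => by positivity
  rw [← integrable_norm_rpow_iff hc.aestronglyMeasurable hq0 hq']
  refine (integrable_one_add_norm (E := ℝ) (μ := volume) (r := q.toReal) (by simpa using hr)).congr
    (Eventually.of_forall fun t => ?_)
  simp only
  have h0 : 0 ≤ (1 + ‖t‖)⁻¹ := by positivity
  rw [Real.norm_of_nonneg h0, Real.inv_rpow (by positivity), Real.rpow_neg (by positivity)]

lemma memLp_fourierInv_indicator_interval {q : ℝ≥0∞} (hq : 1 < q) (hq' : q ≠ ∞) {I : Set ℝ}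
    (hI : I ∈ dyadicIntervals) : MemLp (𝓕⁻ (I.indicator fun _ => (1 : ℂ))) q volume := by
  obtain ⟨a, b, hab, hm, hae, -⟩ := ae_eq_Ioc_of_mem_dyadicIntervals hI
  have h1 : 𝓕⁻ (I.indicator fun _ => (1 : ℂ)) = 𝓕⁻ ((Ioc a b).indicator fun _ => (1 : ℂ)) := by
    ext t
    exact Real.fourierInv_congr_ae (indicator_ae_eq_of_ae_eq_set hae) t
  rw [h1]
  have hint : Integrable ((Ioc a b).indicator fun _ => (1 : ℂ)) := by
    rw [integrable_indicator_iff measurableSet_Ioc]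
    exact integrableOn_const (by simp)
  have hcont : Continuous (𝓕⁻ ((Ioc a b).indicator fun _ => (1 : ℂ))) := by
    rw [Real.fourierInv_eq_fourier_comp_neg]
    exact VectorFourier.fourierIntegral_continuous Real.continuous_fourierChar
      (by exact continuous_inner) (hint.comp_neg)
  refine MemLp.of_le ((memLp_one_add_norm_inv hq hq').const_mul (b - a + 1))
    hcont.aestronglyMeasurable (Eventually.of_forall fun t => ?_)
  refine (norm_fourierInv_indicator_Ioc_le a b hab t).trans (le_abs_self _)

variable {d : ℕ}

/-- The kernel of the partial sum operator `S_R`. -/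
abbrev rectKernel (R : Set (EuclideanSpace ℝ (Fin d))) : EuclideanSpace ℝ (Fin d) → ℂ :=
  𝓕⁻ (R.indicator fun _ => (1 : ℂ))

/-- The character of `ℝ^d` and the indicator of a product set both factor over the coordinates, so
integrability questions reduce to dimension one. -/
lemma rectKernel_eq_prod (I : Fin d → Set ℝ) (x : EuclideanSpace ℝ (Fin d)) :
    rectKernel {ξ : EuclideanSpace ℝ (Fin d) | ∀ i, ξ i ∈ I i} x =
      ∏ i, 𝓕⁻ ((I i).indicator fun _ => (1 : ℂ)) (x i) := by
  simp_rw [rectKernel, Real.fourierInv_eq]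
  rw [← integral_fintype_prod_volume_eq_prod]
  rw [← (EuclideanSpace.volume_preserving_symm_measurableEquiv_toLp (Fin d)).integral_comp'
    (g := fun v : Fin d → ℝ => ∏ i, Real.fourierChar (inner ℝ (v i) (x i)) •
      (I i).indicator (fun _ => (1 : ℂ)) (v i))]
  refine integral_congr_ae (Eventually.of_forall fun v => ?_)
  simp only [Circle.smul_def, smul_eq_mul, Finset.prod_mul_distrib]
  congr 1
  · have h1 : ∀ s : Finset (Fin d), ∀ a : Fin d → ℝ, Real.fourierChar (∑ i ∈ s, a i) =
        ∏ i ∈ s, Real.fourierChar (a i) := fun s a => by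
      induction s using Finset.cons_induction with
      | empty => simp
      | cons i s hi ih => rw [Finset.sum_cons, Finset.prod_cons, AddChar.map_add_eq_mul, ih]
    rw [PiLp.inner_apply, h1]
    exact map_prod Circle.coeHom _ _
  · by_cases h : ∀ i, v i ∈ I i
    · rw [indicator_of_mem (by exact h)]
      symm
      exact Finset.prod_eq_one fun i _ => indicator_of_mem (h i) _
    · rw [indicator_of_notMem (by exact h)]
      push Not at h
      obtain ⟨i, hi⟩ := h
      exact (Finset.prod_eq_zero (Finset.mem_univ i) (indicator_of_notMem hi _)).symm

/-- By Hölder, this makes `S_R f x` a convergent integral at every point for every `f ∈ L_p`,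
continuous in `f` for the `L_p` norm. -/
lemma memLp_rectKernel {q : ℝ≥0∞} (hq : 1 < q) (hq' : q ≠ ∞) {R : Set (EuclideanSpace ℝ (Fin d))}
    (hR : R ∈ dyadicRectangles d) : MemLp (rectKernel R) q volume := by
  have hq0 : q ≠ 0 := (zero_lt_one.trans hq).ne'
  obtain ⟨I, hI, rfl⟩ := hR
  have hk := fun i => memLp_fourierInv_indicator_interval hq hq' (hI i)
  have h1 : rectKernel {ξ : EuclideanSpace ℝ (Fin d) | ∀ i, ξ i ∈ I i} =
      (fun v : Fin d → ℝ => ∏ i, 𝓕⁻ ((I i).indicator fun _ => (1 : ℂ)) (v i)) ∘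
        (MeasurableEquiv.toLp 2 (Fin d → ℝ)).symm := by
    ext x; exact rectKernel_eq_prod I x
  rw [h1]
  refine MemLp.comp_measurePreserving ?_
    (EuclideanSpace.volume_preserving_symm_measurableEquiv_toLp (Fin d))
  have hm : AEStronglyMeasurable
      (fun v : Fin d → ℝ => ∏ i, 𝓕⁻ ((I i).indicator fun _ => (1 : ℂ)) (v i)) volume := by
    refine Finset.aestronglyMeasurable_fun_prod _ fun i _ => ?_
    exact (hk i).1.comp_quasiMeasurePreserving (Measure.quasiMeasurePreserving_eval _ i)
  rw [← integrable_norm_rpow_iff hm hq0 hq']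
  have h2 := Integrable.fintype_prod (μ := fun _ : Fin d => (volume : Measure ℝ))
    (f := fun i t => ‖𝓕⁻ ((I i).indicator fun _ => (1 : ℂ)) t‖ ^ q.toReal)
    fun i => (integrable_norm_rpow_iff (hk i).1 hq0 hq').2 (hk i)
  refine h2.congr (Eventually.of_forall fun v => ?_)
  simp only [norm_prod]
  rw [Real.finsetProd_rpow _ _ fun i _ => norm_nonneg _]

end Kernel

end DyadicLP

end

noncomputable section

namespace DyadicLP

open Filter Topology

/-! ### Partial sums on `ℝ^d`: continuity and commutation with convolution. -/

section PartialSum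

variable {d : ℕ} {p q : ℝ≥0∞} {R : Set (EuclideanSpace ℝ (Fin d))}
  {f g K : EuclideanSpace ℝ (Fin d) → ℂ}

lemma partialSum_eq_conv (R : Set (EuclideanSpace ℝ (Fin d)))
    (f : EuclideanSpace ℝ (Fin d) → ℂ) : partialSum R f = conv volume f (rectKernel R) := rfl

lemma squareFunction_eq_l2 (f : EuclideanSpace ℝ (Fin d) → ℂ) (x : EuclideanSpace ℝ (Fin d)) :
    squareFunction f x =
      l2 fun R : dyadicRectangles d => ‖partialSum (R : Set (EuclideanSpace ℝ (Fin d))) f x‖ₑ := rfl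

lemma continuous_fourierInv_of_integrable (hf : Integrable f) : Continuous (𝓕⁻ f) := by
  rw [Real.fourierInv_eq_fourier_comp_neg]
  exact VectorFourier.fourierIntegral_continuous Real.continuous_fourierChar
    (by exact continuous_inner) hf.comp_neg

lemma continuous_fourier_of_integrable (hf : Integrable f) : Continuous (𝓕 f) :=
  VectorFourier.fourierIntegral_continuous Real.continuous_fourierChar (by exact continuous_inner) hf

lemma stronglyMeasurable_partialSum (hR : R ∈ dyadicRectangles d)
    (hf : AEStronglyMeasurable f volume) : StronglyMeasurable (partialSum R f) := by
  rw [partialSum_eq_conv]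
  exact stronglyMeasurable_conv hf
    (continuous_fourierInv_of_integrable (integrable_indicator_of_mem_dyadicRectangles hR)).aestronglyMeasurable

lemma measurable_squareFunction (hf : AEStronglyMeasurable f volume) :
    Measurable (squareFunction f) := by
  simp_rw [funext (squareFunction_eq_l2 f)]
  exact measurable_l2 fun R => (stronglyMeasurable_partialSum R.2 hf).enorm

variable [p.HolderConjugate q]

lemma enorm_partialSum_le (hf : AEStronglyMeasurable f volume) (hk : MemLp (rectKernel R) q volume)
    (x : EuclideanSpace ℝ (Fin d)) :
    ‖partialSum R f x‖ₑ ≤ eLpNorm f p volume * eLpNorm (rectKernel R) q volume :=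
  enorm_conv_le hf hk.1 x

lemma partialSum_sub (hk : MemLp (rectKernel R) q volume) (hf : MemLp f p volume)
    (hg : MemLp g p volume) (x : EuclideanSpace ℝ (Fin d)) :
    partialSum R (fun y => f y - g y) x = partialSum R f x - partialSum R g x := by
  simp_rw [partialSum, sub_mul]
  exact integral_sub (integrable_mul_comp_sub hf hk x) (integrable_mul_comp_sub hg hk x)

lemma tendsto_partialSum {F : ℕ → EuclideanSpace ℝ (Fin d) → ℂ}
    (hk : MemLp (rectKernel R) q volume) (hf : MemLp f p volume) (hF : ∀ n, MemLp (F n) p volume)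
    (h : Tendsto (fun n => eLpNorm (fun x => F n x - f x) p volume) atTop (𝓝 0))
    (x : EuclideanSpace ℝ (Fin d)) :
    Tendsto (fun n => partialSum R (F n) x) atTop (𝓝 (partialSum R f x)) := by
  rw [tendsto_iff_edist_tendsto_0]
  have h2 : Tendsto (fun n => eLpNorm (fun x => F n x - f x) p volume *
      eLpNorm (rectKernel R) q volume) atTop (𝓝 0) := by
    have := ENNReal.Tendsto.mul_const (b := eLpNorm (rectKernel R) q volume) h (Or.inr hk.2.ne)
    rwa [zero_mul] at this
  refine tendsto_of_tendsto_of_tendsto_of_le_of_le tendsto_const_nhds h2 (fun _ => zero_le)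
    fun n => ?_
  rw [edist_eq_enorm_sub, ← partialSum_sub hk (hF n) hf]
  exact enorm_partialSum_le ((hF n).sub hf).1 hk x

lemma partialSum_conv (hk : MemLp (rectKernel R) q volume) (hK : Integrable K volume)
    (hf : MemLp f p volume) (x : EuclideanSpace ℝ (Fin d)) :
    partialSum R (conv volume K f) x = conv volume K (partialSum R f) x := by
  simp_rw [partialSum_eq_conv]
  exact (conv_assoc hK hf hk x).symm

/-- Moves the convolution with `K` from `f` to the test function `b`. For general `p` the function
`f` has no pointwise Fourier transform, so spectral information about `K * f` is read off from `K *
b` instead. -/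
lemma conv_conv_comm {b : EuclideanSpace ℝ (Fin d) → ℂ} (hb : MemLp b q volume)
    (hK : Integrable K volume) (hf : MemLp f p volume) (x : EuclideanSpace ℝ (Fin d)) :
    conv volume (conv volume K f) b x = conv volume (conv volume K b) f x := by
  have : ENNReal.HolderConjugate q p := ENNReal.HolderConjugate.symm
  rw [← conv_assoc hK hf hb, ← conv_assoc hK hb hf]
  congr 1
  ext y
  exact conv_comm _ _ _

/-- The partial sum of an integrable function is given by Fourier inversion. -/
lemma partialSum_eq_fourierInv (hR : R ∈ dyadicRectangles d) (hg : Integrable g)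
    (x : EuclideanSpace ℝ (Fin d)) : partialSum R g x = 𝓕⁻ (R.indicator (𝓕 g)) x := by
  have hint := integrable_indicator_of_mem_dyadicRectangles hR
  have h1 : ∀ y, rectKernel R (x - y) =
      𝓕 (fun ξ => Real.fourierChar (inner ℝ ξ x) • R.indicator (fun _ => (1 : ℂ)) ξ) y := fun y => by
    rw [rectKernel, Real.fourierInv_eq, Real.fourier_eq]
    refine integral_congr_ae (Eventually.of_forall fun ξ => ?_)
    simp only
    rw [smul_smul, ← AddChar.map_add_eq_mul, inner_sub_right]
    congr 2; ring
  simp_rw [partialSum, h1]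
  have h2 := VectorFourier.integral_fourierIntegral_smul_eq_flip (μ := volume) (ν := volume)
    (L := innerₗ (EuclideanSpace ℝ (Fin d))) (f := g)
    (g := fun ξ => Real.fourierChar (inner ℝ ξ x) • R.indicator (fun _ => (1 : ℂ)) ξ)
    Real.continuous_fourierChar (by exact continuous_inner) hg (by
      refine hint.mono ?_ (by simp)
      simp only [Circle.smul_def]
      exact ((Real.continuous_fourierChar.comp (by fun_prop)).subtype_val.aestronglyMeasurable).smul hint.1)
  rw [flip_innerₗ] at h2
  refine Eq.trans h2.symm ?_
  rw [Real.fourierInv_eq]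
  refine integral_congr_ae (Eventually.of_forall fun ξ => ?_)
  by_cases h : ξ ∈ R
  · simp only [h, indicator_of_mem, Circle.smul_def, smul_eq_mul, mul_one]
    rw [mul_comm]; rfl
  · simp [h]

omit [p.HolderConjugate q] in
lemma eLpNorm_squareFunction_le_of_le (hp1 : 1 ≤ p) (hp : p ≠ ∞) {k u v : EuclideanSpace ℝ (Fin d) → ℝ≥0∞}
    (hk : AEMeasurable k volume) (hk1 : ∫⁻ z, k z ≠ ∞) (hu : AEMeasurable u volume)
    (h : ∀ x, v x ≤ ∫⁻ z, k z * u (x - z)) :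
    eLpNorm v p volume ≤ (∫⁻ z, k z) * eLpNorm u p volume :=
  (eLpNorm_mono_enorm h).trans (eLpNorm_lconv_le hp1 hp hk hk1 hu)

end PartialSum

/-! ### The square function on `ℝ^d`: behaviour under convolution and limits. -/

section SquareFunction

variable {d : ℕ} {p : ℝ≥0∞} {f g K : EuclideanSpace ℝ (Fin d) → ℂ}

lemma exists_holderConjugate (hp1 : 1 < p) (hp : p < ∞) :
    ∃ q : ℝ≥0∞, p.HolderConjugate q ∧ 1 < q ∧ q ≠ ∞ := by
  have h : p.HolderConjugate p.conjExponent := ENNReal.HolderConjugate.conjExponent hp1.le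
  refine ⟨p.conjExponent, h, ?_, ?_⟩
  · exact (ENNReal.HolderConjugate.lt_top_iff_one_lt p _).1 hp
  · exact ((ENNReal.HolderConjugate.lt_top_iff_one_lt _ p).2 hp1).ne

variable (hp1 : 1 < p) (hp : p < ∞)
include hp1 hp

lemma squareFunction_sub_le (hf : MemLp f p volume) (hg : MemLp g p volume)
    (x : EuclideanSpace ℝ (Fin d)) :
    squareFunction (fun y => f y - g y) x ≤ squareFunction f x + squareFunction g x := by
  obtain ⟨q, hpq, hq1, hq⟩ := exists_holderConjugate hp1 hp
  simp_rw [squareFunction_eq_l2]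
  refine le_trans (l2_mono fun R => ?_) (l2_add_le _ _)
  rw [partialSum_sub (memLp_rectKernel hq1 hq R.2) hf hg]
  exact enorm_sub_le

/-- Partial sums commute with convolution, and Minkowski takes the `ℓ²` norm inside. This controls
the square functions of approximants even though `S^Δ` is not known to be bounded. -/
lemma squareFunction_conv_le (hK : Integrable K volume) (hf : MemLp f p volume)
    (x : EuclideanSpace ℝ (Fin d)) :
    squareFunction (conv volume K f) x ≤ ∫⁻ z, ‖K z‖ₑ * squareFunction f (x - z) := by
  obtain ⟨q, hpq, hq1, hq⟩ := exists_holderConjugate hp1 hp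
  simp_rw [squareFunction_eq_l2, fun R : dyadicRectangles d =>
    partialSum_conv (memLp_rectKernel hq1 hq R.2) hK hf]
  exact l2_conv_le hK.1
    (fun R => (stronglyMeasurable_partialSum R.2 hf.1).aestronglyMeasurable) x

lemma eLpNorm_squareFunction_conv_le (hK : Integrable K volume) (hf : MemLp f p volume) :
    eLpNorm (squareFunction (conv volume K f)) p volume ≤
      (∫⁻ z, ‖K z‖ₑ) * eLpNorm (squareFunction f) p volume :=
  eLpNorm_squareFunction_le_of_le hp1.le hp.ne hK.1.enorm hK.2.ne
    (measurable_squareFunction hf.1).aemeasurable (squareFunction_conv_le hp1 hp hK hf)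

/-- Lower semicontinuity of `f ↦ ‖S^Δ f‖_p` on `L_p`. -/
lemma eLpNorm_squareFunction_le_liminf {F : ℕ → EuclideanSpace ℝ (Fin d) → ℂ}
    (hf : MemLp f p volume) (hF : ∀ n, MemLp (F n) p volume)
    (h : Tendsto (fun n => eLpNorm (fun x => F n x - f x) p volume) atTop (𝓝 0)) :
    eLpNorm (squareFunction f) p volume ≤
      liminf (fun n => eLpNorm (squareFunction (F n)) p volume) atTop := by
  obtain ⟨q, hpq, hq1, hq⟩ := exists_holderConjugate hp1 hp
  refine eLpNorm_le_liminf (zero_lt_one.trans hp1).ne' hp.ne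
    (fun n => (measurable_squareFunction (hF n).1).aemeasurable) (Eventually.of_forall fun x => ?_)
  simp_rw [squareFunction_eq_l2]
  exact l2_le_liminf fun R => (continuous_enorm.tendsto _).comp
    (tendsto_partialSum (memLp_rectKernel hq1 hq R.2) hf hF h x)

end SquareFunction

end DyadicLP

end

noncomputable section

namespace DyadicLP

open Filter Topology

/-! ### Characters of `ℝ^d`. -/

section Character

variable {d : ℕ}

/-- The character `x ↦ e^{2πi⟨ξ, x⟩}` of `ℝ^d`. -/
def ex (ξ x : EuclideanSpace ℝ (Fin d)) : ℂ := (Real.fourierChar (inner ℝ ξ x) : ℂ)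

variable (ξ η x y : EuclideanSpace ℝ (Fin d))

lemma ex_add_left : ex (ξ + η) x = ex ξ x * ex η x := by
  simp [ex, inner_add_left, AddChar.map_add_eq_mul]

lemma ex_add_right : ex ξ (x + y) = ex ξ x * ex ξ y := by
  simp [ex, inner_add_right, AddChar.map_add_eq_mul]

lemma ex_comm : ex ξ x = ex x ξ := by simp [ex, real_inner_comm]

@[simp] lemma norm_ex : ‖ex ξ x‖ = 1 := Circle.norm_coe _

@[simp] lemma enorm_ex : ‖ex ξ x‖ₑ = 1 := by rw [← ofReal_norm, norm_ex]; simp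

@[simp] lemma ex_zero_left : ex 0 x = 1 := by simp [ex]

@[simp] lemma ex_zero_right : ex ξ 0 = 1 := by simp [ex]

lemma ex_neg_neg : ex (-ξ) (-x) = ex ξ x := by simp [ex]

lemma ex_neg_left : ex (-ξ) x = ex ξ (-x) := by simp [ex]

lemma ex_smul_left (s : ℝ) : ex (s • ξ) x = ex ξ (s • x) := by
  simp [ex, inner_smul_left, inner_smul_right]

lemma ex_mul_neg : ex ξ x * ex (-ξ) x = 1 := by rw [← ex_add_left]; simp

lemma conj_ex : (starRingEnd ℂ) (ex ξ x) = ex (-ξ) x := by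
  have h := ex_mul_neg ξ x
  have h2 : ex ξ x * (starRingEnd ℂ) (ex ξ x) = 1 := by
    rw [Complex.mul_conj, Complex.normSq_eq_norm_sq]; simp
  have h0 : ex ξ x ≠ 0 := by rw [← norm_ne_zero_iff]; simp
  exact mul_left_cancel₀ h0 (h2.trans h.symm)

lemma continuous_ex : Continuous fun z : EuclideanSpace ℝ (Fin d) × EuclideanSpace ℝ (Fin d) =>
    ex z.1 z.2 := by
  unfold ex
  exact (Real.continuous_fourierChar.comp (by fun_prop)).subtype_val

@[fun_prop] lemma Continuous.ex' {X : Type*} [TopologicalSpace X] {a b : X → EuclideanSpace ℝ (Fin d)}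
    (ha : Continuous a) (hb : Continuous b) : Continuous fun t => ex (a t) (b t) :=
  continuous_ex.comp (ha.prodMk hb)

lemma fourier_eq_integral_ex (g : EuclideanSpace ℝ (Fin d) → ℂ) :
    𝓕 g ξ = ∫ x, ex (-ξ) x * g x := by
  rw [Real.fourier_eq]
  refine integral_congr_ae (Eventually.of_forall fun x => ?_)
  simp [ex, Circle.smul_def, real_inner_comm]

lemma fourierInv_eq_integral_ex (g : EuclideanSpace ℝ (Fin d) → ℂ) :
    𝓕⁻ g x = ∫ ξ, ex ξ x * g ξ := by
  rw [Real.fourierInv_eq]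
  refine integral_congr_ae (Eventually.of_forall fun x => ?_)
  simp [ex, Circle.smul_def]

variable {ξ η x y}

lemma integrable_ex_mul {g : EuclideanSpace ℝ (Fin d) → ℂ} (hg : Integrable g) :
    Integrable fun y => ex ξ y * g y := by
  refine hg.mono ((by fun_prop : Continuous fun y => ex ξ y).aestronglyMeasurable.mul hg.1) ?_
  simp

end Character

/-! ### Frequencies at positive distance from the rectangle boundaries. -/

section WellInside

variable {d : ℕ} {r : ℝ}

/-- The closed ball of radius `r` around `ξ` lies in a dyadic rectangle. -/
def WellInside (r : ℝ) (ξ : EuclideanSpace ℝ (Fin d)) : Prop :=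
  ∃ R ∈ dyadicRectangles d, Metric.closedBall ξ r ⊆ R

/-- Dyadic rectangles are disjoint, so `R` either is the rectangle containing the ball or misses the
ball. -/
lemma WellInside.add_mem_iff {ξ η : EuclideanSpace ℝ (Fin d)} (h : WellInside r ξ) (hη : ‖η‖ ≤ r)
    {R : Set (EuclideanSpace ℝ (Fin d))} (hR : R ∈ dyadicRectangles d) : ξ + η ∈ R ↔ ξ ∈ R := by
  obtain ⟨S, hS, hb⟩ := h
  have h1 : ξ ∈ S := hb (Metric.mem_closedBall_self ((norm_nonneg _).trans hη))
  have h2 : ξ + η ∈ S := hb (by simpa [Metric.mem_closedBall, dist_eq_norm] using hη)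
  constructor
  · intro h; rwa [eq_of_mem_dyadicRectangles hR hS h h2]
  · intro h; rwa [eq_of_mem_dyadicRectangles hR hS h h1]

lemma WellInside.add {ξ η : EuclideanSpace ℝ (Fin d)} (h : WellInside r ξ) {s t : ℝ}
    (hη : ‖η‖ ≤ s) (hst : s + t ≤ r) : WellInside t (ξ + η) := by
  obtain ⟨S, hS, hb⟩ := h
  refine ⟨S, hS, fun z hz => hb ?_⟩
  rw [Metric.mem_closedBall, dist_eq_norm] at hz ⊢
  have := norm_add_le (z - (ξ + η)) η
  have e : z - (ξ + η) + η = z - ξ := by abel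
  rw [e] at this
  linarith

lemma WellInside.ne_zero {ξ : EuclideanSpace ℝ (Fin d)} (hr : 0 ≤ r) (h : WellInside r ξ)
    (i : Fin d) : ξ i ≠ 0 := by
  obtain ⟨S, ⟨I, hI, rfl⟩, hb⟩ := h
  exact ne_zero_of_mem_dyadicIntervals (hI i) (hb (Metric.mem_closedBall_self hr) i)

end WellInside

/-! ### Multiplication by functions of small spectrum. -/

section Localization

variable {d : ℕ} {p q : ℝ≥0∞} {R : Set (EuclideanSpace ℝ (Fin d))}
  {f g K χ : EuclideanSpace ℝ (Fin d) → ℂ} {r s : ℝ}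

/-- Modulating the kernel by `-ζ` replaces the symbol `1_R` by its translate `1_R(· + ζ)`. On the
spectrum of `K`, which stays at distance `r` from all boundaries, the two symbols agree. -/
lemma conv_ex_mul_rectKernel (hR : R ∈ dyadicRectangles d) (hK : Integrable K)
    (hKr : ∀ ξ, 𝓕 K ξ ≠ 0 → WellInside r ξ) {ζ : EuclideanSpace ℝ (Fin d)} (hζ : ‖ζ‖ ≤ r)
    (u : EuclideanSpace ℝ (Fin d)) :
    conv volume K (fun v => ex (-ζ) v * rectKernel R v) u = conv volume K (rectKernel R) u := by
  classical
  have h1 : conv volume K (fun v => ex (-ζ) v * rectKernel R v) u =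
      ex (-ζ) u * partialSum R (fun z => ex ζ z * K z) u := by
    rw [partialSum_eq_conv, conv, conv, ← integral_const_mul]
    refine integral_congr_ae (Eventually.of_forall fun z => ?_)
    simp only
    rw [sub_eq_add_neg, ex_add_right, ex_neg_neg]
    ring
  rw [h1, partialSum_eq_fourierInv hR (integrable_ex_mul hK), ← partialSum_eq_conv,
    partialSum_eq_fourierInv hR hK, fourierInv_eq_integral_ex, fourierInv_eq_integral_ex,
    ← integral_const_mul]
  have h2 : ∀ ξ, 𝓕 (fun z => ex ζ z * K z) ξ = 𝓕 K (ξ - ζ) := fun ξ => by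
    rw [fourier_eq_integral_ex, fourier_eq_integral_ex]
    refine integral_congr_ae (Eventually.of_forall fun z => ?_)
    simp only
    rw [neg_sub, sub_eq_add_neg, ex_add_left]; ring
  rw [← integral_add_right_eq_self _ ζ]
  refine integral_congr_ae (Eventually.of_forall fun ξ => ?_)
  simp only
  rw [ex_add_left, indicator_apply, indicator_apply, h2, add_sub_cancel_right]
  by_cases h0 : 𝓕 K ξ = 0
  · simp [h0]
  rw [if_congr ((hKr ξ h0).add_mem_iff hζ hR) rfl rfl, ← mul_assoc]
  congr 1
  calc _ = ex ξ u * (ex ζ u * ex (-ζ) u) := by ring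
    _ = _ := by rw [ex_mul_neg, mul_one]

variable [p.HolderConjugate q]

/-- Multiplication by a function with spectrum in a small ball commutes with the partial sum
operators, on functions whose spectrum stays away from the boundaries of the rectangles. -/
lemma partialSum_mul_conv (hR : R ∈ dyadicRectangles d) (hk : MemLp (rectKernel R) q volume)
    (hp1 : 1 ≤ p) (hp : p ≠ ∞) (hK : Integrable K)
    (hf : MemLp f p volume) (hKr : ∀ ξ, 𝓕 K ξ ≠ 0 → WellInside r ξ) (hχ : Integrable χ)
    (hχ1 : ∀ η, χ η ≠ 0 → ‖η‖ ≤ 1) (hs0 : 0 ≤ s) (hs : s ≤ r) (x : EuclideanSpace ℝ (Fin d)) :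
    partialSum R (fun y => 𝓕⁻ χ (s • y) * conv volume K f y) x =
      𝓕⁻ χ (s • x) * partialSum R (conv volume K f) x := by
  set h := conv volume K f with hh
  have hhp : MemLp h p volume := memLp_conv hp1 hp hK hf
  have hmod : ∀ ζ : EuclideanSpace ℝ (Fin d),
      MemLp (fun v => ex (-ζ) v * rectKernel R v) q volume := fun ζ =>
    MemLp.of_le hk ((by fun_prop : Continuous fun y => ex (-ζ) y).aestronglyMeasurable.mul hk.1)
      (by simp)
  have hint : Integrable (fun z => h z * rectKernel R (x - z)) := integrable_mul_comp_sub hhp hk x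
  -- `S_R` commutes with modulation by `s • η` on `h = K * f`. The factor multiplying `h` is then
  -- written as a superposition of such modulations and Fubini applies.
  have key : ∀ η, χ η ≠ 0 → ∫ y, ex (s • η) y * h y * rectKernel R (x - y) =
      ex (s • η) x * partialSum R h x := fun η hη => by
    have h1 : conv volume h (fun v => ex (-(s • η)) v * rectKernel R v) x = partialSum R h x := by
      rw [partialSum_eq_conv, hh, conv_conv_comm (hmod _) hK hf, conv_conv_comm hk hK hf]
      congr 1
      ext u
      refine conv_ex_mul_rectKernel hR hK hKr ?_ u
      rw [norm_smul, Real.norm_of_nonneg hs0]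
      nlinarith [hχ1 η hη]
    rw [← h1, conv, ← integral_const_mul]
    refine integral_congr_ae (Eventually.of_forall fun y => ?_)
    simp only
    rw [sub_eq_add_neg x y, ex_add_right, ex_neg_neg]
    calc _ = ex (s • η) y * h y * rectKernel R (x + -y) := by rfl
      _ = (ex (s • η) x * ex (-(s • η)) x) * (ex (s • η) y * h y * rectKernel R (x + -y)) := by
        rw [ex_mul_neg, one_mul]
      _ = _ := by ring
  calc partialSum R (fun y => 𝓕⁻ χ (s • y) * h y) x
      = ∫ y, ∫ η, χ η * (ex (s • η) y * h y * rectKernel R (x - y)) := by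
        refine integral_congr_ae (Eventually.of_forall fun y => ?_)
        simp only
        rw [fourierInv_eq_integral_ex, mul_assoc, ← integral_mul_const]
        refine integral_congr_ae (Eventually.of_forall fun η => ?_)
        simp only
        rw [ex_smul_left]; ring
    _ = ∫ η, ∫ y, χ η * (ex (s • η) y * h y * rectKernel R (x - y)) := by
        refine integral_integral_swap (f := fun y η => χ η * (ex (s • η) y * h y * rectKernel R (x - y))) ?_
        have h2 : Integrable (fun z : EuclideanSpace ℝ (Fin d) × EuclideanSpace ℝ (Fin d) =>
            (h z.1 * rectKernel R (x - z.1)) * χ z.2) (volume.prod volume) := hint.mul_prod hχ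
        refine h2.mono ?_ (Eventually.of_forall fun z => ?_)
        · have h3 : AEStronglyMeasurable (fun z : EuclideanSpace ℝ (Fin d) × EuclideanSpace ℝ (Fin d) =>
            ex (s • z.2) z.1 * ((h z.1 * rectKernel R (x - z.1)) * χ z.2)) (volume.prod volume) :=
            (by fun_prop : Continuous fun z : EuclideanSpace ℝ (Fin d) × EuclideanSpace ℝ (Fin d) =>
              ex (s • z.2) z.1).aestronglyMeasurable.mul h2.1
          refine h3.congr (Eventually.of_forall fun z => ?_)
          simp only [Function.uncurry]; ring
        · simp only [Function.uncurry, norm_mul, norm_ex]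
          apply le_of_eq; ring
    _ = ∫ η, ex η (s • x) * χ η * partialSum R h x := by
        refine integral_congr_ae (Eventually.of_forall fun η => ?_)
        simp only
        rw [integral_const_mul]
        by_cases h0 : χ η = 0
        · simp [h0]
        rw [key η h0, ex_smul_left]; ring
    _ = _ := by rw [integral_mul_const, fourierInv_eq_integral_ex]

/-- The spectrum of a product is contained in the sum of the spectra. -/
lemma wellInside_of_fourier_mul_conv_ne_zero (hK : Integrable K)
    (hf : MemLp f p volume) (hKr : ∀ ξ, 𝓕 K ξ ≠ 0 → WellInside r ξ) (hχ : Integrable χ)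
    (hχ1 : ∀ η, χ η ≠ 0 → ‖η‖ ≤ 1) (hs0 : 0 ≤ s) {t : ℝ} (hs : s + t ≤ r)
    (hφ : MemLp (fun y => 𝓕⁻ χ (s • y)) q volume) {ξ : EuclideanSpace ℝ (Fin d)}
    (hξ : 𝓕 (fun y => 𝓕⁻ χ (s • y) * conv volume K f y) ξ ≠ 0) : WellInside t ξ := by
  by_contra hcon
  refine hξ ?_
  have hK0 : ∀ η, χ η ≠ 0 → 𝓕 K (ξ - s • η) = 0 := fun η hη => by
    by_contra h0
    refine hcon ?_
    have := (hKr _ h0).add (η := s • η) (s := s) (t := t) ?_ hs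
    · rwa [sub_add_cancel] at this
    · rw [norm_smul, Real.norm_of_nonneg hs0]
      nlinarith [hχ1 η hη]
  -- The Fourier transform at `ξ` is `((K * f) * a) 0 = ((K * a) * f) 0`. The frequencies of `a` are
  -- the points `ξ - s • η` with `χ η ≠ 0`, where `𝓕 K` vanishes, so `K * a = 0`.
  set a : EuclideanSpace ℝ (Fin d) → ℂ := fun z => ex ξ z * 𝓕⁻ χ (-(s • z)) with ha
  have hap : MemLp a q volume := by
    have h1 : MemLp (fun y => 𝓕⁻ χ (s • (-y))) q volume :=
      hφ.comp_measurePreserving (Measure.measurePreserving_neg volume)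
    simp_rw [smul_neg] at h1
    exact MemLp.of_le h1 ((by fun_prop : Continuous fun y => ex ξ y).aestronglyMeasurable.mul h1.1)
      (by simp [ha])
  have h1 : 𝓕 (fun y => 𝓕⁻ χ (s • y) * conv volume K f y) ξ = conv volume (conv volume K f) a 0 := by
    rw [fourier_eq_integral_ex, conv]
    refine integral_congr_ae (Eventually.of_forall fun y => ?_)
    simp only [ha, zero_sub, smul_neg, neg_neg]
    rw [ex_neg_left]; ring
  rw [h1, conv_conv_comm hap hK hf]
  have h2 : conv volume K a = 0 := by
    ext u
    simp only [conv, ha, Pi.zero_apply]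
    calc _ = ∫ z, ∫ η, χ η * (ex ξ u * ex (s • η) (-u)) * (ex (-(ξ - s • η)) z * K z) := by
          refine integral_congr_ae (Eventually.of_forall fun z => ?_)
          simp only
          rw [fourierInv_eq_integral_ex, ← integral_const_mul, ← integral_const_mul]
          refine integral_congr_ae (Eventually.of_forall fun η => ?_)
          simp only
          rw [neg_sub, sub_eq_add_neg (s • η), ex_add_left, ← smul_neg, ← ex_smul_left, neg_sub,
            sub_eq_add_neg u, sub_eq_add_neg z, ex_add_right, ex_add_right, ex_neg_left ξ z]
          ring
      _ = ∫ η, ∫ z, χ η * (ex ξ u * ex (s • η) (-u)) * (ex (-(ξ - s • η)) z * K z) := by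
          refine integral_integral_swap
            (f := fun z η => χ η * (ex ξ u * ex (s • η) (-u)) * (ex (-(ξ - s • η)) z * K z)) ?_
          have h2 : Integrable (fun z : EuclideanSpace ℝ (Fin d) × EuclideanSpace ℝ (Fin d) =>
            K z.1 * χ z.2) (volume.prod volume) := hK.mul_prod hχ
          refine h2.mono ?_ (Eventually.of_forall fun z => ?_)
          · have h3 : AEStronglyMeasurable (fun z : EuclideanSpace ℝ (Fin d) × EuclideanSpace ℝ (Fin d) =>
              (ex ξ u * ex (s • z.2) (-u) * ex (-(ξ - s • z.2)) z.1) * (K z.1 * χ z.2)) (volume.prod volume) :=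
              (by fun_prop : Continuous fun z : EuclideanSpace ℝ (Fin d) × EuclideanSpace ℝ (Fin d) =>
                ex ξ u * ex (s • z.2) (-u) * ex (-(ξ - s • z.2)) z.1).aestronglyMeasurable.mul h2.1
            refine h3.congr (Eventually.of_forall fun z => ?_)
            simp only [Function.uncurry]; ring
          · simp only [Function.uncurry, norm_mul, norm_ex]
            apply le_of_eq; ring
      _ = 0 := by
          refine integral_eq_zero_of_ae (Eventually.of_forall fun η => ?_)
          simp only [Pi.zero_apply]
          rw [integral_const_mul, ← fourier_eq_integral_ex]
          by_cases h0 : χ η = 0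
          · simp [h0]
          · rw [hK0 η h0, mul_zero]
  rw [h2]
  simp [conv]

omit [p.HolderConjugate q] in
/-- If the spectrum of `g ∈ L_1` stays away from the boundaries of the dyadic rectangles and
`S_R g` is integrable, then the Fourier transform of `S_R g` is `1_R 𝓕 g`. -/
lemma fourier_partialSum (hR : R ∈ dyadicRectangles d) (hg : Integrable g) (hr : 0 < r)
    (hgr : ∀ ξ, 𝓕 g ξ ≠ 0 → WellInside r ξ) (hS : Integrable (partialSum R g)) :
    𝓕 (partialSum R g) = R.indicator (𝓕 g) := by
  classical
  have h1 : partialSum R g = 𝓕⁻ (R.indicator (𝓕 g)) := funext fun x => partialSum_eq_fourierInv hR hg x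
  have hgc := continuous_fourier_of_integrable hg
  have hRm := measurableSet_of_mem_dyadicRectangles hR
  -- Near a point within `r / 2` of the spectrum, membership in `R` is locally constant; near any
  -- other point `𝓕 g` vanishes identically. Continuity is what allows pointwise Fourier inversion.
  have hcont : Continuous (R.indicator (𝓕 g)) := by
    rw [continuous_iff_continuousAt]
    intro ξ
    by_cases hξ : ∃ ζ, ‖ζ - ξ‖ ≤ r / 2 ∧ 𝓕 g ζ ≠ 0
    · obtain ⟨ζ, hζ, hζ0⟩ := hξ
      have hW := hgr ζ hζ0
      have hmem : ∀ᶠ v in 𝓝 ξ, (v ∈ R ↔ ζ ∈ R) := by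
        filter_upwards [Metric.ball_mem_nhds ξ (half_pos hr)] with v hv
        rw [Metric.mem_ball, dist_eq_norm] at hv
        have : ‖v - ζ‖ ≤ r := by
          have := norm_sub_le (v - ξ) (ζ - ξ)
          rw [sub_sub_sub_cancel_right] at this
          linarith
        have := hW.add_mem_iff this hR
        rwa [add_sub_cancel] at this
      by_cases hζR : ζ ∈ R
      · refine hgc.continuousAt.congr ?_
        filter_upwards [hmem] with v hv
        rw [indicator_of_mem (hv.2 hζR)]
      · refine (continuousAt_const (y := (0 : ℂ))).congr ?_
        filter_upwards [hmem] with v hv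
        rw [indicator_of_notMem (fun h => hζR (hv.1 h))]
    · push Not at hξ
      refine (continuousAt_const (y := (0 : ℂ))).congr ?_
      filter_upwards [Metric.ball_mem_nhds ξ (half_pos hr)] with v hv
      rw [Metric.mem_ball, dist_eq_norm] at hv
      rw [indicator_apply, hξ v hv.le, ite_self]
  have hint : Integrable (R.indicator (𝓕 g)) := by
    rw [integrable_indicator_iff hRm]
    exact hgc.continuousOn.integrableOn_of_subset_isCompact
      (isBounded_of_mem_dyadicRectangles hR).isCompact_closure hRm subset_closure
      (volume_lt_top_of_mem_dyadicRectangles hR).ne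
  rw [h1]
  refine hcont.fourier_fourierInv_eq hint ?_
  have h2 : 𝓕 (R.indicator (𝓕 g)) = fun x => 𝓕⁻ (R.indicator (𝓕 g)) (-x) := by
    ext x; rw [Real.fourierInv_eq_fourier_neg, neg_neg]
  rw [h2, ← h1]
  exact hS.comp_neg

end Localization

end DyadicLP

end

noncomputable section

namespace DyadicLP

open Filter Topology

/-! ### Anisotropic dilations. -/

section Dilation

variable {d : ℕ} {p : ℝ≥0∞} {v : Fin d → ℝ} {w : EuclideanSpace ℝ (Fin d) → ℂ}

/-- The linear map multiplying the `i`-th coordinate by `v i`. -/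
def diagMap (v : Fin d → ℝ) : EuclideanSpace ℝ (Fin d) →ₗ[ℝ] EuclideanSpace ℝ (Fin d) :=
  Matrix.toEuclideanLin (Matrix.diagonal v)

@[simp] lemma diagMap_apply (v : Fin d → ℝ) (x : EuclideanSpace ℝ (Fin d)) (i : Fin d) :
    diagMap v x i = v i * x i := by
  simp [diagMap, Matrix.mulVec_diagonal]

lemma det_diagMap (v : Fin d → ℝ) : LinearMap.det (diagMap v) = ∏ i, v i := by
  rw [diagMap, Matrix.toEuclideanLin_eq_toLin_orthonormal, LinearMap.det_toLin,
    Matrix.det_diagonal]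

lemma measurableEmbedding_diagMap (hv : ∏ i, v i ≠ 0) : MeasurableEmbedding (diagMap v) := by
  rw [← det_diagMap] at hv
  exact ((LinearMap.equivOfDetNeZero _ hv).toContinuousLinearEquiv.toHomeomorph).measurableEmbedding

lemma map_diagMap (hv : ∏ i, v i ≠ 0) :
    Measure.map (diagMap v) volume = ENNReal.ofReal |(∏ i, v i)⁻¹| • volume := by
  rw [← det_diagMap] at hv ⊢
  exact Measure.map_linearMap_addHaar_eq_smul_addHaar volume hv

lemma lintegral_comp_diagMap (hv : ∏ i, v i ≠ 0) (F : EuclideanSpace ℝ (Fin d) → ℝ≥0∞) :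
    ∫⁻ x, F (diagMap v x) = ENNReal.ofReal |(∏ i, v i)⁻¹| * ∫⁻ x, F x := by
  rw [← (measurableEmbedding_diagMap hv).lintegral_map, map_diagMap hv, lintegral_smul_measure,
    smul_eq_mul]

lemma integral_comp_diagMap (hv : ∏ i, v i ≠ 0) (F : EuclideanSpace ℝ (Fin d) → ℂ) :
    ∫ x, F (diagMap v x) = (|(∏ i, v i)⁻¹| : ℝ) * ∫ x, F x := by
  rw [← (measurableEmbedding_diagMap hv).integral_map, map_diagMap hv, integral_smul_measure,
    ENNReal.toReal_ofReal (abs_nonneg _), Complex.real_smul]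

/-- The `L_1`-normalized dilate of `w`. -/
def dil (v : Fin d → ℝ) (w : EuclideanSpace ℝ (Fin d) → ℂ) (x : EuclideanSpace ℝ (Fin d)) : ℂ :=
  (|∏ i, v i| : ℝ) * w (diagMap v x)

lemma enorm_dil (x : EuclideanSpace ℝ (Fin d)) :
    ‖dil v w x‖ₑ = ENNReal.ofReal |∏ i, v i| * ‖w (diagMap v x)‖ₑ := by
  rw [dil, enorm_mul]
  congr 1
  rw [← ofReal_norm, Complex.norm_real, Real.norm_of_nonneg (abs_nonneg _)]

lemma ofReal_abs_mul_inv (hv : ∏ i, v i ≠ 0) :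
    ENNReal.ofReal |∏ i, v i| * ENNReal.ofReal |(∏ i, v i)⁻¹| = 1 := by
  rw [← ENNReal.ofReal_mul (abs_nonneg _), ← abs_mul, mul_inv_cancel₀ hv]; simp

lemma lintegral_enorm_dil (hv : ∏ i, v i ≠ 0) : ∫⁻ x, ‖dil v w x‖ₑ = ∫⁻ x, ‖w x‖ₑ := by
  simp_rw [enorm_dil]
  rw [lintegral_const_mul' _ _ ENNReal.ofReal_ne_top,
    lintegral_comp_diagMap hv (fun x => ‖w x‖ₑ), ← mul_assoc, ofReal_abs_mul_inv hv, one_mul]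

lemma setLIntegral_enorm_dil (hv : ∏ i, v i ≠ 0) {s t : Set (EuclideanSpace ℝ (Fin d))}
    (hs : MeasurableSet s) (ht : MeasurableSet t) (hst : ∀ x ∈ s, diagMap v x ∈ t) :
    ∫⁻ x in s, ‖dil v w x‖ₑ ≤ ∫⁻ x in t, ‖w x‖ₑ := by
  rw [← lintegral_indicator hs, ← lintegral_indicator ht]
  have h : ∀ x, s.indicator (fun x => ‖dil v w x‖ₑ) x ≤
      ENNReal.ofReal |∏ i, v i| * t.indicator (fun x => ‖w x‖ₑ) (diagMap v x) := fun x => by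
    by_cases hx : x ∈ s
    · rw [indicator_of_mem hx, indicator_of_mem (hst x hx), enorm_dil]
    · rw [indicator_of_notMem hx]; exact zero_le
  refine (lintegral_mono h).trans_eq ?_
  rw [lintegral_const_mul' _ _ ENNReal.ofReal_ne_top,
    lintegral_comp_diagMap hv (fun x => t.indicator (fun x => ‖w x‖ₑ) x), ← mul_assoc,
    ofReal_abs_mul_inv hv, one_mul]

lemma aestronglyMeasurable_dil (hv : ∏ i, v i ≠ 0) (hw : AEStronglyMeasurable w volume) :
    AEStronglyMeasurable (dil v w) volume := by
  refine AEStronglyMeasurable.const_mul ?_ _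
  refine hw.comp_quasiMeasurePreserving ⟨(measurableEmbedding_diagMap hv).measurable, ?_⟩
  rw [map_diagMap hv]
  exact Measure.smul_absolutelyContinuous

lemma integrable_dil (hv : ∏ i, v i ≠ 0) (hw : Integrable w) : Integrable (dil v w) :=
  ⟨aestronglyMeasurable_dil hv hw.1, by
    rw [HasFiniteIntegral, lintegral_enorm_dil hv]; exact hw.2⟩

lemma integral_dil (hv : ∏ i, v i ≠ 0) : ∫ x, dil v w x = ∫ x, w x := by
  unfold dil
  rw [integral_const_mul, integral_comp_diagMap hv, ← mul_assoc, ← Complex.ofReal_mul, ← abs_mul,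
    mul_inv_cancel₀ hv]
  simp

/-- The relation between `ξ` and `ξ'` is a hypothesis, so that no inverse of the diagonal map has to
be written. -/
lemma fourier_dil (hv : ∏ i, v i ≠ 0) {ξ ξ' : EuclideanSpace ℝ (Fin d)}
    (h : ∀ i, ξ i = v i * ξ' i) : 𝓕 (dil v w) ξ = 𝓕 w ξ' := by
  have he : ∀ x, ex (-ξ) x = ex (-ξ') (diagMap v x) := fun x => by
    unfold ex
    congr 2
    simp only [PiLp.inner_apply, PiLp.neg_apply, diagMap_apply, h]
    refine Finset.sum_congr rfl fun i _ => ?_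
    simp; ring
  rw [fourier_eq_integral_ex, fourier_eq_integral_ex]
  unfold dil
  have : ∀ x, ex (-ξ) x * ((|∏ i, v i| : ℝ) * w (diagMap v x)) =
      (|∏ i, v i| : ℝ) * (fun y => ex (-ξ') y * w y) (diagMap v x) := fun x => by
    simp only [he]; ring
  simp_rw [this]
  rw [integral_const_mul, integral_comp_diagMap hv (fun y => ex (-ξ') y * w y), ← mul_assoc,
    ← Complex.ofReal_mul, ← abs_mul, mul_inv_cancel₀ hv]
  simp

/-- The exponent `p - 1` is positive for `p > 1`: an `L_1`-normalized dilate becomes small in `L_p`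
as the determinant tends to zero. -/
lemma eLpNorm_dil (hv : ∏ i, v i ≠ 0) (hp0 : p ≠ 0) (hp : p ≠ ∞) :
    eLpNorm (dil v w) p volume ^ p.toReal =
      ENNReal.ofReal |∏ i, v i| ^ (p.toReal - 1) * eLpNorm w p volume ^ p.toReal := by
  have hr := ENNReal.toReal_pos hp0 hp
  have h0 : ENNReal.ofReal |∏ i, v i| ≠ 0 := by simpa using hv
  simp_rw [eLpNorm_rpow_eq_lintegral hp0 hp, enorm_dil, ENNReal.mul_rpow_of_nonneg _ _ hr.le]
  rw [lintegral_const_mul' _ _ (ENNReal.rpow_ne_top_of_nonneg hr.le ENNReal.ofReal_ne_top),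
    lintegral_comp_diagMap hv (fun x => ‖w x‖ₑ ^ p.toReal), ← mul_assoc]
  congr 1
  rw [ENNReal.rpow_sub _ _ h0 ENNReal.ofReal_ne_top, ENNReal.rpow_one, abs_inv,
    ENNReal.ofReal_inv_of_pos (abs_pos.2 hv), ENNReal.div_eq_inv_mul, mul_comm]

lemma memLp_dil (hv : ∏ i, v i ≠ 0) (hp0 : p ≠ 0) (hp : p ≠ ∞) (hw : MemLp w p volume) :
    MemLp (dil v w) p volume := by
  refine ⟨aestronglyMeasurable_dil hv hw.1, ?_⟩
  have hr := ENNReal.toReal_pos hp0 hp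
  rw [← ENNReal.rpow_lt_top_iff_of_pos hr, eLpNorm_dil hv hp0 hp]
  refine ENNReal.mul_lt_top (lt_top_iff_ne_top.2 ?_) (ENNReal.rpow_lt_top_of_nonneg hr.le hw.2.ne)
  have h0 : ENNReal.ofReal |∏ i, v i| ≠ 0 := by simpa using hv
  exact ENNReal.rpow_ne_top_of_ne_zero h0 ENNReal.ofReal_ne_top

end Dilation

/-! ### Bump functions and band-limited kernels. -/

section Bumps

variable {d : ℕ}

open SchwartzMap in
/-- Schwartz bump functions. -/
lemma exists_schwartz_bump {a b : ℝ} (ha : 0 < a) (hab : a < b) :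
    ∃ χ : SchwartzMap (EuclideanSpace ℝ (Fin d)) ℂ, (∀ η, ‖η‖ ≤ a → χ η = 1) ∧
      (∀ η, χ η ≠ 0 → ‖η‖ ≤ b) ∧ ∀ η, χ η = (‖χ η‖ : ℝ) := by
  let B : ContDiffBump (0 : EuclideanSpace ℝ (Fin d)) := ⟨a, b, ha, hab⟩
  have h1 : HasCompactSupport (fun η => (B η : ℂ)) :=
    B.hasCompactSupport.comp_left (g := fun t : ℝ => (t : ℂ)) (by simp)
  have h2 : ContDiff ℝ (⊤ : ℕ∞) (fun η => (B η : ℂ)) := Complex.ofRealCLM.contDiff.comp B.contDiff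
  refine ⟨h1.toSchwartzMap h2, fun η hη => ?_, fun η hη => ?_, fun η => ?_⟩
  · have : B η = 1 := B.one_of_mem_closedBall (by simpa [Metric.mem_closedBall] using hη)
    simp [this]
  · by_contra hcon
    push Not at hcon
    refine hη ?_
    have : B η = 0 := B.zero_of_le_dist (by simpa using hcon.le)
    simp [this]
  · simp [abs_of_nonneg B.nonneg]

/-- A normalized Schwartz function on the frequency side, supported in the unit ball. -/
lemma exists_schwartz_bump_integral_eq_one :
    ∃ χ : SchwartzMap (EuclideanSpace ℝ (Fin d)) ℂ, (∀ η, χ η ≠ 0 → ‖η‖ ≤ 1) ∧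
      (∀ η, χ η = (‖χ η‖ : ℝ)) ∧ ∫ η, χ η = 1 := by
  obtain ⟨χ, h1, h2, h3⟩ := exists_schwartz_bump (d := d) (a := 1 / 2) (b := 1) (by norm_num)
    (by norm_num)
  have hI : 0 < ∫ η, ‖χ η‖ := by
    rw [integral_pos_iff_support_of_nonneg (fun η => norm_nonneg _) χ.integrable.norm]
    refine lt_of_lt_of_le (Metric.measure_ball_pos volume (0 : EuclideanSpace ℝ (Fin d))
      (half_pos one_pos)) (measure_mono fun η hη => ?_)
    rw [Function.mem_support, h1 η (by simpa using (Metric.mem_ball.1 hη).le)]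
    simp
  have hI2 : ∫ η, χ η = (∫ η, ‖χ η‖ : ℝ) := by
    rw [← integral_complex_ofReal]
    exact integral_congr_ae (Eventually.of_forall h3)
  refine ⟨((∫ η, ‖χ η‖ : ℝ)⁻¹ : ℂ) • χ, fun η hη => h2 η fun h0 => hη (by simp [h0]), fun η => ?_, ?_⟩
  · simp only [smul_apply, smul_eq_mul, norm_mul, Complex.ofReal_mul]
    rw [← h3 η]
    congr 1
    rw [norm_inv, Complex.norm_real, Real.norm_of_nonneg hI.le]
    push_cast; rfl
  · simp only [smul_apply, smul_eq_mul]
    rw [integral_const_mul, hI2, inv_mul_cancel₀]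
    exact_mod_cast hI.ne'

lemma schwartz_fourierInv_coe (χ : SchwartzMap (EuclideanSpace ℝ (Fin d)) ℂ) :
    ∃ φ : SchwartzMap (EuclideanSpace ℝ (Fin d)) ℂ, 𝓕⁻ (χ : EuclideanSpace ℝ (Fin d) → ℂ) = φ ∧
      𝓕 (φ : EuclideanSpace ℝ (Fin d) → ℂ) = χ := by
  refine ⟨𝓕⁻ χ, (SchwartzMap.fourierInv_coe χ).symm, ?_⟩
  rw [← SchwartzMap.fourier_coe]
  simp

lemma norm_fourierInv_le (χ : EuclideanSpace ℝ (Fin d) → ℂ) (x : EuclideanSpace ℝ (Fin d)) :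
    ‖𝓕⁻ χ x‖ ≤ ∫ η, ‖χ η‖ := by
  rw [fourierInv_eq_integral_ex]
  refine (norm_integral_le_integral_norm _).trans (le_of_eq ?_)
  simp

lemma schwartz_decay (φ : SchwartzMap (EuclideanSpace ℝ (Fin d)) ℂ) (k : ℕ) :
    ∃ C : ℝ, 0 ≤ C ∧ ∀ x, ‖φ x‖ ≤ C * ((1 + ‖x‖) ^ k)⁻¹ := by
  refine ⟨2 ^ k * (Finset.Iic (k, 0)).sup (fun m => SchwartzMap.seminorm ℝ m.1 m.2) φ, ?_,
    fun x => ?_⟩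
  · positivity
  · have := SchwartzMap.one_add_le_sup_seminorm_apply (𝕜 := ℝ) (m := (k, 0)) le_rfl le_rfl φ x
    rw [← div_eq_mul_inv, le_div_iff₀ (by positivity), mul_comm]
    simpa using this

/-- A nonnegative, normalized, smooth and rapidly decreasing function with compact spectrum. -/
lemma exists_positive_kernel :
    ∃ ρ : EuclideanSpace ℝ (Fin d) → ℂ, Integrable ρ ∧ (∀ q : ℝ≥0∞, MemLp ρ q volume) ∧
      ∫ x, ρ x = 1 ∧ ∫⁻ x, ‖ρ x‖ₑ = 1 ∧ ∀ ξ, 𝓕 ρ ξ ≠ 0 → ‖ξ‖ ≤ 2 := by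
  obtain ⟨χ, hχ1, hχ2, hχ3⟩ := exists_schwartz_bump_integral_eq_one (d := d)
  obtain ⟨φ, hφ, hφχ⟩ := schwartz_fourierInv_coe χ
  have hφ0 : φ 0 = 1 := by
    rw [← hφ, fourierInv_eq_integral_ex]; simp [hχ3]
  have hconj : ∀ x, (starRingEnd ℂ) (φ x) = 𝓕 (χ : EuclideanSpace ℝ (Fin d) → ℂ) x := fun x => by
    rw [← hφ, fourierInv_eq_integral_ex, fourier_eq_integral_ex, ← integral_conj]
    refine integral_congr_ae (Eventually.of_forall fun η => ?_)
    simp only [map_mul, conj_ex]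
    rw [hχ2 η, Complex.conj_ofReal, ex_neg_left, ex_comm, ex_neg_left]
  -- The kernel is `|φ|²`, normalized. Its Fourier transform is an autocorrelation of `χ`, hence
  -- supported in the ball of radius `2`.
  set σ : EuclideanSpace ℝ (Fin d) → ℂ := fun x => φ x * (starRingEnd ℂ) (φ x) with hσ
  have hσn : ∀ x, σ x = (‖φ x‖ ^ 2 : ℝ) := fun x => by
    simp only [hσ]; rw [Complex.mul_conj, Complex.normSq_eq_norm_sq]
  obtain ⟨C, hC0, hC⟩ := schwartz_decay φ 0
  have hmem : ∀ q : ℝ≥0∞, MemLp σ q volume := fun q => by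
    refine MemLp.of_le_mul (g := φ) (c := C) (φ.memLp q volume) ?_ (Eventually.of_forall fun x => ?_)
    · exact (by fun_prop : Continuous σ).aestronglyMeasurable
    · rw [hσn, Complex.norm_real, Real.norm_of_nonneg (by positivity), sq]
      gcongr
      simpa using hC x
  have hσi : Integrable σ := memLp_one_iff_integrable.1 (hmem 1)
  set I : ℝ := ∫ x, ‖φ x‖ ^ 2 with hI
  have hIσ : ∫ x, σ x = (I : ℂ) := by
    rw [hI, ← integral_complex_ofReal]
    exact integral_congr_ae (Eventually.of_forall hσn)
  have hi2 : Integrable fun x => ‖φ x‖ ^ 2 := by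
    refine hσi.norm.congr (Eventually.of_forall fun x => ?_)
    simp only [hσn]; rw [Complex.norm_real, Real.norm_of_nonneg (by positivity)]
  have hI0 : 0 < I := by
    refine integral_pos_of_integrable_nonneg_nonzero
      (by fun_prop : Continuous fun x => ‖φ x‖ ^ 2) hi2
      (fun x => by positivity) (x := 0) (by simp [hφ0])
  refine ⟨fun x => (I⁻¹ : ℝ) * σ x, hσi.const_mul _, fun q => (hmem q).const_mul _, ?_, ?_, fun ξ hξ => ?_⟩
  · rw [integral_const_mul, hIσ, ← Complex.ofReal_mul, inv_mul_cancel₀ hI0.ne']; simp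
  · have : ∀ x, ‖((I⁻¹ : ℝ) : ℂ) * σ x‖ₑ = ENNReal.ofReal (I⁻¹ * ‖φ x‖ ^ 2) := fun x => by
      rw [hσn, ← Complex.ofReal_mul, ← ofReal_norm, Complex.norm_real,
        Real.norm_of_nonneg (by positivity)]
    simp_rw [this]
    rw [← ofReal_integral_eq_lintegral_ofReal (hi2.const_mul _)
      (Eventually.of_forall fun x => by positivity), integral_const_mul, inv_mul_cancel₀ hI0.ne']
    simp
  · by_contra hcon
    push Not at hcon
    refine hξ ?_
    have h1 : 𝓕 (fun x => ((I⁻¹ : ℝ) : ℂ) * σ x) ξ =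
        ((I⁻¹ : ℝ) : ℂ) * ∫ x, (ex (-ξ) x * φ x) * 𝓕 (χ : EuclideanSpace ℝ (Fin d) → ℂ) x := by
      rw [fourier_eq_integral_ex, ← integral_const_mul]
      refine integral_congr_ae (Eventually.of_forall fun x => ?_)
      simp only [hσ, hconj]; ring
    -- The multiplication formula turns the transform of `φ · conj φ` into `∫ χ(η) χ(η + ξ) dη`,
    -- whose integrand vanishes when `‖ξ‖ > 2`.
    have h2 := VectorFourier.integral_fourierIntegral_smul_eq_flip (μ := volume) (ν := volume)
      (L := innerₗ (EuclideanSpace ℝ (Fin d))) (f := (χ : EuclideanSpace ℝ (Fin d) → ℂ))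
      (g := fun x => ex (-ξ) x * φ x)
      Real.continuous_fourierChar (by exact continuous_inner) χ.integrable (integrable_ex_mul φ.integrable)
    rw [flip_innerₗ] at h2
    have h3 : ∫ x, (ex (-ξ) x * φ x) * 𝓕 (χ : EuclideanSpace ℝ (Fin d) → ℂ) x =
        ∫ η, χ η • 𝓕 (fun x => ex (-ξ) x * φ x) η := by
      refine Eq.trans ?_ h2
      refine integral_congr_ae (Eventually.of_forall fun x => ?_)
      simp only [smul_eq_mul]
      rw [mul_comm]; rfl
    rw [h1, h3]
    convert mul_zero _
    refine integral_eq_zero_of_ae (Eventually.of_forall fun η => ?_)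
    have h4 : 𝓕 (fun x => ex (-ξ) x * φ x) η = χ (η + ξ) := by
      rw [← hφχ, fourier_eq_integral_ex, fourier_eq_integral_ex]
      refine integral_congr_ae (Eventually.of_forall fun x => ?_)
      simp only
      rw [neg_add, ex_add_left]; ring
    simp only [h4, Pi.zero_apply, smul_eq_mul]
    by_cases h5 : χ η = 0
    · rw [h5, zero_mul]
    by_cases h6 : χ (η + ξ) = 0
    · rw [h6, mul_zero]
    exfalso
    have h7 := hχ1 _ h5
    have h8 := hχ1 _ h6
    have := norm_sub_le (η + ξ) η
    rw [add_sub_cancel_left] at this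
    linarith

end Bumps

end DyadicLP

end

noncomputable section

namespace DyadicLP

open Filter Topology

/-! ### Convolution with spread-out kernels is small in `L_p`. -/

section SmallConvolution

variable {d : ℕ} {p : ℝ≥0∞}

lemma exists_eLpNorm_indicator_compl_ball_le (hp0 : p ≠ 0) (hp : p ≠ ∞)
    {u : EuclideanSpace ℝ (Fin d) → ℝ≥0∞} (hup : eLpNorm u p volume ≠ ∞)
    {ε : ℝ≥0∞} (hε : ε ≠ 0) :
    ∃ n : ℕ, eLpNorm ((Metric.ball (0 : EuclideanSpace ℝ (Fin d)) n)ᶜ.indicator u) p volume ≤ ε := by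
  rcases eq_or_ne ε ∞ with rfl | hε'
  · exact ⟨0, le_top⟩
  have hr := ENNReal.toReal_pos hp0 hp
  set s : ℕ → Set (EuclideanSpace ℝ (Fin d)) := fun n => (Metric.ball 0 n)ᶜ with hs
  have hsm : ∀ n, MeasurableSet (s n) := fun n => measurableSet_ball.compl
  set ν := (volume : Measure (EuclideanSpace ℝ (Fin d))).withDensity fun x => u x ^ p.toReal with hν
  have hνs : ∀ n, eLpNorm ((s n).indicator u) p volume ^ p.toReal = ν (s n) := fun n => by
    rw [eLpNorm_rpow_eq_lintegral hp0 hp, hν, withDensity_apply _ (hsm n),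
      ← lintegral_indicator (hsm n)]
    refine lintegral_congr fun x => ?_
    by_cases hx : x ∈ s n
    · simp [hx]
    · simp [hx, hr]
  have hfin : ν (s 0) ≠ ∞ := by
    rw [← hνs 0]
    refine ENNReal.rpow_ne_top_of_nonneg hr.le (ne_top_of_le_ne_top hup ?_)
    exact eLpNorm_mono_enorm fun x => by
      simp only [enorm_eq_self]; exact indicator_le_self _ _ _
  have hanti : Antitone s := fun m n hmn => by
    refine compl_subset_compl.2 (Metric.ball_subset_ball ?_)
    exact_mod_cast hmn
  have hlim : Tendsto (fun n => ν (s n)) atTop (𝓝 0) := by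
    have := tendsto_measure_iInter_atTop (μ := ν) (s := s)
      (fun n => (hsm n).nullMeasurableSet) hanti ⟨0, hfin⟩
    have hempty : ⋂ n, s n = ∅ := by
      rw [eq_empty_iff_forall_notMem]
      intro x hx
      obtain ⟨n, hn⟩ := exists_nat_gt ‖x‖
      exact (mem_iInter.1 hx n) (by simpa using hn)
    rwa [hempty, measure_empty] at this
  have hpos : 0 < ε ^ p.toReal := ENNReal.rpow_pos (pos_iff_ne_zero.2 hε) hε'
  obtain ⟨n, hn⟩ := (hlim.eventually_le_const hpos).exists
  refine ⟨n, ?_⟩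
  rw [← ENNReal.rpow_le_rpow_iff hr]
  exact (hνs n).trans_le hn

lemma lintegral_indicator_ball_ne_top (hp1 : 1 ≤ p)
    {u : EuclideanSpace ℝ (Fin d) → ℝ≥0∞} (hu : AEMeasurable u volume)
    (hup : eLpNorm u p volume ≠ ∞) (n : ℕ) :
    ∫⁻ x, (Metric.ball (0 : EuclideanSpace ℝ (Fin d)) n).indicator u x ≠ ∞ := by
  rw [lintegral_indicator measurableSet_ball]
  have h := eLpNorm_le_eLpNorm_mul_rpow_measure_univ
    (μ := volume.restrict (Metric.ball (0 : EuclideanSpace ℝ (Fin d)) n)) (f := u) hp1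
    hu.aestronglyMeasurable.restrict
  rw [eLpNorm_one_eq_lintegral_enorm] at h
  simp only [enorm_eq_self] at h
  refine ne_top_of_le_ne_top (ENNReal.mul_ne_top ?_ ?_) h
  · exact ne_top_of_le_ne_top hup (eLpNorm_restrict_le _ _ _ _)
  · refine ENNReal.rpow_ne_top_of_nonneg ?_ ?_
    · rw [sub_nonneg]
      rcases eq_or_ne p ∞ with rfl | hp
      · simp
      have : 1 ≤ p.toReal := by
        rw [← ENNReal.toReal_one]; exact (ENNReal.toReal_le_toReal (by simp) hp).2 hp1
      simpa using inv_le_one_of_one_le₀ this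
    · rw [Measure.restrict_apply_univ]; exact measure_ball_lt_top.ne

lemma lconv_comm {k u : EuclideanSpace ℝ (Fin d) → ℝ≥0∞} (x : EuclideanSpace ℝ (Fin d)) :
    ∫⁻ z, k z * u (x - z) = ∫⁻ z, u z * k (x - z) := by
  rw [← lintegral_sub_left_eq_self (fun z => k z * u (x - z)) x]
  simp [mul_comm]

lemma prod_update_one (i : Fin d) (t : ℝ) : ∏ j, Function.update (1 : Fin d → ℝ) i t j = t := by
  rw [Finset.prod_update_of_mem (Finset.mem_univ i)]; simp

/-- Convolution with kernels that are spread out in one direction is small in `L_p`, `p > 1`. -/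
lemma exists_eLpNorm_lconv_dil_le (hp1 : 1 < p) (hp : p < ∞)
    {w : EuclideanSpace ℝ (Fin d) → ℂ} (hw : Integrable w) (hwp : MemLp w p volume)
    {u : EuclideanSpace ℝ (Fin d) → ℝ≥0∞} (hu : AEMeasurable u volume)
    (hup : eLpNorm u p volume ≠ ∞) (i : Fin d) {ε : ℝ≥0∞} (hε : ε ≠ 0) :
    ∃ t₀ : ℝ, 0 < t₀ ∧ ∀ t, 0 < t → t ≤ t₀ →
      eLpNorm (fun x => ∫⁻ z, ‖dil (Function.update 1 i t) w z‖ₑ * u (x - z)) p volume ≤ ε := by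
  have hp0 : p ≠ 0 := (zero_lt_one.trans hp1).ne'
  have hr : 1 < p.toReal := by
    rw [← ENNReal.toReal_one]; exact (ENNReal.toReal_lt_toReal (by simp) hp.ne).2 hp1
  have hr0 : 0 < p.toReal := by linarith
  set A := ∫⁻ x, ‖w x‖ₑ with hA
  have hAtop : A ≠ ∞ := hw.2.ne
  obtain ⟨n, hn⟩ := exists_eLpNorm_indicator_compl_ball_le hp0 hp.ne hup
    (ε := ε / 2 / (A + 1)) (by
      have : A + 1 ≠ ∞ := by simp [hAtop]
      simp [ENNReal.div_eq_zero_iff, hε, this])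
  set u₁ := (Metric.ball (0 : EuclideanSpace ℝ (Fin d)) n).indicator u with hu₁
  set u₂ := (Metric.ball (0 : EuclideanSpace ℝ (Fin d)) n)ᶜ.indicator u with hu₂
  have hu12 : ∀ x, u x = u₁ x + u₂ x := fun x => by
    by_cases hx : x ∈ Metric.ball (0 : EuclideanSpace ℝ (Fin d)) n <;> simp [hu₁, hu₂, hx]
  have hu₁m : AEMeasurable u₁ volume := hu.indicator measurableSet_ball
  have hu₂m : AEMeasurable u₂ volume := hu.indicator measurableSet_ball.compl
  have hu₁i : ∫⁻ x, u₁ x ≠ ∞ := lintegral_indicator_ball_ne_top hp1.le hu hup n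
  -- The compactly supported part `u₁` is integrable, so Young's inequality with the roles exchanged
  -- bounds its convolution by `‖u₁‖_1` times the `L_p` norm of the dilate, of order `t^{(p-1)/p}`.
  -- The tail `u₂` is small in `L_p` already and is only met by the `L_1` norm `A` of the dilate.
  have hlim : Tendsto (fun t : ℝ => (∫⁻ x, u₁ x) * (ENNReal.ofReal t ^ ((p.toReal - 1) / p.toReal) *
      eLpNorm w p volume)) (𝓝[>] 0) (𝓝 0) := by
    have h1 : Tendsto (fun t : ℝ => ENNReal.ofReal t ^ ((p.toReal - 1) / p.toReal)) (𝓝[>] 0) (𝓝 0) := by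
      have h2 : Continuous fun t : ℝ => ENNReal.ofReal t ^ ((p.toReal - 1) / p.toReal) :=
        ENNReal.continuous_rpow_const.comp ENNReal.continuous_ofReal
      have h3 := h2.tendsto 0
      rw [ENNReal.ofReal_zero, ENNReal.zero_rpow_of_pos (div_pos (by linarith) hr0)] at h3
      exact h3.mono_left nhdsWithin_le_nhds
    have h4 := ENNReal.Tendsto.const_mul (a := ∫⁻ x, u₁ x)
      (ENNReal.Tendsto.mul_const (b := eLpNorm w p volume) h1 (Or.inr hwp.2.ne)) (Or.inr hu₁i)
    simpa using h4
  have hε2 : 0 < ε / 2 := by simp [pos_iff_ne_zero, hε]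
  have hev := hlim.eventually_le_const hε2
  obtain ⟨t₀, ht₀, hsub⟩ := mem_nhdsGT_iff_exists_Ioc_subset.1 hev
  refine ⟨t₀, ht₀, fun t ht htt => ?_⟩
  have ht1 := hsub ⟨ht, htt⟩
  set v := Function.update (1 : Fin d → ℝ) i t with hv
  have hprod : ∏ j, v j = t := prod_update_one i t
  have hv0 : ∏ j, v j ≠ 0 := by rw [hprod]; exact ht.ne'
  have hdm := (aestronglyMeasurable_dil hv0 hw.1).enorm
  have hdI : ∫⁻ x, ‖dil v w x‖ₑ = A := lintegral_enorm_dil hv0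
  have hdp : eLpNorm (dil v w) p volume =
      ENNReal.ofReal t ^ ((p.toReal - 1) / p.toReal) * eLpNorm w p volume := by
    have h := eLpNorm_dil (w := w) hv0 hp0 hp.ne
    rw [hprod, abs_of_pos ht] at h
    apply (ENNReal.rpow_left_injective hr0.ne')
    simp only
    rw [h, ENNReal.mul_rpow_of_nonneg _ _ hr0.le, ← ENNReal.rpow_mul, div_mul_cancel₀ _ hr0.ne']
  have hmeas : ∀ u' : EuclideanSpace ℝ (Fin d) → ℝ≥0∞, AEMeasurable u' volume →
      AEMeasurable (fun x => ∫⁻ z, ‖dil v w z‖ₑ * u' (x - z)) volume := fun u' hu' => by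
    refine AEMeasurable.lintegral_prod_right' (f := fun y : _ × _ => ‖dil v w y.2‖ₑ * u' (y.1 - y.2)) ?_
    exact (hdm.comp_snd).mul (hu'.comp_quasiMeasurePreserving
      (quasiMeasurePreserving_sub_of_right_invariant volume volume))
  calc eLpNorm (fun x => ∫⁻ z, ‖dil v w z‖ₑ * u (x - z)) p volume
      ≤ eLpNorm ((fun x => ∫⁻ z, ‖dil v w z‖ₑ * u₁ (x - z)) +
          fun x => ∫⁻ z, ‖dil v w z‖ₑ * u₂ (x - z)) p volume := by
        refine eLpNorm_mono_enorm fun x => ?_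
        simp only [enorm_eq_self, Pi.add_apply, hu12, mul_add]
        rw [lintegral_add_left']
        exact hdm.mul (hu₁m.comp_quasiMeasurePreserving
          (Measure.measurePreserving_sub_left volume x).quasiMeasurePreserving)
    _ ≤ eLpNorm (fun x => ∫⁻ z, ‖dil v w z‖ₑ * u₁ (x - z)) p volume +
          eLpNorm (fun x => ∫⁻ z, ‖dil v w z‖ₑ * u₂ (x - z)) p volume :=
        eLpNorm_add_le (hmeas u₁ hu₁m).aestronglyMeasurable (hmeas u₂ hu₂m).aestronglyMeasurable hp1.le
    _ ≤ (∫⁻ x, u₁ x) * eLpNorm (dil v w) p volume + A * eLpNorm u₂ p volume := by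
        gcongr
        · simp_rw [lconv_comm (k := fun z => ‖dil v w z‖ₑ) (u := u₁)]
          refine (eLpNorm_lconv_le hp1.le hp.ne hu₁m hu₁i hdm).trans_eq ?_
          rw [eLpNorm_enorm]
        · refine (eLpNorm_lconv_le hp1.le hp.ne hdm (by rw [hdI]; exact hAtop) hu₂m).trans_eq ?_
          rw [hdI]
    _ ≤ ε / 2 + ε / 2 := by
        gcongr
        · rw [hdp]; exact ht1
        · calc A * eLpNorm u₂ p volume ≤ (A + 1) * (ε / 2 / (A + 1)) := by
                gcongr
                exact le_self_add
            _ ≤ ε / 2 := ENNReal.mul_div_le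
    _ = ε := ENNReal.add_halves ε

end SmallConvolution

/-! ### Clearing the spectrum near hyperplanes. -/

section Removal

variable {d : ℕ} {p q : ℝ≥0∞} [p.HolderConjugate q] {f K : EuclideanSpace ℝ (Fin d) → ℂ}

lemma fourier_conv {V K : EuclideanSpace ℝ (Fin d) → ℂ} (hV : Integrable V) (hK : Integrable K)
    (ξ : EuclideanSpace ℝ (Fin d)) : 𝓕 (conv volume V K) ξ = 𝓕 V ξ * 𝓕 K ξ :=
  Real.fourier_mul_convolution_eq hV hK ξ

lemma fourier_sub_apply {V K : EuclideanSpace ℝ (Fin d) → ℂ} (hV : Integrable V) (hK : Integrable K)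
    (ξ : EuclideanSpace ℝ (Fin d)) : 𝓕 (fun x => V x - K x) ξ = 𝓕 V ξ - 𝓕 K ξ := by
  simp_rw [fourier_eq_integral_ex, mul_sub]
  exact integral_sub (integrable_ex_mul hV) (integrable_ex_mul hK)

/-- A kernel can be modified so that its spectrum avoids a neighbourhood of a hyperplane
`ξ i = b`, with little effect on `K * f` and on its square function. -/
lemma exists_kernel_avoiding_hyperplane (hp1 : 1 < p) (hp : p < ∞) (hq1 : 1 ≤ q) (hq : q ≠ ∞)
    (hf : MemLp f p volume)
    (hK : Integrable K) (hKq : MemLp K q volume) {M : ℝ} (hM : ∀ ξ, 𝓕 K ξ ≠ 0 → ‖ξ‖ ≤ M)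
    (i : Fin d) (b : ℝ) {ε : ℝ≥0∞} (hε : ε ≠ 0) :
    ∃ L : EuclideanSpace ℝ (Fin d) → ℂ, Integrable L ∧ MemLp L q volume ∧
      (∀ ξ, 𝓕 L ξ ≠ 0 → 𝓕 K ξ ≠ 0) ∧ (∃ δ > 0, ∀ ξ, 𝓕 L ξ ≠ 0 → δ ≤ |ξ i - b|) ∧
      eLpNorm (fun x => conv volume L f x - conv volume K f x) p volume ≤ ε ∧
      eLpNorm (squareFunction (conv volume L f)) p volume ≤
        eLpNorm (squareFunction (conv volume K f)) p volume + ε := by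
  have hp0 : p ≠ 0 := (zero_lt_one.trans hp1).ne'
  have hqp : ENNReal.HolderConjugate q p := ENNReal.HolderConjugate.symm
  set h := conv volume K f with hh
  have hhp : MemLp h p volume := memLp_conv hp1.le hp.ne hK hf
  set M' := max M 0 with hM'
  -- Radius `M' + 1`: a rescaled frequency to be removed is a vector of norm at most `M` plus an
  -- `i`-th coordinate of absolute value at most one.
  obtain ⟨χ, hχ1, hχ2, -⟩ := exists_schwartz_bump (d := d) (a := M' + 1) (b := M' + 2)
    (by positivity) (by linarith)
  obtain ⟨w, hw, hwχ⟩ := schwartz_fourierInv_coe χ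
  obtain ⟨t₁, ht₁, H₁⟩ := exists_eLpNorm_lconv_dil_le hp1 hp w.integrable (w.memLp p volume)
    hhp.1.enorm (by rw [eLpNorm_enorm]; exact hhp.2.ne) i hε
  -- When the square function of `h` has infinite norm there is nothing to prove, and any `t₂`
  -- serves.
  obtain ⟨t₂, ht₂, H₂⟩ : ∃ t₂ : ℝ, 0 < t₂ ∧ ∀ t, 0 < t → t ≤ t₂ →
      eLpNorm (squareFunction h) p volume + eLpNorm (fun x => ∫⁻ z,
        ‖dil (Function.update 1 i t) w z‖ₑ * squareFunction h (x - z)) p volume ≤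
        eLpNorm (squareFunction h) p volume + ε := by
    by_cases hS : eLpNorm (squareFunction h) p volume = ∞
    · exact ⟨1, one_pos, fun t _ _ => by simp [hS]⟩
    · obtain ⟨t₂, ht₂, H₂⟩ := exists_eLpNorm_lconv_dil_le hp1 hp w.integrable (w.memLp p volume)
        (measurable_squareFunction hhp.1).aemeasurable hS i hε
      exact ⟨t₂, ht₂, fun t h1 h2 => by gcongr; exact H₂ t h1 h2⟩
  set t := min 1 (min t₁ t₂) with ht
  have ht0 : 0 < t := lt_min one_pos (lt_min ht₁ ht₂)
  have htt₁ : t ≤ t₁ := (min_le_right _ _).trans (min_le_left _ _)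
  have htt₂ : t ≤ t₂ := (min_le_right _ _).trans (min_le_right _ _)
  set v := Function.update (1 : Fin d → ℝ) i t with hv
  have hprod : ∏ j, v j = t := prod_update_one i t
  have hv0 : ∏ j, v j ≠ 0 := by rw [hprod]; exact ht0.ne'
  set e : EuclideanSpace ℝ (Fin d) := EuclideanSpace.single i b with he
  -- The dilate is long in the `i`-th direction, so its transform lives in a slab of width of order
  -- `t`; modulation by `e` centres the slab at `ξ i = b`. There `𝓕 V = 1` on the spectrum of `K`,
  -- so `L = K - V * K` has no spectrum, and `L * f` differs from `K * f` by the small function `V *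
  -- h`.
  set V : EuclideanSpace ℝ (Fin d) → ℂ := fun x => ex e x * dil v w x with hVdef
  have hVi : Integrable V := integrable_ex_mul (integrable_dil hv0 w.integrable)
  have hVn : ∀ x, ‖V x‖ₑ = ‖dil v w x‖ₑ := fun x => by simp [hVdef]
  have hVK : Integrable (conv volume V K) :=
    memLp_one_iff_integrable.1 (memLp_conv le_rfl (by simp) hVi (memLp_one_iff_integrable.2 hK))
  have hVKq : MemLp (conv volume V K) q volume := memLp_conv hq1 hq hVi hKq
  set L : EuclideanSpace ℝ (Fin d) → ℂ := fun x => K x - conv volume V K x with hL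
  have hconv : conv volume L f = fun x => h x - conv volume V h x := by
    ext x
    rw [hh, conv_assoc hVi hKq hf, conv, conv, conv]
    simp_rw [hL, sub_mul]
    exact integral_sub (integrable_mul_comp_sub hKq hf x) (integrable_mul_comp_sub hVKq hf x)
  have hFL : ∀ ξ, 𝓕 L ξ = 𝓕 K ξ * (1 - 𝓕 V ξ) := fun ξ => by
    rw [hL, fourier_sub_apply hK hVK, fourier_conv hVi hK]; ring
  have hFV : ∀ ξ, ‖ξ‖ ≤ M → |ξ i - b| ≤ t → 𝓕 V ξ = 1 := fun ξ hξ hξb => by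
    have h1 : 𝓕 V ξ = 𝓕 (dil v w) (ξ - e) := by
      rw [fourier_eq_integral_ex, fourier_eq_integral_ex]
      refine integral_congr_ae (Eventually.of_forall fun z => ?_)
      simp only [hVdef]
      rw [neg_sub, sub_eq_add_neg, ex_add_left]; ring
    set ξ' : EuclideanSpace ℝ (Fin d) := WithLp.toLp 2 fun j => (ξ - e) j / v j with hξ'
    have hvj : ∀ j, v j ≠ 0 := fun j hj => hv0 (Finset.prod_eq_zero (Finset.mem_univ j) hj)
    rw [h1, fourier_dil hv0 (ξ' := ξ') (fun j => by simp only [hξ']; rw [mul_div_cancel₀ _ (hvj j)]),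
      hwχ]
    refine hχ1 _ ?_
    have hdecomp : ξ' = (ξ - EuclideanSpace.single i (ξ i)) + EuclideanSpace.single i ((ξ i - b) / t) := by
      ext j
      by_cases hj : j = i
      · subst hj; simp [hξ', he, hv]
      · simp [hξ', he, hv, hj]
    have hn1 : ‖ξ - EuclideanSpace.single i (ξ i)‖ ≤ ‖ξ‖ := by
      rw [EuclideanSpace.norm_eq, EuclideanSpace.norm_eq]
      refine Real.sqrt_le_sqrt (Finset.sum_le_sum fun j _ => ?_)
      by_cases hj : j = i
      · subst hj; simp; positivity
      · simp [hj]
    have hn2 : ‖EuclideanSpace.single i ((ξ i - b) / t)‖ ≤ 1 := by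
      rw [PiLp.norm_single, norm_div, Real.norm_eq_abs, Real.norm_of_nonneg ht0.le,
        div_le_one ht0]
      exact hξb
    rw [hdecomp]
    refine (norm_add_le _ _).trans ?_
    have := le_max_left M 0
    linarith
  refine ⟨L, hK.sub hVK, hKq.sub hVKq, fun ξ hξ h0 => hξ (by rw [hFL, h0, zero_mul]),
    ⟨t, ht0, fun ξ hξ => ?_⟩, ?_, ?_⟩
  · by_contra hcon
    push Not at hcon
    have hK0 : 𝓕 K ξ ≠ 0 := fun h0 => hξ (by rw [hFL, h0, zero_mul])
    exact hξ (by rw [hFL, hFV ξ (hM ξ hK0) hcon.le, sub_self, mul_zero])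
  · refine le_trans (eLpNorm_mono_enorm fun x => ?_) (H₁ t ht0 htt₁)
    rw [hconv, enorm_eq_self]
    simp only [sub_sub_cancel_left, enorm_neg]
    refine (enorm_conv_le_lintegral V h x).trans_eq ?_
    simp_rw [hVn]; rfl
  · have hVh : MemLp (conv volume V h) p volume := memLp_conv hp1.le hp.ne hVi hhp
    rw [hconv]
    calc _ ≤ eLpNorm (squareFunction h + squareFunction (conv volume V h)) p volume :=
          eLpNorm_mono_enorm fun x => squareFunction_sub_le hp1 hp hhp hVh x
      _ ≤ eLpNorm (squareFunction h) p volume + eLpNorm (squareFunction (conv volume V h)) p volume :=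
          eLpNorm_add_le (measurable_squareFunction hhp.1).aestronglyMeasurable
            (measurable_squareFunction hVh.1).aestronglyMeasurable hp1.le
      _ ≤ eLpNorm (squareFunction h) p volume + eLpNorm (fun x => ∫⁻ z,
            ‖dil (Function.update 1 i t) w z‖ₑ * squareFunction h (x - z)) p volume := by
          gcongr
          refine eLpNorm_mono_enorm fun x => ?_
          refine (squareFunction_conv_le hp1 hp hVi hhp x).trans_eq ?_
          simp_rw [hVn]; rfl
      _ ≤ _ := H₂ t ht0 htt₂

/-- Hyperplanes are removed one at a time with halved errors. Each step only shrinks the spectrum,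
so distances already gained are kept. -/
lemma exists_kernel_avoiding_hyperplanes (hp1 : 1 < p) (hp : p < ∞) (hq1 : 1 ≤ q) (hq : q ≠ ∞)
    (hf : MemLp f p volume)
    (hK : Integrable K) (hKq : MemLp K q volume) {M : ℝ} (hM : ∀ ξ, 𝓕 K ξ ≠ 0 → ‖ξ‖ ≤ M)
    (B : Finset (Fin d × ℝ)) {ε : ℝ≥0∞} (hε : ε ≠ 0) :
    ∃ L : EuclideanSpace ℝ (Fin d) → ℂ, Integrable L ∧ MemLp L q volume ∧
      (∀ ξ, 𝓕 L ξ ≠ 0 → 𝓕 K ξ ≠ 0) ∧ (∃ δ > 0, ∀ ξ, 𝓕 L ξ ≠ 0 → ∀ b ∈ B, δ ≤ |ξ b.1 - b.2|) ∧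
      eLpNorm (fun x => conv volume L f x - conv volume K f x) p volume ≤ ε ∧
      eLpNorm (squareFunction (conv volume L f)) p volume ≤
        eLpNorm (squareFunction (conv volume K f)) p volume + ε := by
  induction B using Finset.cons_induction generalizing ε with
  | empty => exact ⟨K, hK, hKq, fun ξ h => h, ⟨1, one_pos, by simp⟩, by simp, le_self_add⟩
  | cons b B hb ih =>
    have hε2 : ε / 2 ≠ 0 := by simp [hε]
    obtain ⟨L₁, hi₁, hq₁, hs₁, ⟨δ₁, hδ₁, hd₁⟩, hn₁, hS₁⟩ := ih hε2
    obtain ⟨L₂, hi₂, hq₂, hs₂, ⟨δ₂, hδ₂, hd₂⟩, hn₂, hS₂⟩ := exists_kernel_avoiding_hyperplane hp1 hp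
      hq1 hq hf hi₁ hq₁ (fun ξ hξ => hM ξ (hs₁ ξ hξ)) b.1 b.2 hε2
    refine ⟨L₂, hi₂, hq₂, fun ξ hξ => hs₁ ξ (hs₂ ξ hξ), ⟨min δ₁ δ₂, lt_min hδ₁ hδ₂, fun ξ hξ c hc => ?_⟩,
      ?_, ?_⟩
    · rcases Finset.mem_cons.1 hc with rfl | hc
      · exact (min_le_right _ _).trans (hd₂ ξ hξ)
      · exact (min_le_left _ _).trans (hd₁ ξ (hs₂ ξ hξ) c hc)
    · have hm : ∀ L : EuclideanSpace ℝ (Fin d) → ℂ, Integrable L → MemLp (conv volume L f) p volume :=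
        fun L hL => memLp_conv hp1.le hp.ne hL hf
      calc _ = eLpNorm ((fun x => conv volume L₂ f x - conv volume L₁ f x) +
            fun x => conv volume L₁ f x - conv volume K f x) p volume := by
            congr 1; ext x; simp
        _ ≤ _ := eLpNorm_add_le ((hm _ hi₂).sub (hm _ hi₁)).1 ((hm _ hi₁).sub (hm _ hK)).1 hp1.le
        _ ≤ ε / 2 + ε / 2 := add_le_add hn₂ hn₁
        _ = ε := ENNReal.add_halves ε
    · refine hS₂.trans ?_
      calc _ ≤ eLpNorm (squareFunction (conv volume K f)) p volume + ε / 2 + ε / 2 := by gcongr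
        _ = _ := by rw [add_assoc, ENNReal.add_halves]

end Removal

end DyadicLP

end

noncomputable section

namespace DyadicLP

open Filter Topology

/-! ### Only finitely many dyadic hyperplanes matter. -/

section Separation

/-- The absolute values of the endpoints of the interval of `x` lie within a factor two of `|x|`,
hence between `δ₀ / 2` and `2 M`, which leaves the exponents `|k| ≤ N`. To leave the interval, `y`
would have to cross an endpoint at distance at least `δ`. -/
lemma mem_dyadicInterval_of_separated {I : Set ℝ} (hI : I ∈ dyadicIntervals) {x y δ₀ δ M : ℝ} {N : ℕ}
    (hx : x ∈ I) (hx0 : δ₀ ≤ |x|) (hxM : |x| ≤ M) (hN0 : (2 : ℝ) ^ (-(N : ℤ)) ≤ δ₀ / 2)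
    (hNM : 2 * M ≤ 2 ^ (N : ℤ))
    (hsep : ∀ k ∈ Finset.Icc (-(N : ℤ)) N, δ ≤ |x - 2 ^ k| ∧ δ ≤ |x - -2 ^ k|)
    (hxy : |y - x| < δ) : y ∈ I := by
  have hk : ∀ k : ℤ, δ₀ / 2 ≤ 2 ^ k → (2 : ℝ) ^ k ≤ 2 * M → k ∈ Finset.Icc (-(N : ℤ)) N := by
    intro k h1 h2
    rw [Finset.mem_Icc]
    exact ⟨(zpow_le_zpow_iff_right₀ (one_lt_two : (1 : ℝ) < 2)).1 (hN0.trans h1),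
      (zpow_le_zpow_iff_right₀ (one_lt_two : (1 : ℝ) < 2)).1 (h2.trans hNM)⟩
  have hδ₀ : 0 < δ₀ := by have := zpow_two_pos (-(N : ℤ)); linarith
  rw [abs_lt] at hxy
  obtain ⟨k, rfl | rfl⟩ := hI
  · obtain ⟨h1, h2⟩ := hx
    have hp := zpow_two_pos (k - 1)
    have e : (2 : ℝ) ^ k = 2 * 2 ^ (k - 1) := by rw [← zpow_one_add₀ two_ne_zero]; ring_nf
    rw [abs_of_pos (by linarith)] at hx0 hxM
    constructor
    · by_contra hcon
      push Not at hcon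
      have := (hsep (k - 1) (hk _ (by linarith) (by linarith))).1
      rw [abs_of_nonneg (by linarith)] at this
      linarith
    · by_contra hcon
      push Not at hcon
      have := (hsep k (hk _ (by linarith) (by linarith))).1
      rw [abs_of_neg (by linarith)] at this
      linarith
  · obtain ⟨h1, h2⟩ := hx
    have hp := zpow_two_pos (k - 1)
    have e : (2 : ℝ) ^ k = 2 * 2 ^ (k - 1) := by rw [← zpow_one_add₀ two_ne_zero]; ring_nf
    rw [abs_of_neg (by linarith)] at hx0 hxM
    constructor
    · by_contra hcon
      push Not at hcon
      have := (hsep k (hk _ (by linarith) (by linarith))).2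
      rw [abs_of_nonneg (by linarith)] at this
      linarith
    · by_contra hcon
      push Not at hcon
      have := (hsep (k - 1) (hk _ (by linarith) (by linarith))).2
      rw [abs_of_nonpos (by linarith)] at this
      linarith

variable {d : ℕ}

lemma wellInside_of_separated {ξ : EuclideanSpace ℝ (Fin d)} {δ₀ δ M r : ℝ} {N : ℕ}
    (hx0 : ∀ i, δ₀ ≤ |ξ i|) (hxM : ‖ξ‖ ≤ M) (hN0 : (2 : ℝ) ^ (-(N : ℤ)) ≤ δ₀ / 2)
    (hNM : 2 * M ≤ 2 ^ (N : ℤ))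
    (hsep : ∀ i, ∀ k ∈ Finset.Icc (-(N : ℤ)) N, δ ≤ |ξ i - 2 ^ k| ∧ δ ≤ |ξ i - -2 ^ k|)
    (hr : r < δ) : WellInside r ξ := by
  have hδ₀ : 0 < δ₀ := by have := zpow_two_pos (-(N : ℤ)); linarith
  choose I hI hxI using fun i => exists_mem_dyadicIntervals (abs_pos.1 (hδ₀.trans_le (hx0 i)))
  refine ⟨_, ⟨I, hI, rfl⟩, fun ζ hζ i => ?_⟩
  refine mem_dyadicInterval_of_separated (hI i) (hxI i) (hx0 i)
    ((PiLp.norm_apply_le ξ i).trans hxM) hN0 hNM (hsep i) (lt_of_le_of_lt ?_ hr)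
  rw [Metric.mem_closedBall, dist_eq_norm] at hζ
  exact (PiLp.norm_apply_le (ζ - ξ) i).trans hζ

end Separation

/-! ### Approximation by well localized functions on `ℝ^d`. -/

section Approximation

variable {d : ℕ} {p : ℝ≥0∞} {f : EuclideanSpace ℝ (Fin d) → ℂ}

/-- Rapidly decreasing functions whose spectrum avoids the boundaries of the dyadic rectangles and
whose partial sums are rapidly decreasing as well. -/
structure WellLocalized (g : EuclideanSpace ℝ (Fin d) → ℂ) : Prop where
  stronglyMeasurable : StronglyMeasurable g
  decay : ∃ C : ℝ, 0 ≤ C ∧ ∀ x, ‖g x‖ ≤ C * ((1 + ‖x‖) ^ (d + 1))⁻¹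
  decay_partialSum : ∀ R ∈ dyadicRectangles d,
    ∃ C : ℝ, 0 ≤ C ∧ ∀ x, ‖partialSum R g x‖ ≤ C * ((1 + ‖x‖) ^ (d + 1))⁻¹
  fourier_partialSum : ∀ R ∈ dyadicRectangles d, 𝓕 (partialSum R g) = R.indicator (𝓕 g)
  ne_zero : ∀ ξ, 𝓕 g ξ ≠ 0 → ∀ i, ξ i ≠ 0

/-- The kernel is a concentrated dilate of a nonnegative function of integral one. Its `L_1` norm is
one, so by Young the square function does not grow in norm at all. -/
lemma exists_bandlimited_kernel {q : ℝ≥0∞} [p.HolderConjugate q] (hp1 : 1 < p) (hp : p < ∞)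
    (hq1 : 1 < q) (hq : q ≠ ∞) (hf : MemLp f p volume) {ε : ℝ≥0∞} (hε : ε ≠ 0) :
    ∃ K : EuclideanSpace ℝ (Fin d) → ℂ, Integrable K ∧ MemLp K q volume ∧
      (∃ M : ℝ, ∀ ξ, 𝓕 K ξ ≠ 0 → ‖ξ‖ ≤ M) ∧
      eLpNorm (fun x => conv volume K f x - f x) p volume ≤ ε ∧
      eLpNorm (squareFunction (conv volume K f)) p volume ≤ eLpNorm (squareFunction f) p volume := by
  obtain ⟨ρ, hρ, hρq, hρ1, hρn, hρF⟩ := exists_positive_kernel (d := d)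
  obtain ⟨U, hU, δ, hδ, H⟩ := exists_nhds_eLpNorm_conv_sub_le (q := q) hp1.le hp.ne hf hε
  obtain ⟨η, hη, hηU⟩ := Metric.mem_nhds_iff.1 hU
  obtain ⟨m, hm⟩ := exists_eLpNorm_indicator_compl_ball_le (p := 1) one_ne_zero (by simp)
    (u := fun x => ‖ρ x‖ₑ) (by rw [eLpNorm_enorm]; exact (hρq 1).2.ne) hδ
  rw [eLpNorm_one_eq_lintegral_enorm] at hm
  simp only [enorm_eq_self] at hm
  rw [lintegral_indicator measurableSet_ball.compl] at hm
  -- Dilation by `n` carries the complement of the ball of radius `η` into that of radius `m`, where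
  -- `ρ` has mass at most `δ`.
  obtain ⟨n, hn⟩ := exists_nat_gt (m / η)
  have hn0 : (0 : ℝ) < n := lt_of_le_of_lt (by positivity) hn
  set v : Fin d → ℝ := fun _ => n with hv
  have hv0 : ∏ j, v j ≠ 0 := Finset.prod_ne_zero_iff.2 fun j _ => hn0.ne'
  have hdn : ∫⁻ x, ‖dil v ρ x‖ₑ = 1 := (lintegral_enorm_dil hv0).trans hρn
  have hdi := integrable_dil hv0 hρ
  refine ⟨dil v ρ, hdi, memLp_dil hv0 (zero_lt_one.trans hq1).ne' hq (hρq q),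
    ⟨n * 2, fun ξ hξ => ?_⟩, H _ hdi (memLp_dil hv0 (zero_lt_one.trans hq1).ne' hq (hρq q)) ?_ hdn.le ?_,
    ?_⟩
  · have h1 : 𝓕 (dil v ρ) ξ = 𝓕 ρ ((n : ℝ)⁻¹ • ξ) := fourier_dil hv0 fun i => by
      simp [hv, hn0.ne']
    rw [h1] at hξ
    have := hρF _ hξ
    rw [norm_smul, norm_inv, Real.norm_of_nonneg hn0.le, inv_mul_le_iff₀ hn0] at this
    exact this
  · rw [integral_dil hv0, hρ1]
  · refine le_trans (lintegral_mono_set (compl_subset_compl.2 hηU)) (le_trans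
      (setLIntegral_enorm_dil hv0 measurableSet_ball.compl measurableSet_ball.compl fun x hx => ?_) hm)
    have h1 : diagMap v x = (n : ℝ) • x := by ext i; simp [hv]
    simp only [mem_compl_iff, Metric.mem_ball, dist_zero_right, not_lt] at hx ⊢
    rw [h1, norm_smul, Real.norm_of_nonneg hn0.le]
    rw [div_lt_iff₀ hη] at hn
    nlinarith
  · refine (eLpNorm_squareFunction_conv_le hp1 hp hdi hf).trans_eq ?_
    rw [hdn, one_mul]

/-- Two rounds are needed because the dyadic hyperplanes accumulate at the coordinate hyperplanes.
Clearing `ξ i = 0` first gives a lower bound `δ₀` on the coordinates, after which finitely many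
hyperplanes `ξ i = ± 2^k` remain. -/
lemma exists_separated_kernel {q : ℝ≥0∞} [p.HolderConjugate q] (hp1 : 1 < p) (hp : p < ∞)
    (hq1 : 1 < q) (hq : q ≠ ∞) (hf : MemLp f p volume) {ε : ℝ≥0∞} (hε : ε ≠ 0) :
    ∃ K : EuclideanSpace ℝ (Fin d) → ℂ, Integrable K ∧ MemLp K q volume ∧
      (∃ r > 0, ∀ ξ, 𝓕 K ξ ≠ 0 → WellInside r ξ) ∧
      eLpNorm (fun x => conv volume K f x - f x) p volume ≤ ε ∧
      eLpNorm (squareFunction (conv volume K f)) p volume ≤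
        eLpNorm (squareFunction f) p volume + ε := by
  have hε2 : ε / 2 ≠ 0 := by simp [hε]
  have hε4 : ε / 2 / 2 ≠ 0 := by simp [hε]
  obtain ⟨K, hK, hKq, ⟨M, hM⟩, hKn, hKS⟩ := exists_bandlimited_kernel hp1 hp hq1 hq hf hε2
  obtain ⟨K₁, hi₁, hq₁, hs₁, ⟨δ₀, hδ₀, hd₁⟩, hn₁, hS₁⟩ := exists_kernel_avoiding_hyperplanes hp1 hp
    hq1.le hq hf hK hKq hM (Finset.univ.image fun i : Fin d => (i, (0 : ℝ))) hε4
  obtain ⟨N₁, hN₁⟩ := exists_pow_lt_of_lt_one (half_pos hδ₀) (by norm_num : (1 / 2 : ℝ) < 1)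
  obtain ⟨N₂, hN₂⟩ := pow_unbounded_of_one_lt (2 * M) (one_lt_two : (1 : ℝ) < 2)
  set N := max N₁ N₂ with hN
  have hN0 : (2 : ℝ) ^ (-(N : ℤ)) ≤ δ₀ / 2 := by
    rw [zpow_neg, zpow_natCast, ← inv_pow, inv_eq_one_div]
    exact (pow_le_pow_of_le_one (by norm_num) (by norm_num) (le_max_left _ _)).trans hN₁.le
  have hNM : 2 * M ≤ 2 ^ (N : ℤ) := by
    rw [zpow_natCast]
    exact hN₂.le.trans (pow_le_pow_right₀ one_le_two (le_max_right _ _))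
  obtain ⟨K₂, hi₂, hq₂, hs₂, ⟨δ, hδ, hd₂⟩, hn₂, hS₂⟩ := exists_kernel_avoiding_hyperplanes hp1 hp
    hq1.le hq hf hi₁ hq₁ (fun ξ hξ => hM ξ (hs₁ ξ hξ))
    ((Finset.univ ×ˢ Finset.Icc (-(N : ℤ)) N).image (fun z : Fin d × ℤ => (z.1, (2 : ℝ) ^ z.2)) ∪
      (Finset.univ ×ˢ Finset.Icc (-(N : ℤ)) N).image (fun z : Fin d × ℤ => (z.1, -(2 : ℝ) ^ z.2))) hε4
  refine ⟨K₂, hi₂, hq₂, ⟨δ / 2, half_pos hδ, fun ξ hξ => ?_⟩, ?_, ?_⟩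
  · refine wellInside_of_separated (δ₀ := δ₀) (δ := δ) (M := M) (N := N) (fun i => ?_)
      (hM ξ (hs₁ ξ (hs₂ ξ hξ))) hN0 hNM (fun i k hk => ⟨?_, ?_⟩) (half_lt_self hδ)
    · simpa using hd₁ ξ (hs₂ ξ hξ) (i, 0) (Finset.mem_image.2 ⟨i, Finset.mem_univ i, rfl⟩)
    · exact hd₂ ξ hξ (i, 2 ^ k) (Finset.mem_union_left _ (Finset.mem_image.2
        ⟨(i, k), Finset.mem_product.2 ⟨Finset.mem_univ i, hk⟩, rfl⟩))
    · exact hd₂ ξ hξ (i, -2 ^ k) (Finset.mem_union_right _ (Finset.mem_image.2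
        ⟨(i, k), Finset.mem_product.2 ⟨Finset.mem_univ i, hk⟩, rfl⟩))
  · have hm : ∀ L : EuclideanSpace ℝ (Fin d) → ℂ, Integrable L → MemLp (conv volume L f) p volume :=
      fun L hL => memLp_conv hp1.le hp.ne hL hf
    calc _ = eLpNorm ((fun x => conv volume K₂ f x - conv volume K₁ f x) +
          ((fun x => conv volume K₁ f x - conv volume K f x) + fun x => conv volume K f x - f x))
            p volume := by
          congr 1; ext x; simp
      _ ≤ _ := eLpNorm_add_le ((hm _ hi₂).sub (hm _ hi₁)).1
          (((hm _ hi₁).sub (hm _ hK)).add ((hm _ hK).sub hf)).1 hp1.le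
      _ ≤ ε / 2 / 2 + (ε / 2 / 2 + ε / 2) := by
          gcongr
          exact (eLpNorm_add_le ((hm _ hi₁).sub (hm _ hK)).1 ((hm _ hK).sub hf).1 hp1.le).trans
            (add_le_add hn₁ hKn)
      _ = ε := by rw [← add_assoc, ENNReal.add_halves, ENNReal.add_halves]
  · refine hS₂.trans ?_
    calc _ ≤ eLpNorm (squareFunction f) p volume + ε / 2 / 2 + ε / 2 / 2 := by
          gcongr
          refine hS₁.trans ?_
          gcongr
      _ = eLpNorm (squareFunction f) p volume + ε / 2 := by rw [add_assoc, ENNReal.add_halves]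
      _ ≤ _ := by gcongr; exact ENNReal.half_le_self

/-- Dominated convergence with majorant `2 |h|`. -/
lemma tendsto_eLpNorm_mul_comp_smul_sub (hp0 : p ≠ 0) (hp : p ≠ ∞)
    {φ h : EuclideanSpace ℝ (Fin d) → ℂ} (hφ : Continuous φ) (hφ0 : φ 0 = 1) (hφ1 : ∀ x, ‖φ x‖ ≤ 1)
    (hh : MemLp h p volume) {s : ℕ → ℝ} (hs : Tendsto s atTop (𝓝 0)) :
    Tendsto (fun n => eLpNorm (fun x => φ (s n • x) * h x - h x) p volume) atTop (𝓝 0) := by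
  have hr := ENNReal.toReal_pos hp0 hp
  have key : Tendsto (fun n => ∫⁻ x, ‖φ (s n • x) * h x - h x‖ₑ ^ p.toReal) atTop
      (𝓝 (∫⁻ _ : EuclideanSpace ℝ (Fin d), 0)) := by
    refine tendsto_lintegral_of_dominated_convergence' (fun x => (2 * ‖h x‖ₑ) ^ p.toReal)
      (fun n => ?_) (fun n => Eventually.of_forall fun x => ?_) ?_ (Eventually.of_forall fun x => ?_)
    · refine AEMeasurable.pow_const (AEStronglyMeasurable.enorm ?_) _
      exact ((hφ.comp (continuous_const_smul (s n))).aestronglyMeasurable.mul hh.1).sub hh.1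
    · refine ENNReal.rpow_le_rpow ?_ hr.le
      refine enorm_sub_le.trans ?_
      rw [two_mul, enorm_mul]
      gcongr
      refine mul_le_of_le_one_left' ?_
      rw [← ofReal_norm]
      exact ENNReal.ofReal_le_one.2 (hφ1 _)
    · simp_rw [ENNReal.mul_rpow_of_nonneg _ _ hr.le]
      rw [lintegral_const_mul' _ _ (by simp), ← eLpNorm_rpow_eq_lintegral hp0 hp]
      exact ENNReal.mul_ne_top (by simp) (ENNReal.rpow_ne_top_of_nonneg hr.le hh.2.ne)
    · have h1 : Tendsto (fun n => φ (s n • x) * h x - h x) atTop (𝓝 (φ ((0 : ℝ) • x) * h x - h x)) :=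
        (((hφ.tendsto _).comp (hs.smul_const x)).mul_const _).sub_const _
      rw [zero_smul, hφ0, one_mul, sub_self] at h1
      have h2 := ((ENNReal.continuous_rpow_const (y := p.toReal)).tendsto _).comp
        ((continuous_enorm.tendsto _).comp h1)
      simpa [hr, Function.comp_def] using h2
  simp only [lintegral_zero] at key
  have h3 := ((ENNReal.continuous_rpow_const (y := 1 / p.toReal)).tendsto _).comp key
  rw [ENNReal.zero_rpow_of_pos (by positivity)] at h3
  refine h3.congr fun n => ?_
  simp only [Function.comp]
  rw [← eLpNorm_rpow_eq_lintegral hp0 hp, ← ENNReal.rpow_mul, mul_one_div_cancel hr.ne',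
    ENNReal.rpow_one]

lemma decay_comp_smul {φ : EuclideanSpace ℝ (Fin d) → ℂ} {C s : ℝ} {k : ℕ} (hC : 0 ≤ C)
    (hφ : ∀ x, ‖φ x‖ ≤ C * ((1 + ‖x‖) ^ k)⁻¹) (hs : 0 < s) (hs1 : s ≤ 1)
    (x : EuclideanSpace ℝ (Fin d)) :
    ‖φ (s • x)‖ ≤ (C * (s ^ k)⁻¹) * ((1 + ‖x‖) ^ k)⁻¹ := by
  refine (hφ _).trans ?_
  rw [mul_assoc, ← mul_inv, ← mul_pow]
  gcongr
  rw [norm_smul, Real.norm_of_nonneg hs.le, mul_add, mul_one]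
  gcongr

/-- Approximation of functions in `L_p` by well localized functions, with control of the square
functions. -/
theorem exists_wellLocalized_approx (hp1 : 1 < p) (hp : p < ∞) (hf : MemLp f p volume)
    {ε : ℝ≥0∞} (hε : ε ≠ 0) :
    ∃ g : EuclideanSpace ℝ (Fin d) → ℂ, WellLocalized g ∧ MemLp g p volume ∧
      eLpNorm (fun x => g x - f x) p volume ≤ ε ∧
      eLpNorm (squareFunction g) p volume ≤ eLpNorm (squareFunction f) p volume + ε ∧
      (eLpNorm (squareFunction f) p volume ≠ ∞ →
        ∃ C : ℝ, 0 ≤ C ∧ ∀ x, squareFunction g x ≤ ENNReal.ofReal (C * ((1 + ‖x‖) ^ (d + 1))⁻¹)) := by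
  obtain ⟨q, hpq, hq1, hq⟩ := exists_holderConjugate hp1 hp
  have hqp : ENNReal.HolderConjugate q p := ENNReal.HolderConjugate.symm
  have hp0 : p ≠ 0 := (zero_lt_one.trans hp1).ne'
  have hε2 : ε / 2 ≠ 0 := by simp [hε]
  obtain ⟨K, hK, hKq, ⟨r, hr, hKr⟩, hKn, hKS⟩ := exists_separated_kernel hp1 hp hq1 hq hf hε2
  set h := conv volume K f with hh
  have hhp : MemLp h p volume := memLp_conv hp1.le hp.ne hK hf
  -- Since `χ ≥ 0` has integral one, `φ` satisfies `φ 0 = 1` and `|φ| ≤ 1`: the cut-off `φ (s • x)`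
  -- tends to one as `s → 0` and never increases absolute values.
  obtain ⟨χ, hχ1, hχ2, hχ3⟩ := exists_schwartz_bump_integral_eq_one (d := d)
  obtain ⟨φ, hφ, hφχ⟩ := schwartz_fourierInv_coe χ
  have hφ0 : φ 0 = 1 := by
    rw [← hφ, fourierInv_eq_integral_ex]; simp [hχ3]
  have hφ1 : ∀ x, ‖φ x‖ ≤ 1 := fun x => by
    rw [← hφ]
    refine (norm_fourierInv_le _ x).trans (le_of_eq ?_)
    have h1 : ((∫ η, ‖χ η‖ : ℝ) : ℂ) = 1 := by
      rw [← hχ3, ← integral_complex_ofReal]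
      exact integral_congr_ae (Eventually.of_forall fun η => (hχ2 η).symm)
    exact_mod_cast h1
  obtain ⟨C, hC0, hC⟩ := schwartz_decay φ (d + 1)
  obtain ⟨s, hs0, hs1, hsr, hsn⟩ : ∃ s : ℝ, 0 < s ∧ s ≤ 1 ∧ s ≤ r / 2 ∧
      eLpNorm (fun x => φ (s • x) * h x - h x) p volume ≤ ε / 2 := by
    have hlim : Tendsto (fun n : ℕ => (1 : ℝ) / (n + 1)) atTop (𝓝 0) :=
      tendsto_one_div_add_atTop_nhds_zero_nat
    have h1 := (tendsto_eLpNorm_mul_comp_smul_sub hp0 hp.ne φ.continuous hφ0 hφ1 hhp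
      hlim).eventually_le_const (pos_iff_ne_zero.2 hε2)
    have h2 := hlim.eventually_le_const (half_pos hr)
    obtain ⟨n, hn1, hn2⟩ := (h1.and h2).exists
    exact ⟨1 / (n + 1), by positivity, by
      rw [div_le_one (by positivity)]; linarith [Nat.cast_nonneg (α := ℝ) n], hn2, hn1⟩
  set C' := C * (s ^ (d + 1))⁻¹ with hC'
  have hC'0 : 0 ≤ C' := by positivity
  have hφs : ∀ x, ‖φ (s • x)‖ ≤ C' * ((1 + ‖x‖) ^ (d + 1))⁻¹ := decay_comp_smul hC0 hC hs0 hs1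
  have hφsc : Continuous fun x => φ (s • x) := φ.continuous.comp (continuous_const_smul s)
  set g : EuclideanSpace ℝ (Fin d) → ℂ := fun x => φ (s • x) * h x with hg
  -- The spectrum of the cut-off lies within `s ≤ r / 2` of the origin, so the cut-off commutes with
  -- every `S_R` on `h` and leaves a margin `r / 2` for `g`.
  have hSg : ∀ R ∈ dyadicRectangles d, ∀ x,
      partialSum R g x = φ (s • x) * partialSum R h x := fun R hR x => by
    have := partialSum_mul_conv hR (memLp_rectKernel hq1 hq hR) hp1.le hp.ne hK hf hKr χ.integrable
      hχ1 hs0.le (by linarith) x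
    rw [hφ] at this
    exact this
  have hSqg : ∀ x, squareFunction g x = ‖φ (s • x)‖ₑ * squareFunction h x := fun x => by
    simp_rw [squareFunction_eq_l2, ← l2_mul_left]
    congr 1
    ext R
    rw [hSg R R.2, enorm_mul]
  have hgm : StronglyMeasurable g := hφsc.stronglyMeasurable.mul (stronglyMeasurable_conv hK.1 hf.1)
  have bound : ∀ u : EuclideanSpace ℝ (Fin d) → ℂ, (∃ B : ℝ≥0∞, B ≠ ∞ ∧ ∀ x, ‖u x‖ₑ ≤ B) →
      ∃ D : ℝ, 0 ≤ D ∧ ∀ x, ‖φ (s • x) * u x‖ ≤ D * ((1 + ‖x‖) ^ (d + 1))⁻¹ := by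
    rintro u ⟨B, hB, hu⟩
    refine ⟨C' * B.toReal, by positivity, fun x => ?_⟩
    have hux : ‖u x‖ ≤ B.toReal := by
      rw [← toReal_enorm]; exact ENNReal.toReal_mono hB (hu x)
    rw [norm_mul]
    calc ‖φ (s • x)‖ * ‖u x‖ ≤ (C' * ((1 + ‖x‖) ^ (d + 1))⁻¹) * B.toReal := by
          gcongr; exact hφs x
      _ = _ := by ring
  have hSR : ∀ R ∈ dyadicRectangles d,
      ∃ D : ℝ, 0 ≤ D ∧ ∀ x, ‖partialSum R g x‖ ≤ D * ((1 + ‖x‖) ^ (d + 1))⁻¹ := fun R hR => by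
    have hk := memLp_rectKernel hq1 hq hR
    simp_rw [hSg R hR]
    exact bound _ ⟨_, ENNReal.mul_ne_top hhp.2.ne hk.2.ne, fun x => enorm_partialSum_le hhp.1 hk x⟩
  have hgd : ∃ D : ℝ, 0 ≤ D ∧ ∀ x, ‖g x‖ ≤ D * ((1 + ‖x‖) ^ (d + 1))⁻¹ :=
    bound h ⟨_, ENNReal.mul_ne_top hKq.2.ne hf.2.ne, fun x => enorm_conv_le hKq.1 hf.1 x⟩
  have hint : ∀ u : EuclideanSpace ℝ (Fin d) → ℂ, AEStronglyMeasurable u volume →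
      (∃ D : ℝ, 0 ≤ D ∧ ∀ x, ‖u x‖ ≤ D * ((1 + ‖x‖) ^ (d + 1))⁻¹) → Integrable u := by
    rintro u hu ⟨D, -, hD⟩
    have h1 := (integrable_one_add_norm (E := EuclideanSpace ℝ (Fin d)) (μ := volume)
      (r := ((d + 1 : ℕ) : ℝ)) (by simp)).const_mul D
    refine h1.mono' hu (Eventually.of_forall fun x => ?_)
    rw [Real.rpow_neg (by positivity), Real.rpow_natCast]
    exact hD x
  have hgi : Integrable g := hint g hgm.aestronglyMeasurable hgd
  have hgW : ∀ ξ, 𝓕 g ξ ≠ 0 → WellInside (r / 2) ξ := fun ξ hξ => by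
    refine wellInside_of_fourier_mul_conv_ne_zero (q := q) (s := s) hK hf hKr χ.integrable hχ1 hs0.le
      (by linarith) ?_ (ξ := ξ) (by rw [hφ]; exact hξ)
    rw [hφ]
    have hv0 : ∏ _j : Fin d, s ≠ 0 := Finset.prod_ne_zero_iff.2 fun j _ => hs0.ne'
    have h1 := (memLp_dil hv0 (zero_lt_one.trans hq1).ne' hq (φ.memLp q volume)).const_mul
      (((|∏ _j : Fin d, s| : ℝ) : ℂ)⁻¹)
    refine h1.ae_eq (Eventually.of_forall fun x => ?_)
    have h2 : diagMap (fun _ => s) x = s • x := by ext i; simp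
    simp only [dil, h2]
    rw [inv_mul_cancel_left₀]
    simpa using hv0
  refine ⟨g, ⟨hgm, hgd, hSR, fun R hR => ?_, fun ξ hξ i => (hgW ξ hξ).ne_zero (by linarith) i⟩,
    ?_, ?_, ?_, fun hS => ?_⟩
  · exact fourier_partialSum hR hgi (half_pos hr) hgW
      (hint _ (stronglyMeasurable_partialSum hR hgi.1).aestronglyMeasurable (hSR R hR))
  · refine hhp.of_le hgm.aestronglyMeasurable (Eventually.of_forall fun x => ?_)
    simp only [hg, norm_mul]
    exact mul_le_of_le_one_left (norm_nonneg _) (hφ1 _)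
  · calc _ = eLpNorm ((fun x => g x - h x) + fun x => h x - f x) p volume := by congr 1; ext x; simp
      _ ≤ _ := eLpNorm_add_le (hgm.aestronglyMeasurable.sub hhp.1) (hhp.sub hf).1 hp1.le
      _ ≤ ε / 2 + ε / 2 := add_le_add hsn hKn
      _ = ε := ENNReal.add_halves ε
  · calc _ ≤ eLpNorm (squareFunction h) p volume := eLpNorm_mono_enorm fun x => by
          rw [enorm_eq_self, enorm_eq_self, hSqg]
          refine mul_le_of_le_one_left' ?_
          rw [← ofReal_norm]
          exact ENNReal.ofReal_le_one.2 (hφ1 _)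
      _ ≤ _ := hKS.trans (by gcongr; exact ENNReal.half_le_self)
  -- Hölder bounds `|K| * S f` uniformly by `‖K‖_q ‖S f‖_p`. This is why `K` is kept in `L_q`
  -- throughout and why the norm of `S f` must be finite; the decay then comes from the cut-off.
  · set B := eLpNorm K q volume * eLpNorm (squareFunction f) p volume with hB
    have hBtop : B ≠ ∞ := ENNReal.mul_ne_top hKq.2.ne hS
    have hSh : ∀ x, squareFunction h x ≤ B := fun x => by
      refine (squareFunction_conv_le hp1 hp hK hf x).trans ?_
      have hm := measurable_squareFunction hf.1
      have hrpos := ENNReal.toReal_pos hp0 hp.ne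
      have hq1r : 1 < q.toReal := by
        rw [← ENNReal.toReal_one]; exact (ENNReal.toReal_lt_toReal ENNReal.one_ne_top hq).2 hq1
      have hmx : AEMeasurable (fun z => squareFunction f (x - z)) volume :=
        (hm.comp (measurable_const.sub measurable_id)).aemeasurable
      refine (ENNReal.lintegral_mul_le_Lp_mul_Lq volume (ENNReal.HolderConjugate.toReal (p := q) (q := p) hq1r)
        hK.1.enorm hmx).trans_eq ?_
      rw [hB, eLpNorm_eq_lintegral_rpow_enorm_toReal (zero_lt_one.trans hq1).ne' hq,
        eLpNorm_eq_lintegral_rpow_enorm_toReal hp0 hp.ne,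
        lintegral_sub_left_eq_self (fun z => squareFunction f z ^ p.toReal) x]
      rfl
    refine ⟨C' * B.toReal, by positivity, fun x => ?_⟩
    rw [hSqg]
    calc ‖φ (s • x)‖ₑ * squareFunction h x
        ≤ ENNReal.ofReal (C' * ((1 + ‖x‖) ^ (d + 1))⁻¹) * ENNReal.ofReal B.toReal := by
          rw [ENNReal.ofReal_toReal hBtop, ← ofReal_norm]
          gcongr
          · exact hφs x
          · exact hSh x
      _ = _ := by rw [← ENNReal.ofReal_mul (by positivity)]; congr 1; ring

end Approximation

end DyadicLP

end

noncomputable section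

namespace DyadicLP

open Filter Topology

/-! ### The torus as a cube with normalized measure. -/

section Torus

variable {d : ℕ}

instance : IsProbabilityMeasure (torusMeasure d) := by unfold torusMeasure; infer_instance

instance : (torusMeasure d).IsAddHaarMeasure := by unfold torusMeasure; infer_instance

/-- An integer vector as a point of Euclidean space. -/
def intVec (m : Fin d → ℤ) : EuclideanSpace ℝ (Fin d) := WithLp.toLp 2 fun i => (m i : ℝ)

@[simp] lemma intVec_apply (m : Fin d → ℤ) (i : Fin d) : intVec m i = m i := rfl

@[simp] lemma intVec_zero : intVec (0 : Fin d → ℤ) = 0 := by ext i; simp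

lemma intVec_neg (m : Fin d → ℤ) : intVec (-m) = -intVec m := by ext i; simp

/-- The quotient map `ℝ^d → 𝕋^d`. -/
def torusMk (x : EuclideanSpace ℝ (Fin d)) : UnitAddTorus (Fin d) := fun i => (x i : UnitAddCircle)

/-- The cube `(-s/2, s/2]^d`. -/
def cube (d : ℕ) (s : ℝ) : Set (EuclideanSpace ℝ (Fin d)) := {x | ∀ i, x i ∈ Ioc (-(s / 2)) (s / 2)}

/-- The representative of a point of the torus in the cube `(-1/2, 1/2]^d`. -/
def torusLift (z : UnitAddTorus (Fin d)) : EuclideanSpace ℝ (Fin d) :=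
  WithLp.toLp 2 (UnitAddTorus.measurableEquivPiIoc (fun _ => -(1 / 2)) z).1

lemma torusMk_torusLift (z : UnitAddTorus (Fin d)) : torusMk (torusLift z) = z := by
  ext i
  exact AddCircle.coe_equivIoc

lemma mFourier_torusMk (m : Fin d → ℤ) (x : EuclideanSpace ℝ (Fin d)) :
    UnitAddTorus.mFourier m (torusMk x) = ex (intVec m) x := by
  simp only [UnitAddTorus.mFourier, ContinuousMap.coe_mk, torusMk, fourier_coe_apply, ex,
    Real.fourierChar_apply, PiLp.inner_apply, ← Complex.exp_sum]
  congr 1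
  simp only [intVec_apply]
  push_cast
  rw [Finset.mul_sum, Finset.sum_mul]
  refine Finset.sum_congr rfl fun i _ => ?_
  simp
  ring

lemma mFourier_eq_ex_torusLift {s : ℝ} (hs : 0 < s) (m : Fin d → ℤ) (z : UnitAddTorus (Fin d)) :
    UnitAddTorus.mFourier m z = ex (s⁻¹ • intVec m) (s • torusLift z) := by
  rw [ex_smul_left, smul_smul, inv_mul_cancel₀ hs.ne', one_smul, ← mFourier_torusMk,
    torusMk_torusLift]

lemma measurableSet_cube (s : ℝ) : MeasurableSet (cube d s) := by
  simp only [cube, ofPred_forall]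
  refine MeasurableSet.iInter fun i => ?_
  exact measurableSet_Ioc.preimage (by fun_prop)

lemma preimage_smul_cube {s : ℝ} (hs : 0 < s) : (fun x => s • x) ⁻¹' cube d s = cube d 1 := by
  ext x
  simp only [cube, mem_preimage, mem_ofPred_eq, PiLp.smul_apply, smul_eq_mul, mem_Ioc]
  refine forall_congr' fun i => and_congr ⟨fun h => ?_, fun h => ?_⟩ ⟨fun h => ?_, fun h => ?_⟩ <;>
    nlinarith

lemma torusLift_mem_cube (z : UnitAddTorus (Fin d)) : torusLift z ∈ cube d 1 := fun i => by
  have h := (UnitAddTorus.measurableEquivPiIoc (fun _ => -(1 / 2)) z).2 i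
  refine ⟨h.1, h.2.trans_eq (by norm_num)⟩

lemma smul_mem_cube {s : ℝ} (hs : 0 < s) {x : EuclideanSpace ℝ (Fin d)} (hx : x ∈ cube d 1) :
    s • x ∈ cube d s := by rwa [← preimage_smul_cube hs] at hx

lemma measurable_torusLift : Measurable (torusLift (d := d)) :=
  (MeasurableEquiv.toLp 2 (Fin d → ℝ)).measurable.comp
    (measurable_subtype_coe.comp (UnitAddTorus.measurableEquivPiIoc fun _ => -(1 / 2)).measurable)

lemma map_torusLift : Measure.map torusLift (torusMeasure d) = volume.restrict (cube d 1) := by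
  have h1 : MeasurePreserving (UnitAddTorus.measurableEquivPiIoc fun _ : Fin d => -(1 / 2 : ℝ))
      (torusMeasure d) (Measure.comap Subtype.val volume) := UnitAddTorus.measurePreserving_equivPiIoc _
  have hm : MeasurableSet {x : Fin d → ℝ | ∀ i, x i ∈ Ioc (-(1 / 2) : ℝ) (-(1 / 2) + 1)} := by
    simp only [ofPred_forall]
    exact MeasurableSet.iInter fun i => measurableSet_Ioc.preimage (measurable_pi_apply i)
  have h2 : MeasurePreserving (Subtype.val : {x : Fin d → ℝ // ∀ i, x i ∈ Ioc (-(1 / 2) : ℝ) (-(1 / 2) + 1)} → _)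
      (Measure.comap Subtype.val volume) (volume.restrict _) :=
    ⟨measurable_subtype_coe, map_comap_subtype_coe hm volume⟩
  have h3 := (EuclideanSpace.volume_preserving_symm_measurableEquiv_toLp (Fin d)).symm.restrict_preimage
    (measurableSet_cube (d := d) 1)
  have h4 : (MeasurableEquiv.toLp 2 (Fin d → ℝ)).symm.symm ⁻¹' cube d 1 =
      {x : Fin d → ℝ | ∀ i, x i ∈ Ioc (-(1 / 2) : ℝ) (-(1 / 2) + 1)} := by
    ext x
    have : (-(1 / 2) + 1 : ℝ) = 1 / 2 := by norm_num
    rw [this]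
    rfl
  rw [h4] at h3
  exact (h3.comp (h2.comp h1)).map_eq

lemma map_smul_torusLift {s : ℝ} (hs : 0 < s) :
    Measure.map (fun z => s • torusLift z) (torusMeasure d) =
      ENNReal.ofReal (s ^ d)⁻¹ • volume.restrict (cube d s) := by
  have h1 := Measure.map_addHaar_smul (volume : Measure (EuclideanSpace ℝ (Fin d))) hs.ne'
  have hm : Measurable fun x : EuclideanSpace ℝ (Fin d) => s • x := measurable_const_smul s
  have h2 := congrArg (fun μ => Measure.restrict μ (cube d s)) h1
  simp only [Measure.restrict_map hm (measurableSet_cube s), preimage_smul_cube hs,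
    Measure.restrict_smul, finrank_euclideanSpace, Fintype.card_fin] at h2
  rw [abs_of_pos (by positivity)] at h2
  rw [← h2, ← map_torusLift, Measure.map_map hm measurable_torusLift]
  rfl

lemma measurable_smul_torusLift (s : ℝ) :
    Measurable fun z : UnitAddTorus (Fin d) => s • torusLift z :=
  measurable_torusLift.const_smul s

lemma volume_cube_one : volume (cube d 1) = 1 := by
  have h := congrArg (fun μ => μ univ) (map_torusLift (d := d))
  simp only [Measure.restrict_apply_univ] at h
  rw [← h, Measure.map_apply measurable_torusLift MeasurableSet.univ]
  simp

end Torus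

/-! ### Tiling by lattice translates of a cube. -/

section Tiling

variable {d : ℕ} {s : ℝ}

/-- The translate of the cube of side `s` by `s • k`. -/
def tile (s : ℝ) (k : Fin d → ℤ) : Set (EuclideanSpace ℝ (Fin d)) :=
  {x | x - s • intVec k ∈ cube d s}

/-- An explicit formula for the index of the tile containing `x` gives covering and disjointness
together. -/
lemma mem_tile_iff (hs : 0 < s) (k : Fin d → ℤ) (x : EuclideanSpace ℝ (Fin d)) :
    x ∈ tile s k ↔ k = fun i => ⌈x i / s - 1 / 2⌉ := by
  have : ∀ i, (x - s • intVec k) i ∈ Ioc (-(s / 2)) (s / 2) ↔ ⌈x i / s - 1 / 2⌉ = k i := fun i => by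
    rw [Int.ceil_eq_iff]
    simp only [PiLp.sub_apply, PiLp.smul_apply, intVec_apply, smul_eq_mul, mem_Ioc]
    rw [show x i / s - 1 / 2 = (x i - s / 2) / s by field_simp, lt_div_iff₀ hs, div_le_iff₀ hs]
    constructor <;> rintro ⟨h1, h2⟩ <;> constructor <;> nlinarith
  simp only [tile, cube, mem_ofPred_eq, this, funext_iff, eq_comm]

lemma measurableSet_tile (k : Fin d → ℤ) : MeasurableSet (tile s k) :=
  (measurableSet_cube s).preimage (measurable_id.sub_const _)

lemma iUnion_tile (hs : 0 < s) : ⋃ k : Fin d → ℤ, tile s k = univ := by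
  ext x
  simp [mem_tile_iff hs]

lemma pairwise_disjoint_tile (hs : 0 < s) :
    Pairwise (Function.onFun Disjoint fun k : Fin d → ℤ => tile s k) := by
  intro k l hkl
  refine Set.disjoint_left.2 fun x hk hl => hkl ?_
  rw [mem_tile_iff hs] at hk hl
  rw [hk, hl]

lemma preimage_add_tile (k : Fin d → ℤ) : (fun x => x + s • intVec k) ⁻¹' tile s k = cube d s := by
  ext x; simp [tile]

lemma setLIntegral_tile (F : EuclideanSpace ℝ (Fin d) → ℝ≥0∞) (k : Fin d → ℤ) :
    ∫⁻ x in tile s k, F x = ∫⁻ x in cube d s, F (x + s • intVec k) := by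
  rw [← (measurePreserving_add_right volume (s • intVec k)).setLIntegral_comp_preimage_emb
    (measurableEmbedding_addRight _), preimage_add_tile]

lemma setIntegral_tile (F : EuclideanSpace ℝ (Fin d) → ℂ) (k : Fin d → ℤ) :
    ∫ x in tile s k, F x = ∫ x in cube d s, F (x + s • intVec k) := by
  rw [← (measurePreserving_add_right volume (s • intVec k)).setIntegral_preimage_emb
    (measurableEmbedding_addRight _), preimage_add_tile]

lemma lintegral_cube_tsum (hs : 0 < s) {F : EuclideanSpace ℝ (Fin d) → ℝ≥0∞} (hF : Measurable F) :
    ∫⁻ x in cube d s, ∑' k : Fin d → ℤ, F (x + s • intVec k) = ∫⁻ x, F x := by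
  have hm : ∀ k : Fin d → ℤ, Measurable fun x => F (x + s • intVec k) := fun k =>
    hF.comp (measurable_id.add_const _)
  rw [lintegral_tsum fun k => (hm k).aemeasurable, ← setLIntegral_univ F, ← iUnion_tile hs,
    lintegral_iUnion (fun k => measurableSet_tile k) (pairwise_disjoint_tile hs)]
  simp_rw [setLIntegral_tile]

lemma integral_cube_tsum (hs : 0 < s) {F : EuclideanSpace ℝ (Fin d) → ℂ} (hFm : StronglyMeasurable F)
    (hF : Integrable F) :
    ∫ x in cube d s, ∑' k : Fin d → ℤ, F (x + s • intVec k) = ∫ x, F x := by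
  have hm : ∀ k : Fin d → ℤ, StronglyMeasurable fun x => F (x + s • intVec k) := fun k =>
    hFm.comp_measurable (measurable_id.add_const _)
  rw [integral_tsum fun k => (hm k).aestronglyMeasurable]
  · rw [← setIntegral_univ (f := F), ← iUnion_tile hs,
      integral_iUnion (fun k => measurableSet_tile k) (pairwise_disjoint_tile hs) hF.integrableOn]
    simp_rw [setIntegral_tile]
  · rw [← lintegral_tsum fun k => (hm k).enorm.aemeasurable,
      lintegral_cube_tsum hs (F := fun x => ‖F x‖ₑ) hFm.enorm]
    exact hF.2.ne

end Tiling

/-! ### Lattice sums of decaying functions. -/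

section Periodization

variable {d : ℕ} {s : ℝ}

/-- The weight `(1 + ‖x‖)^{-(d+1)}`. -/
def weight (x : EuclideanSpace ℝ (Fin d)) : ℝ≥0∞ := ENNReal.ofReal ((1 + ‖x‖) ^ (d + 1))⁻¹

lemma measurable_weight : Measurable (weight (d := d)) := by unfold weight; fun_prop

lemma lintegral_weight_ne_top : ∫⁻ x : EuclideanSpace ℝ (Fin d), weight x ≠ ∞ := by
  have h := finite_integral_one_add_norm (E := EuclideanSpace ℝ (Fin d)) (μ := volume)
    (r := ((d + 1 : ℕ) : ℝ)) (by simp)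
  refine (lt_of_le_of_lt (lintegral_mono fun x => ?_) h).ne
  rw [Real.rpow_neg (by positivity), Real.rpow_natCast]
  exact le_rfl

lemma weight_le_mul {x y : EuclideanSpace ℝ (Fin d)} {c : ℝ} (hc : 0 < c)
    (h : c * (1 + ‖x‖) ≤ 1 + ‖y‖) : weight y ≤ ENNReal.ofReal (c⁻¹ ^ (d + 1)) * weight x := by
  unfold weight
  rw [← ENNReal.ofReal_mul (by positivity), ← inv_pow, ← inv_pow, ← mul_pow, ← mul_inv]
  gcongr

/-- Points of the unit cube have bounded distance, so the lattice sum at `y` is comparable to that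
at every other `x` of the cube. Averaging over `x` turns the sum into the integral of the weight
over `ℝ^d`. -/
lemma exists_tsum_weight_le (d : ℕ) : ∃ B : ℝ≥0∞, B ≠ ∞ ∧ ∀ y ∈ cube d 1,
    ∑' k : Fin d → ℤ, weight (y + intVec k) ≤ B := by
  obtain ⟨c, hc0, hc⟩ : ∃ c : ℝ, 0 ≤ c ∧ ∀ x ∈ cube d 1, ∀ y ∈ cube d 1, ‖x - y‖ ≤ c := by
    refine ⟨√d, by positivity, fun x hx y hy => ?_⟩
    rw [EuclideanSpace.norm_eq]
    refine Real.sqrt_le_sqrt ?_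
    calc ∑ i, ‖(x - y) i‖ ^ 2 ≤ ∑ _i : Fin d, (1 : ℝ) := Finset.sum_le_sum fun i _ => by
          have h1 := hx i
          have h2 := hy i
          rw [mem_Ioc] at h1 h2
          rw [Real.norm_eq_abs, sq_le_one_iff_abs_le_one, abs_abs, PiLp.sub_apply, abs_le]
          constructor <;> linarith
      _ = d := by simp
  refine ⟨ENNReal.ofReal ((1 + c) ^ (d + 1)) * ∫⁻ x : EuclideanSpace ℝ (Fin d), weight x,
    ENNReal.mul_ne_top (by simp) lintegral_weight_ne_top, fun y hy => ?_⟩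
  have key : ∀ x ∈ cube d 1, ∑' k : Fin d → ℤ, weight (y + intVec k) ≤
      ENNReal.ofReal ((1 + c) ^ (d + 1)) * ∑' k : Fin d → ℤ, weight (x + (1 : ℝ) • intVec k) :=
    fun x hx => by
    rw [← ENNReal.tsum_mul_left]
    refine ENNReal.tsum_le_tsum fun k => ?_
    have := weight_le_mul (x := x + (1 : ℝ) • intVec k) (y := y + intVec k) (c := (1 + c)⁻¹)
      (by positivity) ?_
    · simpa using this
    rw [inv_mul_le_iff₀ (by positivity), one_smul]
    have h1 : ‖x + intVec k‖ ≤ ‖x - y‖ + ‖y + intVec k‖ := by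
      refine (le_of_eq ?_).trans (norm_add_le _ _); congr 1; abel
    nlinarith [hc x hx y hy, norm_nonneg (y + intVec k)]
  calc ∑' k : Fin d → ℤ, weight (y + intVec k)
      = ∫⁻ _x in cube d 1, ∑' k : Fin d → ℤ, weight (y + intVec k) := by
        rw [setLIntegral_const, volume_cube_one, mul_one]
    _ ≤ ∫⁻ x in cube d 1, ENNReal.ofReal ((1 + c) ^ (d + 1)) *
          ∑' k : Fin d → ℤ, weight (x + (1 : ℝ) • intVec k) :=
        setLIntegral_mono' (measurableSet_cube 1) key
    _ = _ := by
        rw [lintegral_const_mul' _ _ (by simp), lintegral_cube_tsum one_pos measurable_weight]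

/-- The tail of the periodization of the weight over the lattice `s ℤ^d` is small. -/
lemma exists_tsum_weight_tail_le (d : ℕ) : ∃ B : ℝ≥0∞, B ≠ ∞ ∧ ∀ s : ℝ, 0 < s → ∀ x ∈ cube d s,
    (∑' k : Fin d → ℤ, if k = 0 then 0 else weight (x + s • intVec k)) ≤
      ENNReal.ofReal ((s ^ (d + 1))⁻¹) * B := by
  obtain ⟨B, hB, h⟩ := exists_tsum_weight_le d
  refine ⟨ENNReal.ofReal (3 ^ (d + 1)) * B, ENNReal.mul_ne_top (by simp) hB, fun s hs x hx => ?_⟩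
  have hy : s⁻¹ • x ∈ cube d 1 := by
    rw [← preimage_smul_cube hs, mem_preimage, smul_smul, mul_inv_cancel₀ hs.ne', one_smul]
    exact hx
  set y := s⁻¹ • x with hyx
  have hxy : x = s • y := by rw [hyx, smul_smul, mul_inv_cancel₀ hs.ne', one_smul]
  -- For `k ≠ 0` some `|k i| ≥ 1` while `|y i| ≤ 1 / 2`, so `‖y + k‖ ≥ 1 / 2` and `1 + ‖y + k‖ ≤ 3
  -- ‖y + k‖`; this is the source of `s / 3`.
  calc _ ≤ ∑' k : Fin d → ℤ, ENNReal.ofReal ((s / 3)⁻¹ ^ (d + 1)) * weight (y + intVec k) := by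
        refine ENNReal.tsum_le_tsum fun k => ?_
        split_ifs with hk
        · exact zero_le
        refine weight_le_mul (by positivity) ?_
        obtain ⟨i, hi⟩ : ∃ i, k i ≠ 0 := by
          by_contra! hcon; exact hk (funext hcon)
        have h1 : (1 : ℝ) ≤ |(k i : ℝ)| := by exact_mod_cast Int.one_le_abs hi
        have h2 : |y i| ≤ 1 / 2 := by
          have := hy i
          rw [mem_Ioc] at this
          rw [abs_le]; constructor <;> linarith
        have h3 : 1 / 2 ≤ ‖y + intVec k‖ := by
          refine le_trans ?_ (PiLp.norm_apply_le (y + intVec k) i)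
          rw [PiLp.add_apply, intVec_apply, Real.norm_eq_abs]
          have := abs_sub_abs_le_abs_sub (k i : ℝ) (-y i)
          rw [abs_neg, sub_neg_eq_add, add_comm (k i : ℝ)] at this
          linarith
        rw [hxy, ← smul_add, norm_smul, Real.norm_of_nonneg hs.le]
        nlinarith
    _ ≤ ENNReal.ofReal ((s / 3)⁻¹ ^ (d + 1)) * B := by
        rw [ENNReal.tsum_mul_left]; gcongr; exact h y hy
    _ = _ := by
        rw [← mul_assoc, ← ENNReal.ofReal_mul (by positivity), inv_div, div_pow]
        congr 2
        field_simp

/-- The periodization of `u` over the lattice `s ℤ^d`. -/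
def periodization (s : ℝ) (u : EuclideanSpace ℝ (Fin d) → ℂ) (x : EuclideanSpace ℝ (Fin d)) : ℂ :=
  ∑' k : Fin d → ℤ, u (x + s • intVec k)

lemma enorm_le_mul_weight {u : EuclideanSpace ℝ (Fin d) → ℂ} {C : ℝ} (hC : 0 ≤ C)
    (h : ∀ x, ‖u x‖ ≤ C * ((1 + ‖x‖) ^ (d + 1))⁻¹) (x : EuclideanSpace ℝ (Fin d)) :
    ‖u x‖ₑ ≤ ENNReal.ofReal C * weight x := by
  rw [weight, ← ENNReal.ofReal_mul hC, ← ofReal_norm]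
  exact ENNReal.ofReal_le_ofReal (h x)

lemma tsum_tail_le {B : ℝ≥0∞} (hB : ∀ s : ℝ, 0 < s → ∀ x ∈ cube d s,
    (∑' k : Fin d → ℤ, if k = 0 then 0 else weight (x + s • intVec k)) ≤
      ENNReal.ofReal ((s ^ (d + 1))⁻¹) * B) {U : EuclideanSpace ℝ (Fin d) → ℝ≥0∞} {C : ℝ≥0∞}
    (hU : ∀ x, U x ≤ C * weight x) (hs : 0 < s) {x : EuclideanSpace ℝ (Fin d)} (hx : x ∈ cube d s) :
    (∑' k : Fin d → ℤ, if k = 0 then 0 else U (x + s • intVec k)) ≤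
      C * (ENNReal.ofReal ((s ^ (d + 1))⁻¹) * B) := by
  refine le_trans ?_ (mul_le_mul_right (hB s hs x hx) C)
  rw [← ENNReal.tsum_mul_left]
  refine ENNReal.tsum_le_tsum fun k => ?_
  split_ifs with hk
  · simp
  · exact hU _

/-- The term `k = 0` is `u` itself and the others form the tail, of order `s^{-(d+1)}` uniformly on
the cube. -/
lemma enorm_periodization_sub_le {B : ℝ≥0∞} (hBt : B ≠ ∞) (hB : ∀ s : ℝ, 0 < s → ∀ x ∈ cube d s,
    (∑' k : Fin d → ℤ, if k = 0 then 0 else weight (x + s • intVec k)) ≤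
      ENNReal.ofReal ((s ^ (d + 1))⁻¹) * B) {u : EuclideanSpace ℝ (Fin d) → ℂ} {C : ℝ≥0∞} (hC : C ≠ ∞)
    (hU : ∀ x, ‖u x‖ₑ ≤ C * weight x) (hs : 0 < s) {x : EuclideanSpace ℝ (Fin d)} (hx : x ∈ cube d s) :
    ‖periodization s u x - u x‖ₑ ≤ C * (ENNReal.ofReal ((s ^ (d + 1))⁻¹) * B) := by
  have h := tsum_tail_le hB hU hs hx
  have hsum : Summable fun k : Fin d → ℤ => u (x + s • intVec k) := by
    refine Summable.of_enorm ?_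
    rw [ENNReal.tsum_eq_add_tsum_ite (0 : Fin d → ℤ)]
    refine ENNReal.add_ne_top.2 ⟨by simp, ne_top_of_le_ne_top ?_ (by convert! h)⟩
    exact ENNReal.mul_ne_top hC (ENNReal.mul_ne_top (by simp) hBt)
  rw [periodization, hsum.tsum_eq_add_tsum_ite 0]
  simp only [intVec_zero, smul_zero, add_zero, add_sub_cancel_left]
  refine enorm_tsum_le_tsum_enorm.trans (le_trans (ENNReal.tsum_le_tsum fun k => ?_) h)
  split_ifs with hk <;> simp

end Periodization

end DyadicLP

end

noncomputable section

namespace DyadicLP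

open Filter Topology

/-! ### Fourier coefficients and trigonometric polynomials on the torus. -/

section TorusFourier

variable {d : ℕ}

lemma finite_of_mem_intDyadicIntervals {J : Set ℤ} (hJ : J ∈ intDyadicIntervals) : J.Finite := by
  rcases hJ with rfl | ⟨I, hI, rfl⟩
  · exact Set.finite_singleton 0
  obtain ⟨a, b, -, -, -, h⟩ := ae_eq_Ioc_of_mem_dyadicIntervals hI
  refine (Set.finite_Icc ⌈a⌉ ⌊b⌋).subset fun n hn => ?_
  exact ⟨Int.ceil_le.2 (h hn).1, Int.le_floor.2 (h hn).2⟩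

lemma finite_of_mem_intDyadicRectangles {J : Set (Fin d → ℤ)} (hJ : J ∈ intDyadicRectangles d) :
    J.Finite := by
  obtain ⟨J, hJ, rfl⟩ := hJ
  exact Set.Finite.pi' fun i => finite_of_mem_intDyadicIntervals (hJ i)

instance countable_intDyadicRectangles : Countable (intDyadicRectangles d) :=
  ((Set.countable_range fun F : Finset (Fin d → ℤ) => (F : Set (Fin d → ℤ))).mono
    fun J (hJ : J ∈ intDyadicRectangles d) =>
      (⟨(finite_of_mem_intDyadicRectangles hJ).toFinset, by simp⟩ :
        J ∈ range fun F : Finset (Fin d → ℤ) => (F : Set (Fin d → ℤ)))).to_subtype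

lemma norm_mFourier_apply_eq_one (m : Fin d → ℤ) (z : UnitAddTorus (Fin d)) :
    ‖UnitAddTorus.mFourier m z‖ = 1 := by
  rw [UnitAddTorus.mFourier, ContinuousMap.coe_mk, norm_prod]
  exact Finset.prod_eq_one fun i _ => Circle.norm_coe _

lemma enorm_mFourier_apply (m : Fin d → ℤ) (z : UnitAddTorus (Fin d)) :
    ‖UnitAddTorus.mFourier m z‖ₑ = 1 := by
  rw [← ofReal_norm, norm_mFourier_apply_eq_one]; simp

lemma mFourier_apply_zero (m : Fin d → ℤ) : UnitAddTorus.mFourier m (0 : UnitAddTorus (Fin d)) = 1 := by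
  simp [UnitAddTorus.mFourier]

lemma mFourier_apply_add (m : Fin d → ℤ) (z w : UnitAddTorus (Fin d)) :
    UnitAddTorus.mFourier m (z + w) = UnitAddTorus.mFourier m z * UnitAddTorus.mFourier m w := by
  simp [UnitAddTorus.mFourier, fourier_apply, smul_add, AddCircle.toCircle_add,
    Finset.prod_mul_distrib]

lemma integrable_mul_mFourier {f : UnitAddTorus (Fin d) → ℂ} (hf : Integrable f (torusMeasure d))
    (m : Fin d → ℤ) : Integrable (fun z => f z * UnitAddTorus.mFourier m z) (torusMeasure d) := by
  refine hf.mono (hf.1.mul (UnitAddTorus.mFourier m).continuous.aestronglyMeasurable)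
    (Eventually.of_forall fun z => ?_)
  simp [norm_mFourier_apply_eq_one]

lemma torusCoeff_mFourier (n m : Fin d → ℤ) :
    torusCoeff (UnitAddTorus.mFourier n) m = if n = m then 1 else 0 := by
  have h := (orthonormal_iff_ite.1 (UnitAddTorus.orthonormal_mFourier (d := Fin d))) m n
  rw [UnitAddTorus.mFourierLp, UnitAddTorus.mFourierLp, ContinuousMap.inner_toLp] at h
  simp_rw [← UnitAddTorus.mFourier_neg] at h
  exact Eq.trans h (if_congr eq_comm rfl rfl)

lemma continuous_mFourier_sum (s : Finset (Fin d → ℤ)) (c : (Fin d → ℤ) → ℂ) :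
    Continuous fun z : UnitAddTorus (Fin d) => ∑ m ∈ s, c m * UnitAddTorus.mFourier m z := by
  fun_prop

lemma torusCoeff_sum (s : Finset (Fin d → ℤ)) (c : (Fin d → ℤ) → ℂ) (n : Fin d → ℤ) [Decidable (n ∈ s)] :
    torusCoeff (fun z => ∑ m ∈ s, c m * UnitAddTorus.mFourier m z) n = if n ∈ s then c n else 0 := by
  have h1 : torusCoeff (fun z => ∑ m ∈ s, c m * UnitAddTorus.mFourier m z) n =
      ∑ m ∈ s, c m * torusCoeff (UnitAddTorus.mFourier m) n := by
    simp_rw [torusCoeff, Finset.sum_mul]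
    rw [integral_finsetSum]
    · simp_rw [mul_assoc, integral_const_mul]
    · intro m _
      refine integrable_mul_mFourier (Integrable.const_mul ?_ _) _
      exact (memLp_top_of_bound (UnitAddTorus.mFourier m).continuous.aestronglyMeasurable 1
        (Eventually.of_forall fun z => (norm_mFourier_apply_eq_one m z).le)).integrable le_top
  rw [h1]
  classical
  simp_rw [torusCoeff_mFourier]
  simp

lemma torusPartialSum_eq_sum {J : Set (Fin d → ℤ)} (hJ : J.Finite) (f : UnitAddTorus (Fin d) → ℂ)
    (z : UnitAddTorus (Fin d)) : torusPartialSum J f z =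
      ∑ m ∈ hJ.toFinset, torusCoeff f m * UnitAddTorus.mFourier m z :=
  finsum_mem_eq_finite_toFinset_sum _ hJ

lemma continuous_torusPartialSum {J : Set (Fin d → ℤ)} (hJ : J.Finite)
    (f : UnitAddTorus (Fin d) → ℂ) : Continuous (torusPartialSum J f) := by
  simp_rw [funext (torusPartialSum_eq_sum hJ f)]
  exact continuous_mFourier_sum _ _

lemma torusSquareFunction_eq_l2 (f : UnitAddTorus (Fin d) → ℂ) (z : UnitAddTorus (Fin d)) :
    torusSquareFunction f z =
      l2 fun R : intDyadicRectangles d => ‖torusPartialSum (R : Set (Fin d → ℤ)) f z‖ₑ := rfl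

lemma measurable_torusSquareFunction (f : UnitAddTorus (Fin d) → ℂ) :
    Measurable (torusSquareFunction f) := by
  simp_rw [funext (torusSquareFunction_eq_l2 f)]
  exact measurable_l2 fun R =>
    (continuous_torusPartialSum (finite_of_mem_intDyadicRectangles R.2) f).measurable.enorm

/-- Completeness of the characters in `L_2` of the torus. -/
lemma ae_eq_zero_of_torusCoeff_eq_zero {f : UnitAddTorus (Fin d) → ℂ}
    (hf : MemLp f 2 (torusMeasure d)) (h : ∀ m, torusCoeff f m = 0) : f =ᵐ[torusMeasure d] 0 := by
  have hz : ∀ m, UnitAddTorus.mFourierBasis.repr hf.toLp m = 0 := fun m => by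
    refine (UnitAddTorus.mFourierBasis_repr _ _).trans ?_
    rw [← h m]
    refine integral_congr_ae ?_
    filter_upwards [hf.coeFn_toLp] with z hz
    exact (congrArg _ hz).trans (mul_comm _ _)
  have h0 : hf.toLp = 0 := by
    have : UnitAddTorus.mFourierBasis.repr hf.toLp = 0 := by
      ext m; rw [hz]; rfl
    exact (LinearIsometryEquiv.map_eq_zero_iff _).1 this
  filter_upwards [hf.coeFn_toLp, Lp.coeFn_zero ℂ 2 (torusMeasure d)] with z h1 h2
  rw [← h1, h0]
  exact h2

/-- A square integrable function on the torus with finitely many nonzero Fourier coefficients is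
almost everywhere equal to the corresponding trigonometric polynomial. -/
lemma ae_eq_torusPartialSum {f : UnitAddTorus (Fin d) → ℂ} (hf : MemLp f 2 (torusMeasure d))
    {J : Set (Fin d → ℤ)} (hJ : J.Finite) (h : ∀ m ∉ J, torusCoeff f m = 0) :
    f =ᵐ[torusMeasure d] torusPartialSum J f := by
  classical
  have hcont := continuous_torusPartialSum hJ f
  have hi2 : Integrable (torusPartialSum J f) (torusMeasure d) :=
    hcont.integrable_of_hasCompactSupport (HasCompactSupport.of_compactSpace _)
  have h2 : MemLp (torusPartialSum J f) 2 (torusMeasure d) :=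
    hcont.memLp_of_hasCompactSupport (HasCompactSupport.of_compactSpace _)
  have h3 := ae_eq_zero_of_torusCoeff_eq_zero (hf.sub h2) fun m => by
    have h4 : torusCoeff (torusPartialSum J f) m = if m ∈ hJ.toFinset then torusCoeff f m else 0 := by
      rw [← torusCoeff_sum]
      congr 1
      ext z
      exact torusPartialSum_eq_sum hJ f z
    have h5 : torusCoeff (f - torusPartialSum J f) m =
        torusCoeff f m - torusCoeff (torusPartialSum J f) m := by
      simp_rw [torusCoeff, Pi.sub_apply, sub_mul]
      exact integral_sub (integrable_mul_mFourier (hf.integrable (by norm_num)) _)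
        (integrable_mul_mFourier hi2 _)
    rw [h5, h4]
    split_ifs with hm
    · simp
    · rw [h m (by simpa using hm), sub_zero]
  filter_upwards [h3] with z hz
  exact sub_eq_zero.1 hz

lemma torusPartialSum_congr {f g : UnitAddTorus (Fin d) → ℂ} {J : Set (Fin d → ℤ)}
    (h : ∀ m ∈ J, torusCoeff f m = torusCoeff g m) : torusPartialSum J f = torusPartialSum J g := by
  ext z
  exact finsum_mem_congr rfl fun m hm => by rw [h m hm]

end TorusFourier

/-! ### Integer blocks cut out by dilated dyadic rectangles. -/

section Blocks

variable {d : ℕ} {s : ℝ}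

/-- The integer points of the dilate `s R`. -/
def intBlock (s : ℝ) (R : Set (EuclideanSpace ℝ (Fin d))) : Set (Fin d → ℤ) :=
  {m | s⁻¹ • intVec m ∈ R}

/-- Dilation by `2^N` shifts the index `k` by `N`. This invariance is the reason for using periods
that are powers of two. -/
lemma mem_dyadicIntervals_preimage_mul {I : Set ℝ} (hI : I ∈ dyadicIntervals) (N : ℤ) :
    {x : ℝ | ((2 : ℝ) ^ N)⁻¹ * x ∈ I} ∈ dyadicIntervals := by
  have h0 := zpow_two_pos N
  have h1 : ∀ k : ℤ, (2 : ℝ) ^ (k + N) = 2 ^ N * 2 ^ k := fun k => by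
    rw [zpow_add₀ two_ne_zero, mul_comm]
  have h2 : ∀ k : ℤ, (2 : ℝ) ^ (k + N - 1) = 2 ^ N * 2 ^ (k - 1) := fun k => by
    rw [← h1]; congr 1; ring
  obtain ⟨k, rfl | rfl⟩ := hI
  · refine ⟨k + N, Or.inl ?_⟩
    ext x
    simp only [mem_Ico, mem_ofPred_eq, h1, h2, le_inv_mul_iff₀ h0, inv_mul_lt_iff₀ h0]
  · refine ⟨k + N, Or.inr ?_⟩
    ext x
    simp only [mem_Ioc, mem_ofPred_eq, h1, h2, lt_inv_mul_iff₀ h0, inv_mul_le_iff₀ h0, mul_neg]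

lemma intBlock_mem_intDyadicRectangles {R : Set (EuclideanSpace ℝ (Fin d))}
    (hR : R ∈ dyadicRectangles d) (N : ℤ) : intBlock ((2 : ℝ) ^ N) R ∈ intDyadicRectangles d := by
  obtain ⟨I, hI, rfl⟩ := hR
  exact ⟨fun i => {n : ℤ | (n : ℝ) ∈ {x : ℝ | ((2 : ℝ) ^ N)⁻¹ * x ∈ I i}},
    fun i => Or.inr ⟨_, mem_dyadicIntervals_preimage_mul (hI i) N, rfl⟩, rfl⟩

lemma eq_intBlock_or_exists_zero {J : Set (Fin d → ℤ)} (hJ : J ∈ intDyadicRectangles d) (N : ℤ) :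
    (∃ R ∈ dyadicRectangles d, J = intBlock ((2 : ℝ) ^ N) R) ∨ ∃ i, ∀ m ∈ J, m i = 0 := by
  obtain ⟨J, hJ, rfl⟩ := hJ
  by_cases h : ∃ i, J i = {0}
  · obtain ⟨i, hi⟩ := h
    exact Or.inr ⟨i, fun m hm => by simpa [hi] using hm i⟩
  push Not at h
  left
  choose I hI hIJ using fun i => (hJ i).resolve_left (h i)
  refine ⟨{ξ | ∀ i, ξ i ∈ {x : ℝ | ((2 : ℝ) ^ (-N))⁻¹ * x ∈ I i}}, ⟨_, fun i =>
    mem_dyadicIntervals_preimage_mul (hI i) (-N), rfl⟩, ?_⟩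
  ext m
  simp only [intBlock, mem_ofPred_eq, hIJ, PiLp.smul_apply, intVec_apply, smul_eq_mul]
  refine forall_congr' fun i => ?_
  rw [zpow_neg, inv_inv, mul_inv_cancel_left₀ (zpow_two_pos N).ne']

/-- If all frequencies of `f` have nonzero coordinates, the square function of `f` may be computed
with the blocks cut out by the dyadic rectangles of `2^{-N} ℝ^d`. -/
lemma torusSquareFunction_eq_l2_intBlock {f : UnitAddTorus (Fin d) → ℂ}
    (hf : ∀ m, torusCoeff f m ≠ 0 → ∀ i, m i ≠ 0) (N : ℤ) (z : UnitAddTorus (Fin d)) :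
    torusSquareFunction f z = l2 fun R : dyadicRectangles d =>
      ‖torusPartialSum (intBlock ((2 : ℝ) ^ N) (R : Set (EuclideanSpace ℝ (Fin d)))) f z‖ₑ := by
  have hne : ∀ J : Set (Fin d → ℤ), torusPartialSum J f z ≠ 0 → ∃ m ∈ J, torusCoeff f m ≠ 0 :=
    fun J hJ => by
    by_contra! hcon
    refine hJ (finsum_mem_eq_zero_of_forall_eq_zero fun m hm => ?_)
    rw [hcon m hm, zero_mul]
  rw [torusSquareFunction_eq_l2, l2, l2]
  congr 1
  -- Different rectangles may cut out the same empty block, so only nonzero terms are matched: such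
  -- a block contains a frequency of `f`, and that frequency determines the rectangle.
  refine tsum_eq_tsum_of_ne_zero_bij
    (fun R => ⟨_, intBlock_mem_intDyadicRectangles R.1.2 N⟩) ?_ ?_ ?_
  · rintro ⟨R, hR⟩ ⟨S, hS⟩ h
    have h' : intBlock ((2 : ℝ) ^ N) (R : Set (EuclideanSpace ℝ (Fin d))) = intBlock ((2 : ℝ) ^ N) S :=
      congrArg Subtype.val h
    have hR' : torusPartialSum (intBlock ((2 : ℝ) ^ N) (R : Set (EuclideanSpace ℝ (Fin d)))) f z ≠ 0 :=
      fun h0 => hR (by simp [h0])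
    obtain ⟨m, hm, -⟩ := hne _ hR'
    have hm2 := hm
    rw [h'] at hm2
    exact Subtype.ext (Subtype.ext (eq_of_mem_dyadicRectangles R.2 S.2 hm hm2))
  · rintro ⟨J, hJ⟩ h
    have hJ0 : torusPartialSum J f z ≠ 0 := fun h0 => h (by simp [h0])
    obtain ⟨m, hm, hmf⟩ := hne _ hJ0
    rcases eq_intBlock_or_exists_zero hJ N with ⟨R, hR, rfl⟩ | ⟨i, hi⟩
    · exact ⟨⟨⟨R, hR⟩, h⟩, rfl⟩
    · exact absurd (hi m hm) (hf m hmf i)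
  · exact fun R => rfl

end Blocks

end DyadicLP

end

noncomputable section

namespace DyadicLP

open Filter Topology

/-! ### Transfer from the torus to `ℝ^d` by periodization. -/

section Transfer

variable {d : ℕ} {s : ℝ} {p : ℝ≥0∞}

/-- Strong measurability together with decay of order `d + 1`. -/
structure Decaying (u : EuclideanSpace ℝ (Fin d) → ℂ) : Prop where
  stronglyMeasurable : StronglyMeasurable u
  bound : ∃ C : ℝ≥0∞, C ≠ ∞ ∧ ∀ x, ‖u x‖ₑ ≤ C * weight x

lemma WellLocalized.decaying {g : EuclideanSpace ℝ (Fin d) → ℂ} (hg : WellLocalized g) :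
    Decaying g :=
  let ⟨C, hC, h⟩ := hg.decay
  ⟨hg.stronglyMeasurable, ENNReal.ofReal C, by simp, enorm_le_mul_weight hC h⟩

lemma WellLocalized.decaying_partialSum {g : EuclideanSpace ℝ (Fin d) → ℂ} (hg : WellLocalized g)
    {R : Set (EuclideanSpace ℝ (Fin d))} (hR : R ∈ dyadicRectangles d) : Decaying (partialSum R g) :=
  let ⟨C, hC, h⟩ := hg.decay_partialSum R hR
  ⟨stronglyMeasurable_partialSum hR hg.stronglyMeasurable.aestronglyMeasurable, ENNReal.ofReal C,
    by simp, enorm_le_mul_weight hC h⟩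

variable {u : EuclideanSpace ℝ (Fin d) → ℂ}

lemma Decaying.integrable (hu : Decaying u) : Integrable u := by
  refine ⟨hu.stronglyMeasurable.aestronglyMeasurable, ?_⟩
  obtain ⟨C, hC, h⟩ := hu.bound
  refine (lintegral_mono h).trans_lt ?_
  rw [lintegral_const_mul' _ _ hC]
  exact ENNReal.mul_lt_top hC.lt_top lintegral_weight_ne_top.lt_top

lemma stronglyMeasurable_periodization (hu : StronglyMeasurable u) (s : ℝ) :
    StronglyMeasurable (periodization s u) :=
  StronglyMeasurable.tsum fun k => hu.comp_measurable (measurable_id.add_const (s • intVec k))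

/-- The periodization of `u`, regarded as a function on the torus. -/
def torusPeriodization (s : ℝ) (u : EuclideanSpace ℝ (Fin d) → ℂ) (z : UnitAddTorus (Fin d)) : ℂ :=
  periodization s u (s • torusLift z)

lemma stronglyMeasurable_torusPeriodization (hu : StronglyMeasurable u) (s : ℝ) :
    StronglyMeasurable (torusPeriodization s u) :=
  (stronglyMeasurable_periodization hu s).comp_measurable (measurable_smul_torusLift s)

lemma memLp_torusPeriodization (hu : Decaying u) (hs : 0 < s) (p : ℝ≥0∞) :
    MemLp (torusPeriodization s u) p (torusMeasure d) := by
  obtain ⟨C, hC, h⟩ := hu.bound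
  obtain ⟨B, hB, hBs⟩ := exists_tsum_weight_tail_le d
  have hb : ∀ z, ‖torusPeriodization s u z‖ₑ ≤ C * (ENNReal.ofReal ((s ^ (d + 1))⁻¹) * B) + C := by
    intro z
    have h1 := enorm_periodization_sub_le hB hBs hC h hs (smul_mem_cube hs (torusLift_mem_cube z))
    have h2 : ‖u (s • torusLift z)‖ₑ ≤ C := (h _).trans <| by
      refine mul_le_of_le_one_right' (ENNReal.ofReal_le_one.2 (inv_le_one_of_one_le₀ ?_))
      exact one_le_pow₀ (by linarith [norm_nonneg (s • torusLift z)])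
    calc ‖torusPeriodization s u z‖ₑ
        = ‖(periodization s u (s • torusLift z) - u (s • torusLift z)) + u (s • torusLift z)‖ₑ := by
          rw [sub_add_cancel, torusPeriodization]
      _ ≤ _ := (enorm_add_le _ _).trans (add_le_add h1 h2)
  set D := C * (ENNReal.ofReal ((s ^ (d + 1))⁻¹) * B) + C with hD
  have hDt : D ≠ ∞ := ENNReal.add_ne_top.2
    ⟨ENNReal.mul_ne_top hC (ENNReal.mul_ne_top (by simp) hB), hC⟩
  refine MemLp.of_bound (stronglyMeasurable_torusPeriodization hu.stronglyMeasurable s).aestronglyMeasurable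
    D.toReal (Eventually.of_forall fun z => ?_)
  rw [← toReal_enorm]
  exact ENNReal.toReal_mono hDt (hb z)

/-- Poisson summation: the character of frequency `m / s` is `s ℤ^d`-periodic, so the integral over
the cube unfolds to one over `ℝ^d`. -/
lemma torusCoeff_torusPeriodization (hu : Decaying u) (hs : 0 < s) (m : Fin d → ℤ) :
    torusCoeff (torusPeriodization s u) m = ((s ^ d)⁻¹ : ℝ) * 𝓕 u (s⁻¹ • intVec m) := by
  have hex : Continuous fun x => ex (-(s⁻¹ • intVec m)) x := by fun_prop
  have hΦ : StronglyMeasurable fun x => periodization s u x * ex (-(s⁻¹ • intVec m)) x :=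
    (stronglyMeasurable_periodization hu.stronglyMeasurable s).mul hex.stronglyMeasurable
  have h1 : ∀ k : Fin d → ℤ, ex (-(s⁻¹ • intVec m)) (s • intVec k) = 1 := fun k => by
    rw [← smul_neg, ex_smul_left, smul_smul, inv_mul_cancel₀ hs.ne', one_smul, ← intVec_neg,
      ← mFourier_torusMk]
    have : torusMk (intVec k) = 0 := by
      ext i
      exact (AddCircle.coe_eq_zero_iff 1).2 ⟨k i, by simp⟩
    rw [this, mFourier_apply_zero]
  calc torusCoeff (torusPeriodization s u) m
      = ∫ z, (fun x => periodization s u x * ex (-(s⁻¹ • intVec m)) x) (s • torusLift z)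
          ∂torusMeasure d := by
        refine integral_congr_ae (Eventually.of_forall fun z => ?_)
        simp only
        rw [mFourier_eq_ex_torusLift hs, intVec_neg, smul_neg]
        rfl
    _ = ∫ x, periodization s u x * ex (-(s⁻¹ • intVec m)) x
          ∂(ENNReal.ofReal (s ^ d)⁻¹ • volume.restrict (cube d s)) := by
        rw [← map_smul_torusLift hs, integral_map (measurable_smul_torusLift s).aemeasurable
          hΦ.aestronglyMeasurable]
    _ = ((s ^ d)⁻¹ : ℝ) * ∫ x in cube d s, ∑' k : Fin d → ℤ,
          (fun y => ex (-(s⁻¹ • intVec m)) y * u y) (x + s • intVec k) := by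
        rw [integral_smul_measure, ENNReal.toReal_ofReal (by positivity), Complex.real_smul]
        congr 1
        refine integral_congr_ae (Eventually.of_forall fun x => ?_)
        simp only [periodization, ex_add_right, h1, mul_one]
        rw [tsum_mul_left, mul_comm]
    _ = _ := by
        rw [integral_cube_tsum hs (F := fun y => ex (-(s⁻¹ • intVec m)) y * u y) (hex.stronglyMeasurable.mul hu.stronglyMeasurable)
          (integrable_ex_mul hu.integrable), fourier_eq_integral_ex]

/-- The periodized `S_R g` has Fourier coefficients sampled from `1_R ĝ`. Only finitely many are
nonzero, so it agrees almost everywhere with the trigonometric polynomial on the left. -/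
lemma torusPartialSum_torusPeriodization {g : EuclideanSpace ℝ (Fin d) → ℂ} (hg : WellLocalized g)
    {R : Set (EuclideanSpace ℝ (Fin d))} (hR : R ∈ dyadicRectangles d) (N : ℤ) :
    torusPartialSum (intBlock ((2 : ℝ) ^ N) R) (torusPeriodization ((2 : ℝ) ^ N) g)
      =ᵐ[torusMeasure d] torusPeriodization ((2 : ℝ) ^ N) (partialSum R g) := by
  have hs := zpow_two_pos N
  have hd := hg.decaying_partialSum hR
  have h1 := ae_eq_torusPartialSum (memLp_torusPeriodization hd hs 2)
    (finite_of_mem_intDyadicRectangles (intBlock_mem_intDyadicRectangles hR N)) fun m hm => by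
      have hmR : ((2 : ℝ) ^ N)⁻¹ • intVec m ∉ R := hm
      rw [torusCoeff_torusPeriodization hd hs, hg.fourier_partialSum R hR,
        Set.indicator_of_notMem hmR, mul_zero]
  refine EventuallyEq.trans (Eventually.of_forall fun z => ?_) h1.symm
  refine congrFun (torusPartialSum_congr fun m hm => ?_) z
  have hmR : ((2 : ℝ) ^ N)⁻¹ • intVec m ∈ R := hm
  rw [torusCoeff_torusPeriodization hd hs, torusCoeff_torusPeriodization hg.decaying hs,
    hg.fourier_partialSum R hR, Set.indicator_of_mem hmR]

/-- The square function built from the periodized partial sums. -/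
def periodizedSquareFunction (s : ℝ) (g : EuclideanSpace ℝ (Fin d) → ℂ)
    (x : EuclideanSpace ℝ (Fin d)) : ℝ≥0∞ :=
  l2 fun R : dyadicRectangles d =>
    ‖periodization s (partialSum (R : Set (EuclideanSpace ℝ (Fin d))) g) x‖ₑ

lemma measurable_periodizedSquareFunction {g : EuclideanSpace ℝ (Fin d) → ℂ}
    (hg : StronglyMeasurable g) (s : ℝ) : Measurable (periodizedSquareFunction s g) :=
  measurable_l2 fun R => (stronglyMeasurable_periodization
    (stronglyMeasurable_partialSum R.2 hg.aestronglyMeasurable) s).measurable.enorm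

/-- The spectrum of `g` avoids the coordinate hyperplanes, so blocks with a factor `{0}` contribute
nothing; the exceptional null sets are countably many. -/
lemma torusSquareFunction_torusPeriodization {g : EuclideanSpace ℝ (Fin d) → ℂ}
    (hg : WellLocalized g) (N : ℤ) :
    torusSquareFunction (torusPeriodization ((2 : ℝ) ^ N) g) =ᵐ[torusMeasure d]
      fun z => periodizedSquareFunction ((2 : ℝ) ^ N) g ((2 : ℝ) ^ N • torusLift z) := by
  have hs := zpow_two_pos N
  have hne : ∀ m, torusCoeff (torusPeriodization ((2 : ℝ) ^ N) g) m ≠ 0 → ∀ i, m i ≠ 0 := by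
    intro m hm i hi
    rw [torusCoeff_torusPeriodization hg.decaying hs] at hm
    refine hg.ne_zero _ (right_ne_zero_of_mul hm) i ?_
    simp [hi]
  have h1 : ∀ᵐ z ∂torusMeasure d, ∀ R : dyadicRectangles d,
      torusPartialSum (intBlock ((2 : ℝ) ^ N) (R : Set (EuclideanSpace ℝ (Fin d))))
        (torusPeriodization ((2 : ℝ) ^ N) g) z =
      torusPeriodization ((2 : ℝ) ^ N) (partialSum (R : Set (EuclideanSpace ℝ (Fin d))) g) z :=
    ae_all_iff.2 fun R => torusPartialSum_torusPeriodization hg R.2 N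
  filter_upwards [h1] with z hz
  rw [torusSquareFunction_eq_l2_intBlock hne N]
  simp_rw [hz]
  rfl

lemma eLpNorm_comp_smul_torusLift (hp : p ≠ ∞) (hs : 0 < s) {ε : Type*} [TopologicalSpace ε]
    [ESeminormedAddMonoid ε] {Φ : EuclideanSpace ℝ (Fin d) → ε} (hΦ : StronglyMeasurable Φ) :
    eLpNorm (fun z => Φ (s • torusLift z)) p (torusMeasure d) =
      ENNReal.ofReal (s ^ d)⁻¹ ^ (1 / p).toReal * eLpNorm ((cube d s).indicator Φ) p volume := by
  have h := eLpNorm_map_measure (p := p) (μ := torusMeasure d) (f := fun z => s • torusLift z)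
    (g := Φ) hΦ.aestronglyMeasurable (measurable_smul_torusLift s).aemeasurable
  rw [map_smul_torusLift hs, eLpNorm_smul_measure_of_ne_top hp,
    ← eLpNorm_indicator_eq_eLpNorm_restrict (measurableSet_cube s)] at h
  exact h.symm

lemma volume_cube (hs : 0 < s) : volume (cube d s) = ENNReal.ofReal (s ^ d) := by
  have h := congrArg (fun μ => μ univ) (map_smul_torusLift (d := d) hs)
  simp only [Measure.smul_apply, Measure.restrict_apply_univ] at h
  rw [Measure.map_apply (measurable_smul_torusLift s) MeasurableSet.univ, preimage_univ,
    measure_univ, smul_eq_mul] at h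
  have hsd : 0 < s ^ d := by positivity
  rw [ENNReal.ofReal_inv_of_pos hsd] at h
  have h0 : ENNReal.ofReal (s ^ d) ≠ 0 := by simpa using hsd
  rw [← mul_one (ENNReal.ofReal (s ^ d)), h, ← mul_assoc, ENNReal.mul_inv_cancel h0 (by simp),
    one_mul]

/-- An error of size `s^{-(d+1)}` on a cube of volume `s^d` has `L_p` norm at most of order
`s^{-1}`, because `s^{d/p} ≤ s^d` for `s ≥ 1`. -/
lemma eLpNorm_indicator_cube_le (hp1 : 1 ≤ p) (hp : p ≠ ∞) (hs : 1 ≤ s)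
    {U V : EuclideanSpace ℝ (Fin d) → ℝ≥0∞} (hU : Measurable U) {D : ℝ≥0∞}
    (h : ∀ x ∈ cube d s, V x ≤ U x + D * ENNReal.ofReal (s ^ (d + 1))⁻¹) :
    eLpNorm ((cube d s).indicator V) p volume ≤
      eLpNorm U p volume + D * ENNReal.ofReal s⁻¹ := by
  have hs0 : 0 < s := one_pos.trans_le hs
  have hp0 : p ≠ 0 := (zero_lt_one.trans_le hp1).ne'
  set e := D * ENNReal.ofReal (s ^ (d + 1))⁻¹ with he
  have hr : 1 ≤ p.toReal := by
    rw [← ENNReal.toReal_one]; exact (ENNReal.toReal_le_toReal (by simp) hp).2 hp1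
  calc eLpNorm ((cube d s).indicator V) p volume
      ≤ eLpNorm (U + (cube d s).indicator fun _ => e) p volume := by
        refine eLpNorm_mono_enorm fun x => ?_
        simp only [enorm_eq_self, Pi.add_apply]
        by_cases hx : x ∈ cube d s
        · simpa [hx] using h x hx
        · simp [hx]
    _ ≤ eLpNorm U p volume + eLpNorm ((cube d s).indicator fun _ => e) p volume :=
        eLpNorm_add_le hU.aestronglyMeasurable
          ((measurable_const.indicator (measurableSet_cube s)).aestronglyMeasurable) hp1
    _ ≤ _ := by
        gcongr
        rw [eLpNorm_indicator_const (measurableSet_cube s) hp0 hp, enorm_eq_self, volume_cube hs0]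
        have h1 : ENNReal.ofReal (s ^ d) ^ (1 / p.toReal) ≤ ENNReal.ofReal (s ^ d) := by
          calc _ ≤ ENNReal.ofReal (s ^ d) ^ (1 : ℝ) := by
                refine ENNReal.rpow_le_rpow_of_exponent_le ?_ ?_
                · rw [ENNReal.one_le_ofReal]; exact one_le_pow₀ hs
                · rw [div_le_one (by linarith)]; exact hr
            _ = _ := ENNReal.rpow_one _
        calc e * ENNReal.ofReal (s ^ d) ^ (1 / p.toReal) ≤ e * ENNReal.ofReal (s ^ d) := by gcongr
          _ = _ := by
            rw [he, mul_assoc, ← ENNReal.ofReal_mul (by positivity), pow_succ, mul_inv,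
              mul_comm (s ^ d)⁻¹, mul_assoc, inv_mul_cancel₀ (by positivity), mul_one]

lemma eventually_mem_cube (x : EuclideanSpace ℝ (Fin d)) :
    ∀ᶠ N : ℕ in atTop, x ∈ cube d ((2 : ℝ) ^ (N : ℤ)) := by
  have h : Tendsto (fun N : ℕ => (2 : ℝ) ^ N) atTop atTop := tendsto_pow_atTop_atTop_of_one_lt one_lt_two
  filter_upwards [h.eventually_gt_atTop (2 * ‖x‖)] with N hN i
  have h1 := abs_le.1 ((Real.norm_eq_abs _).symm.trans_le (PiLp.norm_apply_le x i))
  rw [zpow_natCast, mem_Ioc]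
  constructor <;> linarith [h1.1, h1.2]

lemma tendsto_ofReal_inv_zpow_two :
    Tendsto (fun N : ℕ => ENNReal.ofReal ((2 : ℝ) ^ (N : ℤ))⁻¹) atTop (𝓝 0) := by
  have h : Tendsto (fun N : ℕ => ((2 : ℝ) ^ (N : ℤ))⁻¹) atTop (𝓝 0) := by
    simp_rw [zpow_natCast]
    exact (tendsto_pow_atTop_atTop_of_one_lt one_lt_two).inv_tendsto_atTop
  simpa using ENNReal.tendsto_ofReal h

lemma tendsto_periodization (hu : Decaying u) (x : EuclideanSpace ℝ (Fin d)) :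
    Tendsto (fun N : ℕ => (cube d ((2 : ℝ) ^ (N : ℤ))).indicator
      (fun y => ‖periodization ((2 : ℝ) ^ (N : ℤ)) u y‖ₑ) x) atTop (𝓝 ‖u x‖ₑ) := by
  obtain ⟨C, hC, h⟩ := hu.bound
  obtain ⟨B, hB, hBs⟩ := exists_tsum_weight_tail_le d
  have h1 : Tendsto (fun N : ℕ => C * (ENNReal.ofReal ((2 : ℝ) ^ (N : ℤ))⁻¹ * B)) atTop (𝓝 0) := by
    have h2 := ENNReal.Tendsto.const_mul (a := C)
      (ENNReal.Tendsto.mul_const (b := B) tendsto_ofReal_inv_zpow_two (Or.inr hB)) (Or.inr hC)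
    simpa using h2
  have h2 : Tendsto (fun N : ℕ => periodization ((2 : ℝ) ^ (N : ℤ)) u x) atTop (𝓝 (u x)) := by
    rw [tendsto_iff_edist_tendsto_0]
    refine tendsto_of_tendsto_of_tendsto_of_le_of_le' tendsto_const_nhds h1
      (Eventually.of_forall fun _ => zero_le) ?_
    filter_upwards [eventually_mem_cube x] with N hN
    rw [edist_eq_enorm_sub]
    refine (enorm_periodization_sub_le hB hBs hC h (zpow_two_pos _) hN).trans ?_
    gcongr
    rw [zpow_natCast]
    exact le_self_pow₀ (one_le_pow₀ one_le_two) (by omega)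
  refine ((continuous_enorm.tendsto _).comp h2).congr' ?_
  filter_upwards [eventually_mem_cube x] with N hN
  rw [Set.indicator_of_mem hN]
  rfl

lemma one_le_zpow_two (N : ℕ) : (1 : ℝ) ≤ (2 : ℝ) ^ (N : ℤ) := by
  rw [zpow_natCast]; exact one_le_pow₀ one_le_two

lemma ofReal_inv_rpow_ne_zero_ne_top (hs : 0 < s) (r : ℝ) (hr : 0 ≤ r) :
    ENNReal.ofReal (s ^ d)⁻¹ ^ r ≠ 0 ∧ ENNReal.ofReal (s ^ d)⁻¹ ^ r ≠ ∞ := by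
  have h0 : ENNReal.ofReal (s ^ d)⁻¹ ≠ 0 := by
    have : 0 < (s ^ d)⁻¹ := by positivity
    simpa using this
  exact ⟨by simp [ENNReal.rpow_eq_zero_iff, h0], ENNReal.rpow_ne_top_of_nonneg hr (by simp)⟩

/-- The upper square function estimate passes from the torus to well localized functions. -/
theorem WellLocalized.eLpNorm_squareFunction_le (hp1 : 1 ≤ p) (hp : p ≠ ∞) {C : ℝ≥0∞} (hC : C ≠ ∞)
    (H : ∀ f : UnitAddTorus (Fin d) → ℂ, MemLp f p (torusMeasure d) →
      eLpNorm (torusSquareFunction f) p (torusMeasure d) ≤ C * eLpNorm f p (torusMeasure d))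
    {g : EuclideanSpace ℝ (Fin d) → ℂ} (hg : WellLocalized g) :
    eLpNorm (squareFunction g) p volume ≤ C * eLpNorm g p volume := by
  have hp0 : p ≠ 0 := (zero_lt_one.trans_le hp1).ne'
  obtain ⟨A, hA, h⟩ := hg.decaying.bound
  obtain ⟨B, hB, hBs⟩ := exists_tsum_weight_tail_le d
  have key : ∀ N : ℕ, eLpNorm ((cube d ((2 : ℝ) ^ (N : ℤ))).indicator
      (periodizedSquareFunction ((2 : ℝ) ^ (N : ℤ)) g)) p volume ≤
        C * (eLpNorm g p volume + A * B * ENNReal.ofReal ((2 : ℝ) ^ (N : ℤ))⁻¹) := fun N => by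
    have hs := zpow_two_pos N
    set s : ℝ := (2 : ℝ) ^ (N : ℤ) with hsN
    have h1 := H _ (memLp_torusPeriodization hg.decaying hs p)
    rw [eLpNorm_congr_ae (torusSquareFunction_torusPeriodization hg N),
      eLpNorm_comp_smul_torusLift hp hs
        (measurable_periodizedSquareFunction hg.stronglyMeasurable _).stronglyMeasurable] at h1
    have h2 := eLpNorm_comp_smul_torusLift (p := p) hp hs
      (stronglyMeasurable_periodization hg.stronglyMeasurable s)
    rw [show (fun z => periodization s g (s • torusLift z)) = torusPeriodization s g from rfl] at h2
    rw [h2, mul_left_comm] at h1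
    obtain ⟨h3, h4⟩ := ofReal_inv_rpow_ne_zero_ne_top (d := d) hs (1 / p).toReal (by positivity)
    -- The factor `s^{-d/p}` from rescaling the torus to the cube is the same on both sides and
    -- cancels.
    refine ((ENNReal.mul_le_mul_iff_right h3 h4).1 h1).trans ?_
    gcongr
    rw [← eLpNorm_enorm g, ← eLpNorm_enorm]
    simp_rw [enorm_indicator_eq_indicator_enorm]
    refine eLpNorm_indicator_cube_le hp1 hp (one_le_zpow_two N) hg.stronglyMeasurable.measurable.enorm
      fun x hx => ?_
    calc ‖periodization s g x‖ₑ = ‖g x + (periodization s g x - g x)‖ₑ := by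
          rw [add_sub_cancel]
      _ ≤ ‖g x‖ₑ + A * (ENNReal.ofReal ((s ^ (d + 1))⁻¹) * B) :=
          (enorm_add_le _ _).trans (by gcongr; exact enorm_periodization_sub_le hB hBs hA h hs hx)
      _ = _ := by ring
  have hlim : Tendsto (fun N : ℕ => C * (eLpNorm g p volume +
      A * B * ENNReal.ofReal ((2 : ℝ) ^ (N : ℤ))⁻¹)) atTop (𝓝 (C * eLpNorm g p volume)) := by
    have h1 := ENNReal.Tendsto.const_mul (a := A * B) tendsto_ofReal_inv_zpow_two
      (Or.inr (ENNReal.mul_ne_top hA hB))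
    have h2 := ENNReal.Tendsto.const_mul (a := C) (h1.const_add (eLpNorm g p volume)) (Or.inr hC)
    simpa using h2
  refine le_trans ?_ ((liminf_le_liminf (Eventually.of_forall key)).trans_eq hlim.liminf_eq)
  refine eLpNorm_le_liminf hp0 hp (fun N => ((measurable_periodizedSquareFunction
    hg.stronglyMeasurable _).indicator (measurableSet_cube _)).aemeasurable)
    (Eventually.of_forall fun x => ?_)
  have h3 : ∀ N : ℕ, (cube d ((2 : ℝ) ^ (N : ℤ))).indicator
      (periodizedSquareFunction ((2 : ℝ) ^ (N : ℤ)) g) x = l2 fun R : dyadicRectangles d =>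
        (cube d ((2 : ℝ) ^ (N : ℤ))).indicator (fun y => ‖periodization ((2 : ℝ) ^ (N : ℤ))
          (partialSum (R : Set (EuclideanSpace ℝ (Fin d))) g) y‖ₑ) x := fun N => by
    by_cases hx : x ∈ cube d ((2 : ℝ) ^ (N : ℤ))
    · simp_rw [Set.indicator_of_mem hx]; rfl
    · simp_rw [Set.indicator_of_notMem hx]; simp [l2]
  simp_rw [h3]
  rw [squareFunction_eq_l2]
  exact l2_le_liminf fun R => tendsto_periodization (hg.decaying_partialSum R.2) x

/-- The lower square function estimate passes from the torus to well localized functions. -/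
theorem WellLocalized.mul_eLpNorm_le (hp1 : 1 ≤ p) (hp : p ≠ ∞) {c : ℝ≥0∞} (hc : c ≠ ∞)
    (H : ∀ f : UnitAddTorus (Fin d) → ℂ, MemLp f p (torusMeasure d) →
      c * eLpNorm f p (torusMeasure d) ≤ eLpNorm (torusSquareFunction f) p (torusMeasure d))
    {g : EuclideanSpace ℝ (Fin d) → ℂ} (hg : WellLocalized g) {A : ℝ≥0∞} (hA : A ≠ ∞)
    (h : ∀ x, squareFunction g x ≤ A * weight x) :
    c * eLpNorm g p volume ≤ eLpNorm (squareFunction g) p volume := by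
  have hp0 : p ≠ 0 := (zero_lt_one.trans_le hp1).ne'
  obtain ⟨B, hB, hBs⟩ := exists_tsum_weight_tail_le d
  have key : ∀ N : ℕ, c * eLpNorm ((cube d ((2 : ℝ) ^ (N : ℤ))).indicator
      fun x => ‖periodization ((2 : ℝ) ^ (N : ℤ)) g x‖ₑ) p volume ≤
        eLpNorm (squareFunction g) p volume + A * B * ENNReal.ofReal ((2 : ℝ) ^ (N : ℤ))⁻¹ := by
    intro N
    have hs := zpow_two_pos N
    set s : ℝ := (2 : ℝ) ^ (N : ℤ) with hsN
    have h1 := H _ (memLp_torusPeriodization hg.decaying hs p)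
    rw [eLpNorm_congr_ae (torusSquareFunction_torusPeriodization hg N),
      eLpNorm_comp_smul_torusLift hp hs
        (measurable_periodizedSquareFunction hg.stronglyMeasurable _).stronglyMeasurable] at h1
    have h2 := eLpNorm_comp_smul_torusLift (p := p) hp hs
      (stronglyMeasurable_periodization hg.stronglyMeasurable s)
    rw [show (fun z => periodization s g (s • torusLift z)) = torusPeriodization s g from rfl,
      ← eLpNorm_enorm ((cube d s).indicator _)] at h2
    simp_rw [enorm_indicator_eq_indicator_enorm] at h2
    rw [h2, mul_left_comm] at h1
    obtain ⟨h3, h4⟩ := ofReal_inv_rpow_ne_zero_ne_top (d := d) hs (1 / p).toReal (by positivity)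
    refine ((ENNReal.mul_le_mul_iff_right h3 h4).1 h1).trans ?_
    refine eLpNorm_indicator_cube_le hp1 hp (one_le_zpow_two N)
      (measurable_squareFunction hg.stronglyMeasurable.aestronglyMeasurable) fun x hx => ?_
    -- Minkowski replaces the periodized partial sums by the translates of `S g` as a whole. The
    -- decay of each single `S_R g` would not suffice, its constant depending on `R`; hence the
    -- hypothesis on `squareFunction g`.
    calc periodizedSquareFunction s g x
        ≤ l2 fun R : dyadicRectangles d => ∑' k : Fin d → ℤ,
            ‖partialSum (R : Set (EuclideanSpace ℝ (Fin d))) g (x + s • intVec k)‖ₑ :=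
          l2_mono fun R => enorm_tsum_le_tsum_enorm
      _ ≤ ∑' k : Fin d → ℤ, squareFunction g (x + s • intVec k) := l2_tsum_le _
      _ ≤ squareFunction g x + A * (ENNReal.ofReal ((s ^ (d + 1))⁻¹) * B) := by
          rw [ENNReal.tsum_eq_add_tsum_ite (0 : Fin d → ℤ), intVec_zero, smul_zero, add_zero]
          gcongr
          convert! tsum_tail_le hBs h hs hx
      _ = _ := by ring
  have hlim : Tendsto (fun N : ℕ => eLpNorm (squareFunction g) p volume +
      A * B * ENNReal.ofReal ((2 : ℝ) ^ (N : ℤ))⁻¹) atTop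
        (𝓝 (eLpNorm (squareFunction g) p volume)) := by
    have h1 := ENNReal.Tendsto.const_mul (a := A * B) tendsto_ofReal_inv_zpow_two
      (Or.inr (ENNReal.mul_ne_top hA hB))
    simpa using h1.const_add (eLpNorm (squareFunction g) p volume)
  refine le_trans ?_ ((liminf_le_liminf (Eventually.of_forall key)).trans_eq hlim.liminf_eq)
  rw [ENNReal.liminf_const_mul_of_ne_top hc]
  gcongr
  rw [← eLpNorm_enorm g]
  refine eLpNorm_le_liminf hp0 hp (fun N => ((stronglyMeasurable_periodization
    hg.stronglyMeasurable _).measurable.enorm.indicator (measurableSet_cube _)).aemeasurable)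
    (Eventually.of_forall fun x => ?_)
  exact (tendsto_periodization hg.decaying x).liminf_eq.ge

end Transfer

end DyadicLP

end

noncomputable section

namespace DyadicLP

open Filter Topology

/-! ### Moving integer frequencies into interiors of dyadic rectangles. -/

section Matching

variable {d : ℕ}

lemma eq_of_mem_intDyadicIntervals {J K : Set ℤ} (hJ : J ∈ intDyadicIntervals)
    (hK : K ∈ intDyadicIntervals) {n : ℤ} (hnJ : n ∈ J) (hnK : n ∈ K) : J = K := by
  rcases hJ with rfl | ⟨I, hI, rfl⟩ <;> rcases hK with rfl | ⟨I', hI', rfl⟩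
  · rfl
  · rw [mem_singleton_iff] at hnJ
    exact absurd (by simp [hnJ]) (ne_zero_of_mem_dyadicIntervals hI' hnK)
  · rw [mem_singleton_iff] at hnK
    exact absurd (by simp [hnK]) (ne_zero_of_mem_dyadicIntervals hI hnJ)
  · rw [eq_of_mem_dyadicIntervals hI hI' hnJ hnK]

lemma eq_of_mem_intDyadicRectangles {J K : Set (Fin d → ℤ)} (hJ : J ∈ intDyadicRectangles d)
    (hK : K ∈ intDyadicRectangles d) {m : Fin d → ℤ} (hmJ : m ∈ J) (hmK : m ∈ K) : J = K := by
  obtain ⟨J, hJ, rfl⟩ := hJ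
  obtain ⟨K, hK, rfl⟩ := hK
  have : J = K := funext fun i => eq_of_mem_intDyadicIntervals (hJ i) (hK i) (hmJ i) (hmK i)
  rw [this]

/-- Moving away from zero, the only endpoint that can be reached is the open one, `± 2^k`. Here it
is an integer beyond `n`, hence at distance at least one. -/
lemma add_mem_dyadicInterval_of_int {I : Set ℝ} (hI : I ∈ dyadicIntervals) {n : ℤ}
    (hnI : (n : ℝ) ∈ I) {t : ℝ} (h1 : 0 ≤ n * t) (h2 : |t| < 1) : (n : ℝ) + t ∈ I := by
  have hpow : ∀ k : ℤ, ∀ j : ℤ, 0 < j → (j : ℝ) < 2 ^ k → (j : ℝ) + 1 ≤ 2 ^ k := fun k j hj hk => by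
    have hk0 : 0 ≤ k := by
      by_contra! hk0
      have h3 : (2 : ℝ) ^ k ≤ 2 ^ (0 : ℤ) := zpow_le_zpow_right₀ one_le_two hk0.le
      have h4 : (1 : ℝ) ≤ j := by exact_mod_cast hj
      rw [zpow_zero] at h3
      linarith
    lift k to ℕ using hk0
    rw [zpow_natCast] at hk ⊢
    have h3 : j < 2 ^ k := by exact_mod_cast hk
    exact_mod_cast h3
  have h2' := abs_lt.1 h2
  obtain ⟨k, rfl | rfl⟩ := hI
  · have hn0 : (0 : ℝ) < n := (zpow_two_pos _).trans_le hnI.1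
    have ht : 0 ≤ t := nonneg_of_mul_nonneg_right h1 hn0
    have := hpow k n (by exact_mod_cast hn0) hnI.2
    exact ⟨by linarith [hnI.1], by linarith⟩
  · have hn0 : (n : ℝ) < 0 := hnI.2.trans_lt (by linarith [zpow_two_pos (k - 1)])
    have ht : t ≤ 0 := by nlinarith
    have := hpow k (-n) (by have : n < 0 := by exact_mod_cast hn0
                            omega) (by push_cast; linarith [hnI.1])
    push_cast at this
    exact ⟨by linarith, by linarith [hnI.2]⟩

/-- A small affine perturbation `n ↦ (1 + η) n + ε` moves the integers of absolute value at most
`M` into the interiors of dyadic intervals and respects the dyadic blocks. -/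
lemma exists_affine_perturbation (M : ℕ) : ∃ η ε δ : ℝ, 0 < δ ∧ 0 < 1 + η ∧
    ∀ n : ℤ, |n| ≤ M → ∃ J ∈ intDyadicIntervals, ∃ I ∈ dyadicIntervals, n ∈ J ∧
      (∀ t : ℝ, |t| ≤ δ → (1 + η) * n + ε + t ∈ I) ∧
      ∀ n' : ℤ, |n'| ≤ M → (n' ∈ J ↔ (1 + η) * n' + ε ∈ I) := by
  -- For `0 < |n| ≤ M` the displacement `η n + 3e/4 + t` then has absolute value below `η (M + 1) <
  -- 1`. Since `3e/4 + e/8 < e ≤ η`, it also has the sign of `n`, so it points away from zero.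
  set η : ℝ := 1 / (M + 2) with hη
  have hη0 : 0 < η := by positivity
  have hηM : η * (M + 1) < 1 := by
    rw [hη, one_div, inv_mul_lt_iff₀ (by positivity)]; linarith
  obtain ⟨j, hj⟩ : ∃ j : ℕ, (2 : ℝ) ^ (-(j : ℤ)) ≤ η := by
    obtain ⟨j, hj⟩ := exists_pow_lt_of_lt_one hη0 (by norm_num : (1 / 2 : ℝ) < 1)
    refine ⟨j, ?_⟩
    rw [zpow_neg, zpow_natCast, ← inv_pow, ← one_div]
    exact hj.le
  -- A power of two, so that `[e/2, e)` is dyadic. The frequency `0` is sent to its midpoint `3e/4`,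
  -- and as `e ≤ 1` no integer lies in it, so the block `{0}` stays alone.
  set e : ℝ := (2 : ℝ) ^ (-(j : ℤ)) with he
  have he0 : 0 < e := zpow_two_pos _
  have he1 : e ≤ 1 := zpow_le_one_of_nonpos₀ one_le_two (by omega)
  have he2 : (2 : ℝ) ^ (-(j : ℤ) - 1) = e / 2 := by rw [zpow_sub_one₀ two_ne_zero]; rfl
  have hI0 : Ico (e / 2) e ∈ dyadicIntervals := ⟨-(j : ℤ), Or.inl (by rw [he2])⟩
  have hshift : ∀ n : ℤ, n ≠ 0 → |n| ≤ M → ∀ I ∈ dyadicIntervals, (n : ℝ) ∈ I → ∀ t : ℝ, |t| ≤ e / 8 →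
      (1 + η) * n + 3 / 4 * e + t ∈ I := fun n hn hnM I hI hnI t ht => by
    have ht' := abs_le.1 ht
    have hnM' : |(n : ℝ)| ≤ M := by exact_mod_cast hnM
    have hn1 : (1 : ℝ) ≤ |(n : ℝ)| := by exact_mod_cast Int.one_le_abs hn
    have h := add_mem_dyadicInterval_of_int hI hnI (t := η * n + 3 / 4 * e + t) ?_ ?_
    · convert h using 1; ring
    · rcases abs_cases (n : ℝ) with ⟨h1, h2⟩ | ⟨h1, h2⟩ <;> rw [h1] at hn1
      · have : 0 ≤ η * n := by positivity
        exact mul_nonneg h2 (by linarith)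
      · exact mul_nonneg_of_nonpos_of_nonpos h2.le (by nlinarith)
    · have hb := abs_le.1 hnM'
      rw [abs_lt]
      constructor <;> nlinarith
  have hzero : ∀ t : ℝ, |t| ≤ e / 8 → 3 / 4 * e + t ∈ Ico (e / 2) e := fun t ht => by
    have ht' := abs_le.1 ht
    constructor <;> linarith
  have hint : ∀ n : ℤ, (n : ℝ) ∉ Ico (e / 2) e := fun n hn => by
    have h1 : (0 : ℝ) < n := (half_pos he0).trans_le hn.1
    have h2 : (n : ℝ) < 1 := hn.2.trans_le he1
    have h1' : 0 < n := by exact_mod_cast h1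
    have h2' : n < 1 := by exact_mod_cast h2
    omega
  refine ⟨η, 3 / 4 * e, e / 8, by positivity, by positivity, fun n hn => ?_⟩
  have h08 : |(0 : ℝ)| ≤ e / 8 := by rw [abs_zero]; positivity
  have hrange : ∀ n' : ℤ, n' ≠ 0 → |n'| ≤ M → ∀ I ∈ dyadicIntervals, (1 + η) * n' + 3 / 4 * e ∈ I →
      (n' : ℝ) ∈ I := fun n' h0 hn' I hI h => by
    obtain ⟨I', hI', hnI'⟩ := exists_mem_dyadicIntervals (Int.cast_ne_zero.2 h0 : (n' : ℝ) ≠ 0)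
    have h1 := hshift n' h0 hn' I' hI' hnI' 0 h08
    rw [add_zero] at h1
    rwa [eq_of_mem_dyadicIntervals hI hI' h h1]
  rcases eq_or_ne n 0 with rfl | hn0
  · refine ⟨{0}, Or.inl rfl, _, hI0, rfl, fun t ht => by simpa using hzero t ht, fun n' hn' => ?_⟩
    rw [mem_singleton_iff]
    constructor
    · rintro rfl
      simpa using hzero 0 h08
    · intro h
      by_contra h0
      exact hint n' (hrange n' h0 hn' _ hI0 h)
  · obtain ⟨I, hI, hnI⟩ := exists_mem_dyadicIntervals (Int.cast_ne_zero.2 hn0 : (n : ℝ) ≠ 0)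
    refine ⟨{k : ℤ | (k : ℝ) ∈ I}, Or.inr ⟨I, hI, rfl⟩, I, hI, hnI, hshift n hn0 hn I hI hnI,
      fun n' hn' => ?_⟩
    rcases eq_or_ne n' 0 with rfl | h0
    · refine iff_of_false (fun h => ne_zero_of_mem_dyadicIntervals hI h (by simp)) fun h => ?_
      have h1 := hzero 0 h08
      simp only [Int.cast_zero, mul_zero, zero_add, add_zero] at h h1
      rw [eq_of_mem_dyadicIntervals hI hI0 h h1] at hnI
      exact hint n hnI
    · refine ⟨fun h => ?_, hrange n' h0 hn' I hI⟩
      have h1 := hshift n' h0 hn' I hI h 0 h08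
      rwa [add_zero] at h1

/-- Two systems of blocks inducing the same partition of a finite set give the same `ℓ²` sums. -/
lemma tsum_enorm_sum_block_eq {α β κ : Type*} (M : Finset κ) (A : α → Set κ) (B : β → Set κ)
    [∀ i m, Decidable (m ∈ A i)] [∀ j m, Decidable (m ∈ B j)]
    (hA : ∀ m ∈ M, ∀ i i', m ∈ A i → m ∈ A i' → i = i')
    (hB : ∀ m ∈ M, ∀ j j', m ∈ B j → m ∈ B j' → j = j')
    (hAB : ∀ m ∈ M, ∃ i j, m ∈ A i ∧ m ∈ B j ∧ ∀ m' ∈ M, m' ∈ A i ↔ m' ∈ B j) (v : κ → ℂ) :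
    ∑' i, ‖∑ m ∈ M with m ∈ A i, v m‖ₑ ^ 2 = ∑' j, ‖∑ m ∈ M with m ∈ B j, v m‖ₑ ^ 2 := by
  have hne : ∀ (P : κ → Prop) [DecidablePred P], ‖∑ m ∈ M with P m, v m‖ₑ ^ 2 ≠ 0 →
      ∃ m ∈ M, P m := fun P _ h => by
    by_contra! hcon
    rw [Finset.filter_false_of_mem hcon] at h
    simp at h
  have hex : ∀ j : Function.support fun j => ‖∑ m ∈ M with m ∈ B j, v m‖ₑ ^ 2,
      ∃ i, (∃ m ∈ M, m ∈ A i ∧ m ∈ B j.1) ∧ ∀ m' ∈ M, m' ∈ A i ↔ m' ∈ B j.1 := fun ⟨j, hj⟩ => by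
    obtain ⟨m, hm, hmj⟩ := hne _ hj
    obtain ⟨i, j', hi, hj', h⟩ := hAB m hm
    obtain rfl := hB m hm _ _ hmj hj'
    exact ⟨i, ⟨m, hm, hi, hmj⟩, h⟩
  choose φ hφ1 hφ2 using hex
  refine tsum_eq_tsum_of_ne_zero_bij φ ?_ ?_ ?_
  · intro j j' h
    obtain ⟨m, hm, hmi, hmj⟩ := hφ1 j
    rw [h] at hmi
    exact Subtype.ext (hB m hm _ _ hmj ((hφ2 j' m hm).1 hmi))
  · intro i hi
    obtain ⟨m, hm, hmi⟩ := hne _ hi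
    obtain ⟨i', j, hi', hj, h⟩ := hAB m hm
    obtain rfl := hA m hm _ _ hmi hi'
    have hs : (∑ m ∈ M with m ∈ A i, v m) = ∑ m ∈ M with m ∈ B j, v m := by
      rw [Finset.filter_congr h]
    refine ⟨⟨j, ?_⟩, ?_⟩
    · simp only [Function.mem_support] at hi ⊢
      rwa [← hs]
    · exact hA m hm _ _ ((hφ2 _ m hm).2 hj) hmi
  · intro j
    rw [Finset.filter_congr (hφ2 j)]

/-- Frequencies in `ℝ^d` attached to a finite set of integer frequencies, in the same dyadic
configuration. -/
lemma exists_frequencies (M : Finset (Fin d → ℤ)) : ∃ (s δ : ℝ) (ζ : EuclideanSpace ℝ (Fin d)),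
    0 < δ ∧ (∀ m ∈ M, WellInside δ (s • intVec m + ζ)) ∧
    ∀ m ∈ M, ∃ J ∈ intDyadicRectangles d, ∃ R ∈ dyadicRectangles d, m ∈ J ∧ s • intVec m + ζ ∈ R ∧
      ∀ m' ∈ M, m' ∈ J ↔ s • intVec m' + ζ ∈ R := by
  obtain ⟨M₀, hM₀⟩ : ∃ M₀ : ℕ, ∀ m ∈ M, ∀ i, |m i| ≤ M₀ := by
    refine ⟨∑ m ∈ M, ∑ i, (m i).natAbs, fun m hm i => ?_⟩
    rw [← Int.natCast_natAbs]
    exact_mod_cast (Finset.single_le_sum (f := fun i => (m i).natAbs) (fun _ _ => Nat.zero_le _)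
      (Finset.mem_univ i)).trans (Finset.single_le_sum (f := fun m : Fin d → ℤ => ∑ i, (m i).natAbs)
        (fun _ _ => Nat.zero_le _) hm)
  obtain ⟨η, ε, δ, hδ, -, h⟩ := exists_affine_perturbation M₀
  choose! J hJ I hI hnJ hnI hJI using h
  set ζ : EuclideanSpace ℝ (Fin d) := WithLp.toLp 2 fun _ => ε with hζ
  have hcoord : ∀ (m : Fin d → ℤ) i, ((1 + η) • intVec m + ζ) i = (1 + η) * m i + ε := fun m i => rfl
  refine ⟨1 + η, δ, ζ, hδ, fun m hm => ⟨{ξ | ∀ i, ξ i ∈ I (m i)},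
    ⟨_, fun i => hI _ (hM₀ m hm i), rfl⟩, fun ξ hξ i => ?_⟩, fun m hm =>
    ⟨{k | ∀ i, k i ∈ J (m i)}, ⟨_, fun i => hJ _ (hM₀ m hm i), rfl⟩, {ξ | ∀ i, ξ i ∈ I (m i)},
      ⟨_, fun i => hI _ (hM₀ m hm i), rfl⟩, fun i => hnJ _ (hM₀ m hm i), fun i => ?_,
      fun m' hm' => forall_congr' fun i => hJI _ (hM₀ m hm i) _ (hM₀ m' hm' i)⟩⟩
  · have h1 := hnI _ (hM₀ m hm i) ((ξ - ((1 + η) • intVec m + ζ)) i) ?_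
    · rw [PiLp.sub_apply, hcoord] at h1
      simpa using h1
    · rw [mem_closedBall_iff_norm] at hξ
      exact ((Real.norm_eq_abs _).symm.trans_le (PiLp.norm_apply_le _ i)).trans hξ
  · have h1 := hnI _ (hM₀ m hm i) 0 (by simpa using hδ.le)
    rwa [add_zero] at h1

end Matching

end DyadicLP

end

noncomputable section

namespace DyadicLP

open Filter Topology

/-! ### Partial sums of modulated functions of small spectrum. -/

section Modulation

variable {d : ℕ} {p : ℝ≥0∞}

lemma fourier_ex_mul (Ψ : EuclideanSpace ℝ (Fin d) → ℂ) (ξ ζ : EuclideanSpace ℝ (Fin d)) :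
    𝓕 (fun x => ex ξ x * Ψ x) ζ = 𝓕 Ψ (ζ - ξ) := by
  simp_rw [fourier_eq_integral_ex, ← mul_assoc, ← ex_add_left]
  congr 1
  ext x
  rw [neg_sub, sub_eq_add_neg, add_comm]

/-- The spectrum lies in a ball around `ξ` inside a single dyadic rectangle, so `S_R` keeps the
function whole or kills it. -/
lemma partialSum_ex_mul {χ Ψ : SchwartzMap (EuclideanSpace ℝ (Fin d)) ℂ} (hχ : 𝓕⁻ (χ : EuclideanSpace ℝ (Fin d) → ℂ) = Ψ)
    (hΨ : 𝓕 (Ψ : EuclideanSpace ℝ (Fin d) → ℂ) = χ) {δ : ℝ} (hδ : ∀ η, χ η ≠ 0 → ‖η‖ ≤ δ)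
    {ξ : EuclideanSpace ℝ (Fin d)} (hξ : WellInside δ ξ) {R : Set (EuclideanSpace ℝ (Fin d))}
    (hR : R ∈ dyadicRectangles d) [Decidable (ξ ∈ R)] (x : EuclideanSpace ℝ (Fin d)) :
    partialSum R (fun y => ex ξ y * Ψ y) x = if ξ ∈ R then ex ξ x * Ψ x else 0 := by
  rw [partialSum_eq_fourierInv hR (integrable_ex_mul Ψ.integrable)]
  have h1 : R.indicator (𝓕 fun y => ex ξ y * Ψ y) = fun ζ => if ξ ∈ R then χ (ζ - ξ) else 0 := by
    ext ζ
    by_cases h0 : χ (ζ - ξ) = 0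
    · simp [Set.indicator, fourier_ex_mul, hΨ, h0]
    · have h2 := hξ.add_mem_iff (hδ _ h0) hR
      rw [add_sub_cancel] at h2
      simp [Set.indicator, fourier_ex_mul, hΨ, h2]
  rw [h1, fourierInv_eq_integral_ex]
  split_ifs with h
  · rw [← integral_add_right_eq_self (fun η => ex η x * χ (η - ξ)) ξ]
    simp_rw [add_sub_cancel_right, ex_add_left, mul_comm _ (ex ξ x), mul_assoc]
    rw [integral_const_mul, ← fourierInv_eq_integral_ex, hχ]
  · simp

lemma memLp_ex_mul {Ψ : EuclideanSpace ℝ (Fin d) → ℂ} (hΨ : MemLp Ψ p volume)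
    (ξ : EuclideanSpace ℝ (Fin d)) : MemLp (fun x => ex ξ x * Ψ x) p volume := by
  refine hΨ.of_le ((by fun_prop : Continuous fun y => ex ξ y).aestronglyMeasurable.mul hΨ.1)
    (Eventually.of_forall fun x => ?_)
  simp

lemma partialSum_finset_sum {q : ℝ≥0∞} [p.HolderConjugate q] {κ : Type*} (M : Finset κ) (c : κ → ℂ)
    {u : κ → EuclideanSpace ℝ (Fin d) → ℂ} (hu : ∀ m ∈ M, MemLp (u m) p volume)
    {R : Set (EuclideanSpace ℝ (Fin d))} (hk : MemLp (rectKernel R) q volume)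
    (x : EuclideanSpace ℝ (Fin d)) :
    partialSum R (fun y => ∑ m ∈ M, c m * u m y) x = ∑ m ∈ M, c m * partialSum R (u m) x := by
  simp_rw [partialSum, Finset.sum_mul, mul_assoc]
  rw [integral_finsetSum]
  · simp_rw [integral_const_mul]
  · exact fun m hm => (integrable_mul_comp_sub (hu m hm) hk x).const_mul _

lemma continuous_torusMk : Continuous (torusMk (d := d)) := by
  unfold torusMk
  refine continuous_pi fun i => ?_
  exact (AddCircle.continuous_mk' 1).comp (by fun_prop)

end Modulation

/-! ### Transfer from `ℝ^d` to trigonometric polynomials. -/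

section Transfer

variable {d : ℕ} {p : ℝ≥0∞}

lemma torusPartialSum_trigPoly (M : Finset (Fin d → ℤ)) (a : (Fin d → ℤ) → ℂ) {J : Set (Fin d → ℤ)}
    (hJ : J.Finite) [DecidablePred (· ∈ J)] (z : UnitAddTorus (Fin d)) :
    torusPartialSum J (fun z => ∑ m ∈ M, a m * UnitAddTorus.mFourier m z) z =
      ∑ m ∈ M with m ∈ J, a m * UnitAddTorus.mFourier m z := by
  classical
  rw [torusPartialSum_eq_sum hJ]
  simp_rw [torusCoeff_sum, ite_mul, zero_mul]
  rw [← Finset.sum_filter]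
  refine Finset.sum_congr ?_ fun _ _ => rfl
  ext m
  simp [and_comm]

/-- A trigonometric polynomial on the torus is modelled on `ℝ^d` by functions `g z`, `z ∈ 𝕋^d`, with
`|g z x| = |Ψ x| |f (z + π x)|` and the same relation between the square functions. -/
lemma exists_modulated_model (hp1 : 1 < p) (hp : p < ∞) (M : Finset (Fin d → ℤ)) (a : (Fin d → ℤ) → ℂ) :
    ∃ (Ψ : SchwartzMap (EuclideanSpace ℝ (Fin d)) ℂ) (s : ℝ)
      (g : UnitAddTorus (Fin d) → EuclideanSpace ℝ (Fin d) → ℂ), eLpNorm Ψ p volume ≠ 0 ∧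
      ∀ z, MemLp (g z) p volume ∧
        (∀ x, ‖g z x‖ₑ = ‖Ψ x‖ₑ *
          ‖∑ m ∈ M, a m * UnitAddTorus.mFourier m (z + torusMk (s • x))‖ₑ) ∧
        ∀ x, squareFunction (g z) x = ‖Ψ x‖ₑ *
          torusSquareFunction (fun z => ∑ m ∈ M, a m * UnitAddTorus.mFourier m z)
            (z + torusMk (s • x)) := by
  classical
  obtain ⟨q, hpq, hq1, hq⟩ := exists_holderConjugate hp1 hp
  obtain ⟨s, δ, ζ, hδ, hin, hmatch⟩ := exists_frequencies M
  obtain ⟨χ, hχ1, hχ2, -⟩ := exists_schwartz_bump (d := d) (half_pos hδ) (half_lt_self hδ)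
  obtain ⟨Ψ, hΨ1, hΨ2⟩ := schwartz_fourierInv_coe χ
  set ξ : (Fin d → ℤ) → EuclideanSpace ℝ (Fin d) := fun m => s • intVec m + ζ with hξ
  have hex : ∀ (P : (Fin d → ℤ) → Prop) [DecidablePred P] (z : UnitAddTorus (Fin d))
      (x : EuclideanSpace ℝ (Fin d)),
      ‖∑ m ∈ M with P m, (a m * UnitAddTorus.mFourier m z) * (ex (ξ m) x * Ψ x)‖ₑ =
        ‖Ψ x‖ₑ * ‖∑ m ∈ M with P m, a m * UnitAddTorus.mFourier m (z + torusMk (s • x))‖ₑ := by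
    intro P _ z x
    -- The frequencies depend on `m` affinely, so the factor `ex ζ x * Ψ x` is common to all terms,
    -- and the linear part `s • intVec m` is a translation on the torus.
    have h1 : ∀ m, (a m * UnitAddTorus.mFourier m z) * (ex (ξ m) x * Ψ x) =
        (ex ζ x * Ψ x) * (a m * UnitAddTorus.mFourier m (z + torusMk (s • x))) := fun m => by
      rw [mFourier_apply_add, mFourier_torusMk, ex_add_left, ex_smul_left]; ring
    simp_rw [h1]
    rw [← Finset.mul_sum, enorm_mul, enorm_mul, enorm_ex, one_mul]
  refine ⟨Ψ, s, fun z x => ∑ m ∈ M, (a m * UnitAddTorus.mFourier m z) * (ex (ξ m) x * Ψ x), ?_,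
    fun z => ⟨?_, fun x => ?_, fun x => ?_⟩⟩
  · intro h0
    rw [eLpNorm_eq_zero_iff Ψ.continuous.aestronglyMeasurable (zero_lt_one.trans hp1).ne'] at h0
    have h1 : (χ : EuclideanSpace ℝ (Fin d) → ℂ) 0 = 0 := by
      rw [← hΨ2, fourier_eq_integral_ex]
      refine integral_eq_zero_of_ae ?_
      filter_upwards [h0] with x hx
      simp [hx]
    rw [hχ1 0 (by simpa using (half_pos hδ).le)] at h1
    exact one_ne_zero h1
  · exact memLp_finsetSum M fun m _ => (memLp_ex_mul (Ψ.memLp p volume) (ξ m)).const_mul _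
  · simpa using hex (fun _ => True) z x
  · have hblock : ∀ R : dyadicRectangles d, partialSum (R : Set (EuclideanSpace ℝ (Fin d)))
        (fun x => ∑ m ∈ M, (a m * UnitAddTorus.mFourier m z) * (ex (ξ m) x * Ψ x)) x =
        ∑ m ∈ M with ξ m ∈ (R : Set (EuclideanSpace ℝ (Fin d))),
          (a m * UnitAddTorus.mFourier m z) * (ex (ξ m) x * Ψ x) := fun R => by
      rw [partialSum_finset_sum (p := p) M (fun m => a m * UnitAddTorus.mFourier m z)
        (fun m _ => memLp_ex_mul (Ψ.memLp p volume) (ξ m)) (memLp_rectKernel hq1 hq R.2),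
        Finset.sum_filter]
      refine Finset.sum_congr rfl fun m hm => ?_
      rw [partialSum_ex_mul hΨ1 hΨ2 hχ2 (hin m hm) R.2]
      split_ifs <;> simp [hξ]
    rw [squareFunction_eq_l2]
    simp_rw [hblock, hex]
    rw [l2_mul_left, torusSquareFunction_eq_l2]
    congr 1
    rw [l2, l2]
    congr 1
    simp_rw [fun R : intDyadicRectangles d =>
      torusPartialSum_trigPoly M a (finite_of_mem_intDyadicRectangles R.2)]
    -- The integer blocks and the dyadic rectangles partition the finite frequency set in the same
    -- way; blocks without frequencies contribute zero to either sum.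
    refine (tsum_enorm_sum_block_eq M (fun J : intDyadicRectangles d => (J : Set (Fin d → ℤ)))
      (fun R : dyadicRectangles d => {m | ξ m ∈ (R : Set (EuclideanSpace ℝ (Fin d)))}) ?_ ?_ ?_ _).symm
    · exact fun m _ J K hJ hK => Subtype.ext (eq_of_mem_intDyadicRectangles J.2 K.2 hJ hK)
    · exact fun m _ R S hR hS => Subtype.ext (eq_of_mem_dyadicRectangles R.2 S.2 hR hS)
    · intro m hm
      obtain ⟨J, hJ, R, hR, h1, h2, h3⟩ := hmatch m hm
      exact ⟨⟨J, hJ⟩, ⟨R, hR⟩, h1, h2, h3⟩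

/-- Tonelli and translation invariance: averaging over `z` decouples `w` from `Φ`, for whatever `s`.
-/
lemma lintegral_eLpNorm_translates (hp0 : p ≠ 0) (hp : p ≠ ∞) {w : EuclideanSpace ℝ (Fin d) → ℝ≥0∞}
    (hw : Measurable w) {Φ : UnitAddTorus (Fin d) → ℝ≥0∞} (hΦ : Measurable Φ) (s : ℝ) :
    ∫⁻ z, eLpNorm (fun x => w x * Φ (z + torusMk (s • x))) p volume ^ p.toReal ∂torusMeasure d =
      eLpNorm w p volume ^ p.toReal * eLpNorm Φ p (torusMeasure d) ^ p.toReal := by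
  have hm : Measurable fun y : UnitAddTorus (Fin d) × EuclideanSpace ℝ (Fin d) =>
      y.1 + torusMk (s • y.2) :=
    measurable_fst.add (continuous_torusMk.measurable.comp (measurable_snd.const_smul s))
  simp_rw [eLpNorm_rpow_eq_lintegral hp0 hp, enorm_eq_self]
  rw [lintegral_lintegral_swap]
  · have h1 : ∀ x, ∫⁻ z, (w x * Φ (z + torusMk (s • x))) ^ p.toReal ∂torusMeasure d =
        w x ^ p.toReal * ∫⁻ z, Φ z ^ p.toReal ∂torusMeasure d := fun x => by
      simp_rw [ENNReal.mul_rpow_of_nonneg _ _ ENNReal.toReal_nonneg]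
      have hmx : Measurable fun z => Φ (z + torusMk (s • x)) := hΦ.comp (measurable_id.add_const _)
      rw [lintegral_const_mul _ (hmx.pow_const _),
        lintegral_add_right_eq_self (fun z => Φ z ^ p.toReal)]
    simp_rw [h1]
    rw [lintegral_mul_const _ (hw.pow_const _)]
  · exact (((hw.comp measurable_snd).mul (hΦ.comp hm)).pow_const _).aemeasurable

/-- The same factor `K = ‖Ψ‖_p^p` occurs in both integrals, so an estimate valid for every `g z`
integrates to one for `f` with an unchanged constant. -/
lemma exists_eLpNorm_model (hp1 : 1 < p) (hp : p < ∞) (M : Finset (Fin d → ℤ))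
    (a : (Fin d → ℤ) → ℂ) {f : UnitAddTorus (Fin d) → ℂ}
    (hf : f = fun z => ∑ m ∈ M, a m * UnitAddTorus.mFourier m z) :
    ∃ (K : ℝ≥0∞) (g : UnitAddTorus (Fin d) → EuclideanSpace ℝ (Fin d) → ℂ), K ≠ 0 ∧ K ≠ ∞ ∧
      (∀ z, MemLp (g z) p volume) ∧
      ∫⁻ z, eLpNorm (g z) p volume ^ p.toReal ∂torusMeasure d =
        K * eLpNorm f p (torusMeasure d) ^ p.toReal ∧
      ∫⁻ z, eLpNorm (squareFunction (g z)) p volume ^ p.toReal ∂torusMeasure d =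
        K * eLpNorm (torusSquareFunction f) p (torusMeasure d) ^ p.toReal := by
  have hp0 : p ≠ 0 := (zero_lt_one.trans hp1).ne'
  obtain ⟨Ψ, s, g, hΨ, h⟩ := exists_modulated_model hp1 hp M a
  rw [← hf] at h
  have hfm : Measurable f := by
    rw [hf]; exact (continuous_mFourier_sum M a).measurable
  have hΨm : Measurable fun x => ‖Ψ x‖ₑ := Ψ.continuous.measurable.enorm
  refine ⟨eLpNorm Ψ p volume ^ p.toReal, g, ?_, ?_, fun z => (h z).1, ?_, ?_⟩
  · have hr := ENNReal.toReal_pos hp0 hp.ne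
    simp [ENNReal.rpow_eq_zero_iff, hΨ, hr.not_gt]
  · exact ENNReal.rpow_ne_top_of_nonneg ENNReal.toReal_nonneg (Ψ.memLp p volume).2.ne
  · rw [← eLpNorm_enorm (Ψ : EuclideanSpace ℝ (Fin d) → ℂ), ← eLpNorm_enorm f,
      ← lintegral_eLpNorm_translates hp0 hp.ne hΨm hfm.enorm s]
    refine lintegral_congr fun z => ?_
    rw [← eLpNorm_enorm (g z), funext (h z).2.1, hf]
  · rw [← eLpNorm_enorm (Ψ : EuclideanSpace ℝ (Fin d) → ℂ),
      ← lintegral_eLpNorm_translates hp0 hp.ne hΨm (measurable_torusSquareFunction f) s]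
    refine lintegral_congr fun z => ?_
    rw [funext (h z).2.2]

/-- The upper square function estimate passes from `ℝ^d` to trigonometric polynomials. -/
theorem eLpNorm_torusSquareFunction_trigPoly_le (hp1 : 1 < p) (hp : p < ∞) {C : ℝ≥0∞} (hC : C ≠ ∞)
    (H : ∀ f : EuclideanSpace ℝ (Fin d) → ℂ, MemLp f p volume →
      eLpNorm (squareFunction f) p volume ≤ C * eLpNorm f p volume)
    (M : Finset (Fin d → ℤ)) (a : (Fin d → ℤ) → ℂ) {f : UnitAddTorus (Fin d) → ℂ}
    (hf : f = fun z => ∑ m ∈ M, a m * UnitAddTorus.mFourier m z) :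
    eLpNorm (torusSquareFunction f) p (torusMeasure d) ≤ C * eLpNorm f p (torusMeasure d) := by
  have hr := ENNReal.toReal_pos (zero_lt_one.trans hp1).ne' hp.ne
  obtain ⟨K, g, hK0, hK, hg, h1, h2⟩ := exists_eLpNorm_model hp1 hp M a hf
  rw [← ENNReal.rpow_le_rpow_iff hr, ← ENNReal.mul_le_mul_iff_right hK0 hK, ← h2,
    ENNReal.mul_rpow_of_nonneg _ _ hr.le, mul_left_comm, ← h1,
    ← lintegral_const_mul' _ _ (ENNReal.rpow_ne_top_of_nonneg hr.le hC)]
  refine lintegral_mono fun z => ?_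
  rw [← ENNReal.mul_rpow_of_nonneg _ _ hr.le]
  exact ENNReal.rpow_le_rpow (H _ (hg z)) hr.le

/-- The lower square function estimate passes from `ℝ^d` to trigonometric polynomials. -/
theorem mul_eLpNorm_trigPoly_le (hp1 : 1 < p) (hp : p < ∞) {c : ℝ≥0∞} (hc : c ≠ ∞)
    (H : ∀ f : EuclideanSpace ℝ (Fin d) → ℂ, MemLp f p volume →
      c * eLpNorm f p volume ≤ eLpNorm (squareFunction f) p volume)
    (M : Finset (Fin d → ℤ)) (a : (Fin d → ℤ) → ℂ) {f : UnitAddTorus (Fin d) → ℂ}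
    (hf : f = fun z => ∑ m ∈ M, a m * UnitAddTorus.mFourier m z) :
    c * eLpNorm f p (torusMeasure d) ≤ eLpNorm (torusSquareFunction f) p (torusMeasure d) := by
  have hr := ENNReal.toReal_pos (zero_lt_one.trans hp1).ne' hp.ne
  obtain ⟨K, g, hK0, hK, hg, h1, h2⟩ := exists_eLpNorm_model hp1 hp M a hf
  rw [← ENNReal.rpow_le_rpow_iff hr, ← ENNReal.mul_le_mul_iff_right hK0 hK, ← h2,
    ENNReal.mul_rpow_of_nonneg _ _ hr.le, mul_left_comm, ← h1,
    ← lintegral_const_mul' _ _ (ENNReal.rpow_ne_top_of_nonneg hr.le hc)]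
  refine lintegral_mono fun z => ?_
  rw [← ENNReal.mul_rpow_of_nonneg _ _ hr.le]
  exact ENNReal.rpow_le_rpow (H _ (hg z)) hr.le

end Transfer

end DyadicLP

end

noncomputable section

namespace DyadicLP

open Filter Topology

/-! ### Density of trigonometric polynomials, with control of the square function. -/

section Density

variable {d : ℕ} {p : ℝ≥0∞}

instance : (torusMeasure d).IsNegInvariant :=
  Measure.IsAddHaarMeasure.isNegInvariant_of_innerRegular (torusMeasure d)

lemma exists_finset_sum_of_mem_mFourierSubalgebra {q : C(UnitAddTorus (Fin d), ℂ)}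
    (hq : q ∈ UnitAddTorus.mFourierSubalgebra (Fin d)) : ∃ (M : Finset (Fin d → ℤ)) (c : (Fin d → ℤ) → ℂ),
      ∀ z, q z = ∑ m ∈ M, c m * UnitAddTorus.mFourier m z := by
  have h1 : q ∈ Submodule.span ℂ (range (UnitAddTorus.mFourier (d := Fin d))) := by
    rw [← UnitAddTorus.mFourierSubalgebra_coe]; exact hq
  obtain ⟨c, hc⟩ := (Finsupp.mem_span_range_iff_exists_finsupp).1 h1
  refine ⟨c.support, c, fun z => ?_⟩
  rw [← hc, Finsupp.sum]
  simp

/-- Nonnegative trigonometric polynomials of integral one, concentrated near the origin. -/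
lemma exists_trigPoly_kernel {U : Set (UnitAddTorus (Fin d))} (hU : U ∈ 𝓝 0) {δ : ℝ≥0∞} (hδ : δ ≠ 0) :
    ∃ (M : Finset (Fin d → ℤ)) (c : (Fin d → ℤ) → ℂ) (F : UnitAddTorus (Fin d) → ℂ),
      (F = fun z => ∑ m ∈ M, c m * UnitAddTorus.mFourier m z) ∧ ∫ z, F z ∂torusMeasure d = 1 ∧
      ∫⁻ z, ‖F z‖ₑ ∂torusMeasure d ≤ 1 ∧ ∫⁻ z in Uᶜ, ‖F z‖ₑ ∂torusMeasure d ≤ δ := by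
  obtain ⟨δ', hδ'0, hδ'⟩ : ∃ δ' : ℝ, 0 < δ' ∧ ENNReal.ofReal δ' ≤ δ := by
    obtain ⟨t, ht0, ht⟩ := ENNReal.lt_iff_exists_nnreal_btwn.1 (pos_iff_ne_zero.2 hδ)
    exact ⟨t, by exact_mod_cast ht0, by rw [ENNReal.ofReal_coe_nnreal]; exact ht.le⟩
  obtain ⟨r, hr, hrU⟩ := Metric.mem_nhds_iff.1 hU
  -- The kernel is `|q|²`, normalized, with `q` a trigonometric polynomial uniformly within `η` of
  -- the tent function `b`.
  let b : C(UnitAddTorus (Fin d), ℂ) :=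
    ⟨fun z => ((max 0 (1 - dist z 0 / r) : ℝ) : ℂ), by fun_prop⟩
  set V := Metric.ball (0 : UnitAddTorus (Fin d)) (r / 2) with hV
  set v := (torusMeasure d).real V with hv
  have hv0 : 0 < v := ENNReal.toReal_pos (Metric.measure_ball_pos _ _ (half_pos hr)).ne' (measure_ne_top _ _)
  -- On `V` one has `|b| ≥ 1/2`, so `η ≤ 1/4` gives `|q|² ≥ 1/16` there and total mass `A ≥ v / 16`.
  -- Outside the ball `|q| ≤ η`, so the normalized kernel is at most `16 η² / v ≤ δ'`.
  obtain ⟨η, hη0, hη1, hη2⟩ : ∃ η : ℝ, 0 < η ∧ η ≤ 1 / 4 ∧ η ^ 2 ≤ δ' * (v / 16) := by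
    refine ⟨min (1 / 4) (δ' * (v / 16)), by positivity, min_le_left _ _, ?_⟩
    rw [sq]
    calc _ ≤ 1 * (δ' * (v / 16)) := by
          refine mul_le_mul ((min_le_left _ _).trans (by norm_num)) (min_le_right _ _) (by positivity)
            (by norm_num)
      _ = _ := one_mul _
  obtain ⟨q, hq, hqb⟩ : ∃ q ∈ UnitAddTorus.mFourierSubalgebra (Fin d), dist b q < η := by
    have h : b ∈ closure (UnitAddTorus.mFourierSubalgebra (Fin d) : Set C(UnitAddTorus (Fin d), ℂ)) := by
      rw [← StarSubalgebra.topologicalClosure_coe, UnitAddTorus.mFourierSubalgebra_closure_eq_top]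
      trivial
    exact Metric.mem_closure_iff.1 h η hη0
  have hqz : ∀ z, ‖b z - q z‖ ≤ η := fun z => by
    rw [← dist_eq_norm]; exact (ContinuousMap.dist_apply_le_dist z).trans hqb.le
  obtain ⟨M, c, hMc⟩ := exists_finset_sum_of_mem_mFourierSubalgebra (mul_mem hq (star_mem hq))
  have hsq : ∀ z, ((‖q z‖ ^ 2 : ℝ) : ℂ) = ∑ m ∈ M, c m * UnitAddTorus.mFourier m z := fun z => by
    rw [← hMc]
    simp [Complex.mul_conj, Complex.normSq_eq_norm_sq]
  have hcont : Continuous fun z => ‖q z‖ ^ 2 := by fun_prop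
  have hint : Integrable (fun z => ‖q z‖ ^ 2) (torusMeasure d) :=
    hcont.integrable_of_hasCompactSupport (HasCompactSupport.of_compactSpace _)
  set A := ∫ z, ‖q z‖ ^ 2 ∂torusMeasure d with hA
  have hAv : v / 16 ≤ A := by
    calc v / 16 = ∫ z in V, (1 / 16 : ℝ) ∂torusMeasure d := by
          rw [setIntegral_const, smul_eq_mul, hv]; ring
      _ ≤ ∫ z in V, ‖q z‖ ^ 2 ∂torusMeasure d := by
          refine setIntegral_mono_on (integrable_const _).integrableOn hint.integrableOn
            measurableSet_ball fun z hz => ?_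
          have h1 : (1 / 2 : ℝ) ≤ ‖b z‖ := by
            have h2 : dist z 0 / r < 1 / 2 := by
              rw [div_lt_iff₀ hr]; linarith [Metric.mem_ball.1 hz]
            simp only [b, ContinuousMap.coe_mk, Complex.norm_real]
            refine le_trans ?_ (Real.le_norm_self _)
            exact le_max_of_le_right (by linarith)
          have h2 : ‖b z‖ ≤ ‖b z - q z‖ + ‖q z‖ := by
            refine (le_of_eq ?_).trans (norm_add_le _ _); rw [sub_add_cancel]
          nlinarith [hqz z, norm_nonneg (q z)]
      _ ≤ A := setIntegral_le_integral hint (Eventually.of_forall fun z => by positivity)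
  have hA0 : 0 < A := by linarith [div_pos hv0 (by norm_num : (0 : ℝ) < 16)]
  have hF : ∀ z, ((A⁻¹ * ‖q z‖ ^ 2 : ℝ) : ℂ) = ∑ m ∈ M, ((A⁻¹ : ℝ) : ℂ) * c m * UnitAddTorus.mFourier m z := by
    intro z
    rw [Complex.ofReal_mul, hsq, Finset.mul_sum]
    simp_rw [mul_assoc]
  have hen : ∀ z, ‖((A⁻¹ * ‖q z‖ ^ 2 : ℝ) : ℂ)‖ₑ = ENNReal.ofReal (A⁻¹ * ‖q z‖ ^ 2) := fun z => by
    rw [← ofReal_norm, Complex.norm_real, Real.norm_of_nonneg (by positivity)]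
  refine ⟨M, fun m => ((A⁻¹ : ℝ) : ℂ) * c m, fun z => ((A⁻¹ * ‖q z‖ ^ 2 : ℝ) : ℂ), funext hF, ?_, ?_, ?_⟩
  · rw [integral_complex_ofReal, integral_const_mul, ← hA, inv_mul_cancel₀ hA0.ne', Complex.ofReal_one]
  · simp_rw [hen]
    rw [← ofReal_integral_eq_lintegral_ofReal (hint.const_mul _)
      (Eventually.of_forall fun z => by positivity), integral_const_mul, ← hA, inv_mul_cancel₀ hA0.ne',
      ENNReal.ofReal_one]
  · refine le_trans ?_ hδ'
    simp_rw [hen]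
    have hb : ∀ z ∈ (Metric.ball 0 r)ᶜ, ENNReal.ofReal (A⁻¹ * ‖q z‖ ^ 2) ≤ ENNReal.ofReal δ' := fun z hz => by
      refine ENNReal.ofReal_le_ofReal ?_
      have h1 : b z = 0 := by
        have h2 : r ≤ dist z 0 := by
          by_contra! h; exact hz (Metric.mem_ball.2 h)
        have h3 : 1 ≤ dist z 0 / r := by rwa [le_div_iff₀ hr, one_mul]
        simp only [b, ContinuousMap.coe_mk]
        rw [max_eq_left (by linarith), Complex.ofReal_zero]
      have h2 := hqz z
      rw [h1, zero_sub, norm_neg] at h2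
      rw [inv_mul_le_iff₀ hA0]
      calc ‖q z‖ ^ 2 ≤ η ^ 2 := by gcongr
        _ ≤ δ' * (v / 16) := hη2
        _ ≤ A * δ' := by rw [mul_comm A]; gcongr
    refine (lintegral_mono_set (compl_subset_compl.2 hrU)).trans ?_
    calc _ ≤ ∫⁻ _z in (Metric.ball 0 r)ᶜ, ENNReal.ofReal δ' ∂torusMeasure d :=
          setLIntegral_mono' measurableSet_ball.compl hb
      _ ≤ _ := by
          rw [setLIntegral_const]
          exact mul_le_of_le_one_right' prob_le_one

lemma conv_trigPoly {f : UnitAddTorus (Fin d) → ℂ} (hf : Integrable f (torusMeasure d))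
    (M : Finset (Fin d → ℤ)) (c : (Fin d → ℤ) → ℂ) (z : UnitAddTorus (Fin d)) :
    conv (torusMeasure d) (fun z => ∑ m ∈ M, c m * UnitAddTorus.mFourier m z) f z =
      ∑ m ∈ M, c m * torusCoeff f m * UnitAddTorus.mFourier m z := by
  rw [conv_comm, conv]
  have h1 : ∀ m w, f w * (c m * UnitAddTorus.mFourier m (z - w)) =
      (c m * UnitAddTorus.mFourier m z) * (f w * UnitAddTorus.mFourier (-m) w) := fun m w => by
    have h2 : UnitAddTorus.mFourier m (z - w) =
        UnitAddTorus.mFourier m z * UnitAddTorus.mFourier (-m) w := by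
      rw [sub_eq_add_neg, mFourier_apply_add]
      congr 1
      simp [UnitAddTorus.mFourier, fourier_apply]
    rw [h2]; ring
  simp_rw [Finset.mul_sum, h1]
  rw [integral_finsetSum _ fun m _ => (integrable_mul_mFourier hf _).const_mul _]
  refine Finset.sum_congr rfl fun m _ => ?_
  rw [integral_const_mul, torusCoeff]
  ring

lemma torusPartialSum_conv_trigPoly {f : UnitAddTorus (Fin d) → ℂ} (hf : Integrable f (torusMeasure d))
    (M : Finset (Fin d → ℤ)) (c : (Fin d → ℤ) → ℂ) {J : Set (Fin d → ℤ)} (hJ : J.Finite)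
    (z : UnitAddTorus (Fin d)) :
    torusPartialSum J (conv (torusMeasure d) (fun z => ∑ m ∈ M, c m * UnitAddTorus.mFourier m z) f) z =
      conv (torusMeasure d) (fun z => ∑ m ∈ M, c m * UnitAddTorus.mFourier m z) (torusPartialSum J f) z := by
  classical
  have hcont := continuous_torusPartialSum hJ f
  have hi : Integrable (torusPartialSum J f) (torusMeasure d) :=
    hcont.integrable_of_hasCompactSupport (HasCompactSupport.of_compactSpace _)
  rw [funext (conv_trigPoly hf M c), torusPartialSum_trigPoly M _ hJ, conv_trigPoly hi,
    Finset.sum_filter]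
  refine Finset.sum_congr rfl fun m _ => ?_
  have h4 : torusCoeff (torusPartialSum J f) m = if m ∈ hJ.toFinset then torusCoeff f m else 0 := by
    rw [← torusCoeff_sum]
    congr 1
    ext z
    exact torusPartialSum_eq_sum hJ f z
  rw [h4]
  simp only [Set.Finite.mem_toFinset]
  split_ifs <;> simp

/-- Trigonometric polynomials approximate in `L_p` without increasing the square function. -/
theorem exists_trigPoly_approx (hp1 : 1 < p) (hp : p < ∞) {f : UnitAddTorus (Fin d) → ℂ}
    (hf : MemLp f p (torusMeasure d)) {ε : ℝ≥0∞} (hε : ε ≠ 0) :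
    ∃ (M : Finset (Fin d → ℤ)) (a : (Fin d → ℤ) → ℂ) (g : UnitAddTorus (Fin d) → ℂ),
      (g = fun z => ∑ m ∈ M, a m * UnitAddTorus.mFourier m z) ∧
      eLpNorm (fun z => g z - f z) p (torusMeasure d) ≤ ε ∧
      eLpNorm (torusSquareFunction g) p (torusMeasure d) ≤
        eLpNorm (torusSquareFunction f) p (torusMeasure d) := by
  obtain ⟨q, hpq, hq1, hq⟩ := exists_holderConjugate hp1 hp
  have hfi : Integrable f (torusMeasure d) := hf.integrable hp1.le
  obtain ⟨U, hU, δ, hδ, H⟩ := exists_nhds_eLpNorm_conv_sub_le (q := q) hp1.le hp.ne hf hε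
  obtain ⟨M, c, F, hF, hF1, hF2, hF3⟩ := exists_trigPoly_kernel hU hδ
  have hFc : Continuous F := by rw [hF]; exact continuous_mFourier_sum M c
  have hFi : Integrable F (torusMeasure d) :=
    hFc.integrable_of_hasCompactSupport (HasCompactSupport.of_compactSpace _)
  have hFq : MemLp F q (torusMeasure d) :=
    hFc.memLp_of_hasCompactSupport (HasCompactSupport.of_compactSpace _)
  refine ⟨M, fun m => c m * torusCoeff f m, conv (torusMeasure d) F f, ?_,
    H F hFi hFq hF1 hF2 hF3, ?_⟩
  · rw [hF]; exact funext (conv_trigPoly hfi M c)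
  · calc _ ≤ eLpNorm (fun z => ∫⁻ w, ‖F w‖ₑ * torusSquareFunction f (z - w) ∂torusMeasure d) p
          (torusMeasure d) := by
          refine eLpNorm_mono_enorm fun z => ?_
          simp only [enorm_eq_self]
          simp_rw [torusSquareFunction_eq_l2]
          have h1 : ∀ J : intDyadicRectangles d, torusPartialSum (J : Set (Fin d → ℤ))
              (conv (torusMeasure d) F f) z =
              conv (torusMeasure d) F (torusPartialSum (J : Set (Fin d → ℤ)) f) z := fun J => by
            rw [hF]
            exact torusPartialSum_conv_trigPoly hfi M c (finite_of_mem_intDyadicRectangles J.2) z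
          simp_rw [h1]
          exact l2_conv_le hFi.1 (fun J => (continuous_torusPartialSum
            (finite_of_mem_intDyadicRectangles J.2) f).aestronglyMeasurable) z
      _ ≤ (∫⁻ w, ‖F w‖ₑ ∂torusMeasure d) * eLpNorm (torusSquareFunction f) p (torusMeasure d) :=
          eLpNorm_lconv_le hp1.le hp.ne hFi.1.enorm hFi.2.ne
            (measurable_torusSquareFunction f).aemeasurable
      _ ≤ _ := mul_le_of_le_one_left' hF2

lemma enorm_torusCoeff_le (hp1 : 1 ≤ p) {f : UnitAddTorus (Fin d) → ℂ}
    (hf : AEStronglyMeasurable f (torusMeasure d)) (m : Fin d → ℤ) :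
    ‖torusCoeff f m‖ₑ ≤ eLpNorm f p (torusMeasure d) := by
  refine (enorm_integral_le_lintegral_enorm _).trans ?_
  simp_rw [enorm_mul, enorm_mFourier_apply, mul_one]
  rw [← eLpNorm_one_eq_lintegral_enorm]
  exact eLpNorm_le_eLpNorm_of_exponent_le hp1 hf

/-- Lower semicontinuity of `f ↦ ‖S f‖_p` on `L_p(𝕋^d)`. -/
lemma eLpNorm_torusSquareFunction_le_liminf (hp1 : 1 < p) (hp : p < ∞) {f : UnitAddTorus (Fin d) → ℂ}
    {F : ℕ → UnitAddTorus (Fin d) → ℂ} (hf : MemLp f p (torusMeasure d))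
    (hF : ∀ n, MemLp (F n) p (torusMeasure d))
    (h : Tendsto (fun n => eLpNorm (fun x => F n x - f x) p (torusMeasure d)) atTop (𝓝 0)) :
    eLpNorm (torusSquareFunction f) p (torusMeasure d) ≤
      liminf (fun n => eLpNorm (torusSquareFunction (F n)) p (torusMeasure d)) atTop := by
  have hcoef : ∀ m, Tendsto (fun n => torusCoeff (F n) m) atTop (𝓝 (torusCoeff f m)) := fun m => by
    rw [tendsto_iff_edist_tendsto_0]
    refine tendsto_of_tendsto_of_tendsto_of_le_of_le tendsto_const_nhds h (fun _ => zero_le)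
      fun n => ?_
    have h1 : torusCoeff (F n) m - torusCoeff f m = torusCoeff (fun x => F n x - f x) m := by
      simp_rw [torusCoeff, sub_mul]
      exact (integral_sub (integrable_mul_mFourier ((hF n).integrable hp1.le) _)
        (integrable_mul_mFourier (hf.integrable hp1.le) _)).symm
    simp only [edist_eq_enorm_sub, h1]
    exact enorm_torusCoeff_le hp1.le ((hF n).sub hf).1 m
  refine eLpNorm_le_liminf (zero_lt_one.trans hp1).ne' hp.ne
    (fun n => (measurable_torusSquareFunction (F n)).aemeasurable) (Eventually.of_forall fun z => ?_)
  simp_rw [torusSquareFunction_eq_l2]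
  refine l2_le_liminf fun J => ?_
  simp_rw [torusPartialSum_eq_sum (finite_of_mem_intDyadicRectangles J.2)]
  refine (continuous_enorm.tendsto _).comp (tendsto_finsetSum _ fun m _ => ?_)
  exact (hcoef m).mul_const _

end Density

end DyadicLP

end

noncomputable section

namespace DyadicLP

open Filter Topology

/-! ### Equality of the best constants. -/

section Constants

variable {d : ℕ} {p : ℝ≥0∞}

lemma eLpNorm_le_add_eLpNorm_sub {X : Type*} [MeasurableSpace X] {μ : Measure X} (hp1 : 1 ≤ p)
    {f g : X → ℂ} (hf : AEStronglyMeasurable f μ) (hg : AEStronglyMeasurable g μ) :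
    eLpNorm g p μ ≤ eLpNorm f p μ + eLpNorm (fun x => g x - f x) p μ := by
  refine (le_of_eq ?_).trans (eLpNorm_add_le hf (hg.sub hf) hp1)
  congr 1
  ext x
  simp

lemma eLpNorm_le_add_eLpNorm_sub' {X : Type*} [MeasurableSpace X] {μ : Measure X} (hp1 : 1 ≤ p)
    {f g : X → ℂ} (hf : AEStronglyMeasurable f μ) (hg : AEStronglyMeasurable g μ) :
    eLpNorm f p μ ≤ eLpNorm g p μ + eLpNorm (fun x => g x - f x) p μ := by
  have h := eLpNorm_le_add_eLpNorm_sub hp1 hg hf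
  rwa [show (fun x => f x - g x) = f - g from rfl, eLpNorm_sub_comm] at h

lemma le_mul_of_le_liminf {C a b : ℝ≥0∞} (hC : C ≠ ∞) {u : ℕ → ℝ≥0∞} (h : a ≤ liminf u atTop)
    (hu : ∀ n : ℕ, u n ≤ C * (b + (n : ℝ≥0∞)⁻¹)) : a ≤ C * b := by
  have hlim : Tendsto (fun n : ℕ => C * (b + (n : ℝ≥0∞)⁻¹)) atTop (𝓝 (C * b)) := by
    have h2 := ENNReal.Tendsto.const_mul (a := C) (ENNReal.tendsto_inv_nat_nhds_zero.const_add b)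
      (Or.inr hC)
    simpa using h2
  exact h.trans ((liminf_le_liminf (Eventually.of_forall hu)).trans_eq hlim.liminf_eq)

lemma le_of_forall_approx {c a b : ℝ≥0∞} (hc : c ≠ ∞)
    (h : ∀ ε : ℝ≥0∞, ε ≠ 0 → c * a ≤ b + ε + c * ε) : c * a ≤ b := by
  refine ENNReal.le_of_forall_pos_le_add fun ε hε _ => ?_
  have h0 : 1 + c ≠ 0 := by simp
  have h1 : 1 + c ≠ ∞ := by simp [hc]
  have hε' : (ε : ℝ≥0∞) ≠ 0 := by exact_mod_cast hε.ne'
  refine (h (ε / (1 + c)) (ENNReal.div_ne_zero.2 ⟨hε', h1⟩)).trans_eq ?_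
  rw [add_assoc, ← one_add_mul, ENNReal.mul_div_cancel h0 h1]

/-- Lower semicontinuity of the square function norm suffices here: the square functions of the
approximants are bounded by the estimate itself. -/
theorem cotype_iff (hp1 : 1 < p) (hp : p < ∞) {C : ℝ≥0∞} (hC : C ≠ ∞) :
    (∀ f : EuclideanSpace ℝ (Fin d) → ℂ, MemLp f p volume →
      eLpNorm (squareFunction f) p volume ≤ C * eLpNorm f p volume) ↔
    ∀ f : UnitAddTorus (Fin d) → ℂ, MemLp f p (torusMeasure d) →
      eLpNorm (torusSquareFunction f) p (torusMeasure d) ≤ C * eLpNorm f p (torusMeasure d) := by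
  -- The tolerance is `∞` at `n = 0`, which is harmless since only the limit is used.
  have hinv : ∀ n : ℕ, (n : ℝ≥0∞)⁻¹ ≠ 0 := fun n => ENNReal.inv_ne_zero.2 (ENNReal.natCast_ne_top n)
  constructor
  · intro H f hf
    choose M a g hg hgf _ using fun n => exists_trigPoly_approx hp1 hp hf (hinv n)
    have hgm : ∀ n, MemLp (g n) p (torusMeasure d) := fun n => by
      rw [hg n]
      exact (continuous_mFourier_sum _ _).memLp_of_hasCompactSupport (HasCompactSupport.of_compactSpace _)
    refine le_mul_of_le_liminf hC (eLpNorm_torusSquareFunction_le_liminf hp1 hp hf hgm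
      (tendsto_of_tendsto_of_tendsto_of_le_of_le tendsto_const_nhds ENNReal.tendsto_inv_nat_nhds_zero
        (fun _ => zero_le) hgf)) fun n => ?_
    refine (eLpNorm_torusSquareFunction_trigPoly_le hp1 hp hC H (M n) (a n) (hg n)).trans ?_
    gcongr
    exact (eLpNorm_le_add_eLpNorm_sub hp1.le hf.1 (hgm n).1).trans (add_le_add_right (hgf n) _)
  · intro H f hf
    choose g hg hgm hgf _ using fun n => exists_wellLocalized_approx hp1 hp hf (hinv n)
    refine le_mul_of_le_liminf hC (eLpNorm_squareFunction_le_liminf hp1 hp hf hgm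
      (tendsto_of_tendsto_of_tendsto_of_le_of_le tendsto_const_nhds ENNReal.tendsto_inv_nat_nhds_zero
        (fun _ => zero_le) hgf)) fun n => ?_
    refine ((hg n).eLpNorm_squareFunction_le hp1.le hp.ne hC H).trans ?_
    gcongr
    exact (eLpNorm_le_add_eLpNorm_sub hp1.le hf.1 (hgm n).1).trans (add_le_add_right (hgf n) _)

/-- Here the square function is on the larger side, so the approximants need `‖S g‖_p ≤ ‖S f‖_p +
ε`. On `ℝ^d` the case of infinite `‖S f‖_p` is trivial and is set aside, because the decay of `S g`
depends on finiteness. -/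
theorem type_iff (hp1 : 1 < p) (hp : p < ∞) {c : ℝ≥0∞} (hc : c ≠ ∞) :
    (∀ f : EuclideanSpace ℝ (Fin d) → ℂ, MemLp f p volume →
      c * eLpNorm f p volume ≤ eLpNorm (squareFunction f) p volume) ↔
    ∀ f : UnitAddTorus (Fin d) → ℂ, MemLp f p (torusMeasure d) →
      c * eLpNorm f p (torusMeasure d) ≤ eLpNorm (torusSquareFunction f) p (torusMeasure d) := by
  constructor
  · intro H f hf
    refine le_of_forall_approx hc fun ε hε => ?_
    obtain ⟨M, a, g, hg, hgf, hS⟩ := exists_trigPoly_approx hp1 hp hf hε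
    have hgm : AEStronglyMeasurable g (torusMeasure d) := by
      rw [hg]
      exact (continuous_mFourier_sum _ _).aestronglyMeasurable
    calc c * eLpNorm f p (torusMeasure d)
        ≤ c * (eLpNorm g p (torusMeasure d) + ε) := by
          gcongr
          exact (eLpNorm_le_add_eLpNorm_sub' hp1.le hf.1 hgm).trans (add_le_add_right hgf _)
      _ = c * eLpNorm g p (torusMeasure d) + c * ε := mul_add _ _ _
      _ ≤ _ := by
          gcongr
          exact (mul_eLpNorm_trigPoly_le hp1 hp hc H M a hg).trans (hS.trans le_self_add)
  · intro H f hf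
    rcases eq_or_ne (eLpNorm (squareFunction f) p volume) ∞ with hS | hS
    · rw [hS]; exact le_top
    refine le_of_forall_approx hc fun ε hε => ?_
    obtain ⟨g, hg, hgm, hgf, hgS, hdec⟩ := exists_wellLocalized_approx hp1 hp hf hε
    obtain ⟨A, hA, hAS⟩ := hdec hS
    have hAS' : ∀ x, squareFunction g x ≤ ENNReal.ofReal A * weight x := fun x => by
      rw [weight, ← ENNReal.ofReal_mul hA]; exact hAS x
    calc c * eLpNorm f p volume ≤ c * (eLpNorm g p volume + ε) := by
          gcongr
          exact (eLpNorm_le_add_eLpNorm_sub' hp1.le hf.1 hgm.1).trans (add_le_add_right hgf _)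
      _ = c * eLpNorm g p volume + c * ε := mul_add _ _ _
      _ ≤ _ := by
          gcongr
          exact (hg.mul_eLpNorm_le hp1.le hp.ne hc H (by simp) hAS').trans hgS

lemma sInf_le_sInf_of_ne_top {P Q : ℝ≥0∞ → Prop} (h : ∀ C, C ≠ ∞ → P C → Q C) :
    sInf {C | Q C} ≤ sInf {C | P C} := by
  refine le_sInf fun C hC => ?_
  rcases eq_or_ne C ∞ with rfl | hC'
  · exact le_top
  · exact sInf_le (h C hC' hC)

/-- For `C = 0` the factor `C⁻¹` is infinite and the transfer does not apply. The set of admissible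
constants is closed upwards, so `C` is approached by larger, nonzero constants. -/
lemma sInf_le_sInf_of_ne_zero {P Q : ℝ≥0∞ → Prop} (hP : ∀ C C', C ≤ C' → P C → P C')
    (h : ∀ C, C ≠ 0 → P C → Q C) : sInf {C | Q C} ≤ sInf {C | P C} := by
  refine le_sInf fun C hC => le_of_forall_gt_imp_ge_of_dense fun C' hC' => ?_
  exact sInf_le (h C' (pos_of_gt hC').ne' (hP C C' hC'.le hC))

theorem cotypeConst_eq_torusCotypeConst (hp1 : 1 < p) (hp : p < ∞) (d : ℕ) :
    cotypeConst p d = torusCotypeConst p d :=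
  le_antisymm (sInf_le_sInf_of_ne_top fun _ hC h => (cotype_iff hp1 hp hC).2 h)
    (sInf_le_sInf_of_ne_top fun _ hC h => (cotype_iff hp1 hp hC).1 h)

theorem typeConst_eq_torusTypeConst (hp1 : 1 < p) (hp : p < ∞) (d : ℕ) :
    typeConst p d = torusTypeConst p d := by
  refine le_antisymm
    (sInf_le_sInf_of_ne_zero (fun C C' hCC h f hf => le_trans (by gcongr) (h f hf))
      fun C hC h => (type_iff hp1 hp (ENNReal.inv_ne_top.2 hC)).2 h)
    (sInf_le_sInf_of_ne_zero (fun C C' hCC h f hf => le_trans (by gcongr) (h f hf))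
      fun C hC h => (type_iff hp1 hp (ENNReal.inv_ne_top.2 hC)).1 h)

end Constants

end DyadicLP

end

theorem theorem1p4 (p : ℝ≥0∞) (hp : 1 < p) (hp_top : p < ∞) (d : ℕ) :
    DyadicLP.cotypeConst p d = DyadicLP.torusCotypeConst p d ∧
      DyadicLP.typeConst p d = DyadicLP.torusTypeConst p d :=
  ⟨DyadicLP.cotypeConst_eq_torusCotypeConst hp hp_top d,
    DyadicLP.typeConst_eq_torusTypeConst hp hp_top d⟩
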